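/- **Setting.** Let $\mathfrak g$ be a finite-dimensional Lie algebra over a field $\mathbb K$ with an embedding $\mathbb K\subset\mathbb C$ (e.g. $\mathbb R$ or $\mathbb C$), with basis $(t_i)$ and structure constants $[t_i,t_j]=\sum_k f^k_{ij}t_k$. Assume that $\mathfrak g$ is strongly unimodular: $\mathrm{tr}(\mathrm{ad}_{X_1}\cdots\mathrm{ad}_{X_k})=(-1)^k\,\mathrm{tr}(\mathrm{ad}_{X_k}\cdots\mathrm{ad}_{X_1})$ for all $X_1,\dots,X_k\in\mathfrak g$. The fundamental fields of two-dimensional $BF$ theory in Lorenz gauge are $a,\bar a,c$ ($\mathfrak g$-valued, $\mathcal{AB}$-charge $-1$) and $\gamma,\bar\gamma,b$ ($\mathfrak g^*$-valued, charge $+1$); $b,c$ are odd, the others even. The charge is unchanged by derivatives. Free correlators $\langle\cdots\rangle_0$ are given by Wick's lemma (with Koszul signs) with the graded symmetric propagators $$\langle a^i(w)\gamma_j(z)\rangle_0=\frac{\delta^i_j}{w-z},\quad \langle \bar a^i(w)\bar\gamma_j(z)\rangle_0=\frac{\delta^i_j}{\bar w-\bar z},\quad \langle c^i(w)b_j(z)\rangle_0=(2\log|w-z|+C)\,\delta^i_j,$$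 their derivatives $\langle c^i(w)\,\partial b_j(z)\rangle_0=\frac{\delta^i_j}{z-w}$, $\langle c^i(w)\,\bar\partial b_j(z)\rangle_0=\frac{\delta^i_j}{\bar z-\bar w}$, and all other propagators zero; $C$ is an arbitrary constant, and self-contractions at one point are given arbitrary constant values. Let $$V=\sum f^k_{ij}\big((\gamma-\bar\gamma)_k\,a^i\bar a^j+\partial b_k\,\bar a^ic^j+\bar\partial b_k\,a^ic^j\big).$$ Let $0\le R\le\infty$ and let $D_R=\{|u|<R\}$, so $D_\infty=\mathbb C$ (no infrared cut-off). If $\Phi_1,\dots,\Phi_n$ are components of fields from the list $a,\bar a,\gamma,\bar\gamma,c,b,\partial b,\bar\partial b$, and $z_1,\dots,z_n\in D_R$ are pairwise distinct, their correlator is the formal power series $$\langle\Phi_1(z_1)\cdots\Phi_n(z_n)\rangle=\sum_{N\ge0}\frac{g^N}{N!\,(2\pi)^N}\int_{D_R^N}d^2u_1\cdots d^2u_N\,\big\langle\Phi_1(z_1)\cdots\Phi_n(z_n)V(u_1)\cdots V(u_N)\big\rangle_0 .$$ For higher derivatives $\partial^{p}\bar\partial^{q}$ of these fields, the correlator is defined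 by applying $\partial_{z_i}^{p_i}\bar\partial_{z_i}^{q_i}$ to the correlator of the fields in the list; derivatives of $b$ are written as derivatives of $\partial b$ or $\bar\partial b$. A *diagram* $\Gamma$ with $N$ interaction vertices is a Wick contraction of $\Phi_1,\dots,\Phi_n$ and one cubic monomial of $V$ at each of the (labelled) points $u_1,\dots,u_N$, in which every contracted pair has a nonzero propagator. It is a graph with $n$ univalent fixed vertices and $N$ trivalent interaction vertices, each of which has two incoming half-edges (charge $-1$) and one outgoing half-edge (charge $+1$). Its *contribution* is $\frac{g^N}{N!\,(2\pi)^N}$ times the integral over $D_R^N$ of its term in the Wick expansion, to which the higher derivatives $\partial_{z_i}^{p_i}\bar\partial_{z_i}^{q_i}$, if any, are then applied. **Proposition.** Let $\Phi_1,\dots,\Phi_n$ be fundamental fields or derivatives of them of any order. 1. There are finitely many diagrams without cycles. Every connected component of such a diagram is a binary rooted tree: a tree with exactly one fixed vertex of charge $-1$ (the root), in which at each interaction vertex the outgoing half-edge leads towards the root and the two incoming ones away from it. 2. The number $N$ of interaction vertices of each diagram without cycles equals the total $\mathcal{AB}$-charge of $\Phi_1,\dots,\Phi_n$. All other powers of $g$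 have coefficient $0$ in the correlator. 3. The number of trees in each diagram without cycles equals the number of fields of charge $-1$ among $\Phi_1,\dots,\Phi_n$. 4. For every $N$ and almost every $(u_1,\dots,u_N)\in\mathbb C^N$, the full integrand of order $N$ (with each $\Phi_i$ replaced by the field of the list from which it is derived) equals the sum of the integrands of the diagrams without cycles. 5. Assume that $b$ never occurs without derivatives among the $\Phi_i$ (then $R=\infty$, with integrals over $\mathbb C^N$, is allowed), or that $R<\infty$. Then the integral over $D_R^N$ of every diagram without cycles (before the higher derivatives are applied) converges absolutely for all pairwise distinct $z_1,\dots,z_n\in D_R$ and is a $C^\infty$ function of $(z_1,\dots,z_n)$ there, and the correlator is the sum of the contributions of the diagrams without cycles. -/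

import Mathlib

noncomputable section

namespace BF

open MeasureTheory
open scoped ComplexConjugate ENNReal ContDiff

/-- The six fundamental fields of the gauge-fixed theory. -/
inductive Species
  | a | aBar | gamma | gammaBar | b | c

/-- The `AB`-charge. -/
def Species.charge : Species → ℤ
  | .a => -1
  | .aBar => -1
  | .c => -1
  | .gamma => 1
  | .gammaBar => 1
  | .b => 1

/-- The field `∂^p ∂̄^q φ`, with `φ` a fundamental field. -/
structure Insertion where
  species : Species
  p : ℕ
  q : ℕ

/-- The charge of a field does not change under differentiation. -/
def Insertion.charge (F : Insertion) : ℤ := F.species.charge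

/-- `F` is the ghost `b` without derivatives. -/
def Insertion.IsBareB (F : Insertion) : Prop := F = ⟨.b, 0, 0⟩

/-- The fields that sit on half-edges of Feynman graphs: the fundamental fields and the
first derivatives `db = ∂b`, `dbBar = ∂̄b` (which occur in the interaction). -/
inductive Letter
  | a | aBar | gamma | gammaBar | b | db | dbBar | c

/-- Odd fields: the ghosts. -/
def Letter.IsOdd : Letter → Prop
  | .b => True
  | .db => True
  | .dbBar => True
  | .c => True
  | _ => False

/-- The half-edge decoration of an inserted field; together with `Insertion.rest` it expresses the
inserted field as a derivative of a letter, a derivative of `b` being written as a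
derivative of `∂b` or `∂̄b`. -/
def Insertion.letter : Insertion → Letter
  | ⟨.a, _, _⟩ => .a
  | ⟨.aBar, _, _⟩ => .aBar
  | ⟨.gamma, _, _⟩ => .gamma
  | ⟨.gammaBar, _, _⟩ => .gammaBar
  | ⟨.c, _, _⟩ => .c
  | ⟨.b, 0, 0⟩ => .b
  | ⟨.b, 0, _ + 1⟩ => .dbBar
  | ⟨.b, _ + 1, _⟩ => .db

/-- The numbers `(p, q)` such that the inserted field is `∂^p ∂̄^q` of its letter. -/
def Insertion.rest : Insertion → ℕ × ℕ
  | ⟨.b, 0, 0⟩ => (0, 0)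
  | ⟨.b, 0, q + 1⟩ => (0, q)
  | ⟨.b, p + 1, q⟩ => (p, q)
  | ⟨_, p, q⟩ => (p, q)

/-- Pairs of fields with a nonzero propagator. -/
def Contractible : Letter → Letter → Prop
  | .a, .gamma => True
  | .gamma, .a => True
  | .aBar, .gammaBar => True
  | .gammaBar, .aBar => True
  | .c, .b => True
  | .b, .c => True
  | .c, .db => True
  | .db, .c => True
  | .c, .dbBar => True
  | .dbBar, .c => True
  | _, _ => False

/-- What the theory leaves undetermined: the additive constant `C` of the ghost propagator,
the radius `R ∈ [0, ∞]` of the disk over which interaction vertices are integrated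
(`R = ∞`: no infrared cut-off, `R < ∞`: infrared cut-off), and the values given to propagators at
coinciding points (they matter only for the self-contractions of an interaction vertex). -/
structure Scheme where
  C : ℂ
  R : ℝ≥0∞
  selfValue : Letter → Letter → ℂ

/-- The free two-point function `⟨x(w) y(z)⟩₀`, at `w ≠ z`, without its color factor. It is graded
symmetric; the entries with `∂b`, `∂̄b` are derivatives of `⟨c b⟩₀` and `⟨b c⟩₀`. -/
def green (C : ℂ) : Letter → Letter → ℂ → ℂ → ℂ
  | .a, .gamma, w, z => 1 / (w - z)
  | .gamma, .a, w, z => 1 / (z - w)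
  | .aBar, .gammaBar, w, z => 1 / (conj w - conj z)
  | .gammaBar, .aBar, w, z => 1 / (conj z - conj w)
  | .c, .b, w, z => 2 * (Real.log ‖w - z‖ : ℂ) + C
  | .b, .c, w, z => -(2 * (Real.log ‖z - w‖ : ℂ) + C)
  | .c, .db, w, z => 1 / (z - w)
  | .db, .c, w, z => -(1 / (w - z))
  | .c, .dbBar, w, z => 1 / (conj z - conj w)
  | .dbBar, .c, w, z => -(1 / (conj w - conj z))
  | _, _, _, _ => 0

open Classical in
/-- The propagator, with the values at coinciding points prescribed by the scheme. -/
def propagator (S : Scheme) (x y : Letter) (w z : ℂ) : ℂ :=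
  if w = z then (if Contractible x y then S.selfValue x y else 0) else green S.C x y w z

/-- The half-edges: one for each of `n` inserted fields, three for each of `N` interaction
vertices. For a vertex, the half-edge `0` is the outgoing one and `1`, `2` are incoming. -/
abbrev HalfEdge (n N : ℕ) := Fin n ⊕ Fin N × Fin 3

/-- The position of a half-edge in the product
`Φ₁(z₁) ⋯ Φₙ(zₙ) V(u₁) ⋯ V(u_N)`, every `V` being a cubic monomial. -/
def rank {n N : ℕ} : HalfEdge n N → ℕ
  | .inl i => i
  | .inr (k, s) => n + 3 * k + s

/-- Complete pairings of the elements of `H`, as involutions without fixed points. -/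
abbrev Pairing (H : Type) := {σ : Equiv.Perm H // (∀ h, σ (σ h) = h) ∧ ∀ h, σ h ≠ h}

section Wick

variable {n N : ℕ}

open Classical in
/-- The sign of a Wick contraction: `-1` to the number of crossings of odd chords. -/
def koszulSign (x : HalfEdge n N → Letter) (σ : Pairing (HalfEdge n N)) : ℂ :=
  (-1) ^ (Finset.univ.filter fun hk : HalfEdge n N × HalfEdge n N =>
    (x hk.1).IsOdd ∧ (x hk.2).IsOdd ∧ rank hk.1 < rank hk.2 ∧
      rank hk.2 < rank (σ.1 hk.1) ∧ rank (σ.1 hk.1) < rank (σ.1 hk.2)).card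

/-- The product of the propagators over the chords of a pairing. -/
def chordProduct (S : Scheme) (x : HalfEdge n N → Letter) (pt : HalfEdge n N → ℂ)
    (σ : Pairing (HalfEdge n N)) : ℂ :=
  ∏ h ∈ Finset.univ.filter fun h => rank h < rank (σ.1 h),
    propagator S (x h) (x (σ.1 h)) (pt h) (pt (σ.1 h))

open Classical in
/-- The color factor of a pairing: `1` if paired components have equal indices, else `0`. -/
def colorDelta {ι : Type*} (κ : HalfEdge n N → ι) (σ : Pairing (HalfEdge n N)) : ℂ :=
  if ∀ h, κ h = κ (σ.1 h) then 1 else 0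

/-- The free correlator of the component fields `x h` with index `κ h` at the points `pt h`, in the
order of `rank`, by Wick's lemma. -/
def freeCorrelator {ι : Type*} (S : Scheme) (x : HalfEdge n N → Letter) (κ : HalfEdge n N → ι)
    (pt : HalfEdge n N → ℂ) : ℂ :=
  ∑ σ : Pairing (HalfEdge n N), koszulSign x σ * chordProduct S x pt σ * colorDelta κ σ

end Wick

/-- The cubic monomials of the interaction
`⟨γ - γ̄, [a, ā]⟩ + ⟨∂b, [ā, c]⟩ + ⟨∂̄b, [a, c]⟩`. -/
inductive VertexKind
  | gamma | gammaBar | db | dbBar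
  deriving DecidableEq

instance : Fintype VertexKind where
  elems := {.gamma, .gammaBar, .db, .dbBar}
  complete := by intro x; cases x <;> simp

/-- The three factors of a cubic monomial. -/
def VertexKind.letter : VertexKind → Fin 3 → Letter
  | .gamma => ![.gamma, .a, .aBar]
  | .gammaBar => ![.gammaBar, .a, .aBar]
  | .db => ![.db, .aBar, .c]
  | .dbBar => ![.dbBar, .a, .c]

/-- The coefficient of a cubic monomial. -/
def VertexKind.sign : VertexKind → ℂ
  | .gammaBar => -1
  | _ => 1

section Correlator

variable {𝕜 L ι : Type*} [Field 𝕜] [Algebra 𝕜 ℂ] [LieRing L] [LieAlgebra 𝕜 L]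
  [Fintype ι] {n : ℕ}

/-- The structure constant `f^k_{ij}`, the component `k` of `[t_i, t_j]`. -/
def structConst (B : Module.Basis ι 𝕜 L) (k i j : ι) : ℂ :=
  algebraMap 𝕜 ℂ (B.repr ⁅B i, B j⁆ k)

/-- The fields on all half-edges, for given interaction monomials. -/
def letters (Φ : Fin n → Insertion) {N : ℕ} (ν : Fin N → VertexKind) : HalfEdge n N → Letter :=
  Sum.elim (fun i => (Φ i).letter) (fun ks => (ν ks.1).letter ks.2)

/-- The color indices on all half-edges. -/
def colors (e : Fin n → ι) {N : ℕ} (κ : Fin N → Fin 3 → ι) : HalfEdge n N → ι :=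
  Sum.elim e (fun ks => κ ks.1 ks.2)

/-- The points at which the half-edges sit. -/
def points (z : Fin n → ℂ) {N : ℕ} (u : Fin N → ℂ) : HalfEdge n N → ℂ :=
  Sum.elim z (fun ks => u ks.1)

/-- `⟨Φ₁(z₁) ⋯ Φₙ(zₙ) V(u₁) ⋯ V(u_N)⟩₀`, where `Φᵢ` is the component `e i` of the letter of the
`i`-th inserted field and
`V = f^k_{ij} ((γ - γ̄)_k a^i ā^j + ∂b_k ā^i c^j + ∂̄b_k a^i c^j)`. -/
def integrand (S : Scheme) (B : Module.Basis ι 𝕜 L) (Φ : Fin n → Insertion) (e : Fin n → ι)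
    (N : ℕ) (z : Fin n → ℂ) (u : Fin N → ℂ) : ℂ :=
  ∑ ν : Fin N → VertexKind, ∑ κ : Fin N → Fin 3 → ι,
    (∏ k, (ν k).sign * structConst B (κ k 0) (κ k 1) (κ k 2)) *
      freeCorrelator S (letters Φ ν) (colors e κ) (points z u)

/-- The integration domain for the positions of `N` interaction vertices; for `R = ∞` it is
`ℂ^N`. -/
def domain (S : Scheme) (N : ℕ) : Set (Fin N → ℂ) :=
  Set.univ.pi fun _ => Metric.eball (0 : ℂ) S.R

/-- The weight of a term with `N` interaction vertices in the expansion of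
`exp (g / (2π) ∫ d²u V(u))`, without `g ^ N`. -/
def expWeight (N : ℕ) : ℂ := 1 / (N.factorial : ℂ) * (1 / (2 * Real.pi)) ^ N

/-- The Wirtinger derivative in the variable `z i`. -/
def dz (i : Fin n) (F : (Fin n → ℂ) → ℂ) (z : Fin n → ℂ) : ℂ :=
  (fderiv ℝ F z (Pi.single i 1) - Complex.I * fderiv ℝ F z (Pi.single i Complex.I)) / 2

/-- The Wirtinger derivative in the variable conjugate to `z i`. -/
def dzBar (i : Fin n) (F : (Fin n → ℂ) → ℂ) (z : Fin n → ℂ) : ℂ :=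
  (fderiv ℝ F z (Pi.single i 1) + Complex.I * fderiv ℝ F z (Pi.single i Complex.I)) / 2

/-- The differential operator `∏ᵢ ∂ᵢ^pᵢ ∂̄ᵢ^qᵢ` that turns the letters into the inserted fields. -/
def derivatives (Φ : Fin n → Insertion) (F : (Fin n → ℂ) → ℂ) : (Fin n → ℂ) → ℂ :=
  (List.finRange n).foldr (fun i G => (dz i)^[(Φ i).rest.1] ((dzBar i)^[(Φ i).rest.2] G)) F

/-- The correlator `⟨Φ₁(z₁) ⋯ Φₙ(zₙ)⟩` of the non-abelian theory, for the components of the inserted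
fields with indices `e i`, as a power series in the coupling constant `g`. -/
def correlator (S : Scheme) (B : Module.Basis ι 𝕜 L) (Φ : Fin n → Insertion) (e : Fin n → ι)
    (z : Fin n → ℂ) : PowerSeries ℂ :=
  PowerSeries.mk fun N =>
    derivatives Φ (fun w => expWeight N * ∫ u in domain S N, integrand S B Φ e N w u) z

/-- Configurations of pairwise distinct points (inside the disk of radius `R`). -/
def conf (S : Scheme) (n : ℕ) : Set (Fin n → ℂ) :=
  {z | Function.Injective z ∧ ∀ i, z i ∈ Metric.eball (0 : ℂ) S.R}

/-- A Feynman diagram with `N` interaction vertices: its half-edges are decorated by fields, and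
paired so that only fields with a nonzero propagator are joined. -/
structure Diagram (Φ : Fin n → Insertion) (N : ℕ) where
  kind : Fin N → VertexKind
  pairing : Pairing (HalfEdge n N)
  admissible : ∀ h, Contractible (letters Φ kind h) (letters Φ kind (pairing.1 h))

open Classical in
instance (Φ : Fin n → Insertion) (N : ℕ) : Fintype (Diagram Φ N) :=
  Fintype.ofInjective (fun Γ => (Γ.kind, Γ.pairing)) (by
    rintro ⟨ν, σ, h⟩ ⟨ν', σ', h'⟩ heq
    simp only [Prod.mk.injEq] at heq
    obtain ⟨rfl, rfl⟩ := heq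
    rfl)

namespace Diagram

variable {Φ : Fin n → Insertion} {N : ℕ}

/-- The product of the structure constants at the vertices, contracted along the edges. -/
def colorFactor (B : Module.Basis ι 𝕜 L) (e : Fin n → ι) (Γ : Diagram Φ N) : ℂ :=
  ∑ κ : Fin N → Fin 3 → ι,
    (∏ k, structConst B (κ k 0) (κ k 1) (κ k 2)) * colorDelta (colors e κ) Γ.pairing

/-- The integrand of a diagram: signs, color factor and the product of the propagators over the
edges. -/
def integrand (S : Scheme) (B : Module.Basis ι 𝕜 L) (e : Fin n → ι) (Γ : Diagram Φ N)
    (z : Fin n → ℂ) (u : Fin N → ℂ) : ℂ :=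
  (∏ k, (Γ.kind k).sign) * koszulSign (letters Φ Γ.kind) Γ.pairing * Γ.colorFactor B e *
    chordProduct S (letters Φ Γ.kind) (points z u) Γ.pairing

/-- The integral of a diagram, before the remaining derivatives in the `z i` are applied. -/
def integral (S : Scheme) (B : Module.Basis ι 𝕜 L) (e : Fin n → ι) (Γ : Diagram Φ N)
    (z : Fin n → ℂ) : ℂ :=
  expWeight N * ∫ u in domain S N, Γ.integrand S B e z u

/-- The contribution of a diagram to the correlator, as a monomial in `g`. -/
def contribution (S : Scheme) (B : Module.Basis ι 𝕜 L) (e : Fin n → ι) (Γ : Diagram Φ N)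
    (z : Fin n → ℂ) : PowerSeries ℂ :=
  PowerSeries.monomial N (derivatives Φ (Γ.integral S B e) z)

/-- The nodes of the graph of a diagram: the half-edges and the interaction vertices. A fixed
vertex is univalent and is identified with its half-edge. -/
abbrev Node (n N : ℕ) := HalfEdge n N ⊕ Fin N

/-- The graph of a diagram, with every edge subdivided into its two half-edges (so that
multiple edges and self-contractions are seen): a half-edge is adjacent to the half-edge it is paired
with, and to its interaction vertex. -/
def graph (Γ : Diagram Φ N) : SimpleGraph (Node n N) :=
  SimpleGraph.fromRel fun x y =>
    match x, y with
    | .inl h, .inl h' => Γ.pairing.1 h = h'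
    | .inl (.inr (k, _)), .inr k' => k = k'
    | _, _ => False

/-- The diagram has no cycle. -/
def IsForest (Γ : Diagram Φ N) : Prop := Γ.graph.IsAcyclic

/-- A connected component that is a binary rooted tree: it is a tree with exactly one fixed vertex
of charge `-1`, the root, and at every interaction vertex the outgoing half-edge leads towards the
root and the two incoming half-edges lead away from it. -/
def IsBinaryRootedTree (Γ : Diagram Φ N) (T : Γ.graph.ConnectedComponent) : Prop :=
  (Γ.graph.induce T.supp).IsTree ∧
    ∃ r : Fin n, (Φ r).charge = -1 ∧ Sum.inl (Sum.inl r) ∈ T.supp ∧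
      (∀ i : Fin n, Sum.inl (Sum.inl i) ∈ T.supp → (Φ i).charge = -1 → i = r) ∧
      ∀ k : Fin N, Sum.inr k ∈ T.supp →
        Γ.graph.dist (Sum.inl (Sum.inr (k, 0))) (Sum.inl (Sum.inl r)) + 1 =
          Γ.graph.dist (Sum.inr k) (Sum.inl (Sum.inl r)) ∧
        ∀ s : Fin 3, s ≠ 0 →
          Γ.graph.dist (Sum.inl (Sum.inr (k, s))) (Sum.inl (Sum.inl r)) =
            Γ.graph.dist (Sum.inr k) (Sum.inl (Sum.inl r)) + 1

end Diagram

end Correlator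

/-- Strong unimodularity: `tr (ad X₁ ⋯ ad X_k) = (-1)^k tr (ad X_k ⋯ ad X₁)` for all `X₁, …, X_k`. -/
def StronglyUnimodular (𝕜 L : Type*) [Field 𝕜] [LieRing L] [LieAlgebra 𝕜 L] : Prop :=
  ∀ X : List L,
    LinearMap.trace 𝕜 L (X.map fun x => (LieAlgebra.ad 𝕜 L x : Module.End 𝕜 L)).prod =
      (-1) ^ X.length *
        LinearMap.trace 𝕜 L (X.reverse.map fun x => (LieAlgebra.ad 𝕜 L x : Module.End 𝕜 L)).prod

end BF

end

/-!
Every edge of a diagram is oriented from its end of charge `+1` to its end of charge `-1`. An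
interaction vertex has one outgoing half-edge, so the orientation is given by a parent map on the
nodes, `Diagram.parent`, whose fixed points are the fixed vertices of charge `-1`. The diagram has
no cycle if and only if these are the only periodic points (`Diagram.isForest_iff`); each
component then consists of the nodes that are led to one root, and the distance to the root is the
number of steps of the parent map (`Diagram.IsForest.isBinaryRootedTree`,
`Diagram.IsForest.card_connectedComponent`). Adding up the charges of all half-edges, which cancel
in pairs, gives the number of vertices (`Diagram.card_vertices`).

The diagrams with cycles cancel. If a vertex is contracted with itself, the color factor contains
the trace of an adjoint operator, which is zero (`colorFactor_eq_zero`). Otherwise there is a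
directed loop (`Diagram.exists_isLoop`), on which the lines are all bosonic or all ghosts.
`Diagram.flip` reverses the loop and exchanges the two cases. The propagators along the loop do not
change, because the propagator of `γ` (or `γ̄`) with `a` (or `ā`) in one direction is that of `∂b`
(or `∂̄b`) with `c` in the other; the ghost loop has an additional sign `-1`
(`Diagram.wickSign_flip`); and the color factors are traces of products of adjoint operators in
opposite orders, which agree up to a sign by strong unimodularity (`Diagram.colorFactor_flip`). So
the two integrands add up to zero, and reversing the loop that contains the smallest vertex lying on
any loop is an involution of the diagrams with loops (`Diagram.sum_integrand_eq`). All of this needs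
the points to be distinct, which they are almost everywhere (`ae_injective`).

For the convergence of the integral of a forest, propagators are bounded by multiples of the inverse
distance; for the logarithm this requires a bounded domain. The vertices are integrated out one
after the other, beginning with those farthest from the root. A branch that has been integrated out
is bounded by a sum of powers `|w - zᵢ|^(-(1 - m ε))` over its leaves `zᵢ`, where `m` is the number
of its vertices and `ε = 1 / (N + 1)`. One more vertex joins two such branches with an inverse
distance; the convolution is again of this form, because the leaves of the two branches are
different points (`exists_vertex_bound`). The loss of `ε` per vertex keeps all integrals convergent
at infinity (`Diagram.IsForest.lintegral_prod_K_lt_top`).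

The integrand cannot be differentiated under the integral sign, since this makes its singularities
stronger. Instead, the vertices are moved along with the fixed points, by diffeomorphisms
`shift χ t` of the disk that take `zᵢ` to `zᵢ + tᵢ`. They multiply each difference of two points by
a factor `1 + ∑ i, tᵢ qᵢ` with a bounded difference quotient `q`. The transformed integrand is
therefore the product of a fixed integrable weight and a smooth function of `t` and of bounded
functions of the positions, and its integral depends smoothly on `t` (`contDiffAt_integral_smul`,
`Diagram.IsForest.contDiffAt_integral`). Hence the derivatives of the correlator can be taken term
by term.
-/

noncomputable section

namespace BF

section ParentMap

/-! ### Graphs of parent maps -/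

variable {X : Type*} {G : SimpleGraph X} {P : X → X}

/- A map `P` on the nodes of a graph `G` is viewed as a parent map: `hG` says that the edges of `G`
join the nodes to their parents, and `hP` that the only cycles of `P` are its fixed points, the
roots. -/

theorem isPeriodicPt_of_iterate_eq {x : X} {i j : ℕ} (h : P^[i] x = P^[j] x) (hij : i < j) :
    P^[i] x ∈ Function.periodicPts P := by
  refine Function.mk_mem_periodicPts (n := j - i) (by omega) ?_
  unfold Function.IsPeriodicPt Function.IsFixedPt
  rw [← Function.iterate_add_apply, Nat.sub_add_cancel hij.le, h]

theorem exists_iterate_fixed [Finite X] (hP : ∀ x ∈ Function.periodicPts P, P x = x) (x : X) :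
    ∃ i, P (P^[i] x) = P^[i] x := by
  obtain ⟨i, j, hne, h⟩ := Finite.exists_ne_map_eq_of_infinite (fun i : ℕ => P^[i] x)
  rcases lt_or_gt_of_ne hne with hij | hij
  · exact ⟨i, hP _ (isPeriodicPt_of_iterate_eq h hij)⟩
  · exact ⟨j, hP _ (isPeriodicPt_of_iterate_eq h.symm hij)⟩

open Classical in
/-- The number of steps from `x` to a fixed point of the parent map (`0` if there is none). -/
def depth (P : X → X) (x : X) : ℕ :=
  if h : ∃ i, P (P^[i] x) = P^[i] x then Nat.find h else 0

/-- The fixed point of the parent map that is reached from `x`. -/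
def rootOf (P : X → X) (x : X) : X := P^[depth P x] x

section

variable [Finite X] (hP : ∀ x ∈ Function.periodicPts P, P x = x)
include hP

theorem parent_rootOf (x : X) : P (rootOf P x) = rootOf P x := by
  classical
  have h := exists_iterate_fixed hP x
  unfold rootOf depth
  rw [dif_pos h]
  exact Nat.find_spec h

theorem depth_of_ne {x : X} (hx : P x ≠ x) : depth P x = depth P (P x) + 1 := by
  classical
  have h := exists_iterate_fixed hP x
  have h' := exists_iterate_fixed hP (P x)
  unfold depth
  rw [dif_pos h, dif_pos h']
  exact Nat.find_comp_succ (p := fun i => P (P^[i] x) = P^[i] x) h h' hx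

omit [Finite X] hP in
theorem depth_of_eq {x : X} (hx : P x = x) : depth P x = 0 := by
  classical
  unfold depth
  rw [dif_pos ⟨0, hx⟩]
  exact (Nat.find_eq_zero _).2 hx

theorem rootOf_parent (x : X) : rootOf P (P x) = rootOf P x := by
  by_cases hx : P x = x
  · rw [hx]
  · unfold rootOf
    rw [depth_of_ne hP hx, Function.iterate_succ_apply]

omit [Finite X] hP in
theorem rootOf_of_eq {x : X} (hx : P x = x) : rootOf P x = x := by
  simp [rootOf, depth_of_eq hx]

end

section

variable (hG : ∀ x y, G.Adj x y ↔ x ≠ y ∧ (P x = y ∨ P y = x))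
include hG

theorem reachable_iterate (x : X) (i : ℕ) : G.Reachable x (P^[i] x) := by
  induction i with
  | zero => exact SimpleGraph.Reachable.refl _
  | succ i ih =>
    rw [Function.iterate_succ_apply']
    by_cases h : P^[i] x = P (P^[i] x)
    · rw [← h]; exact ih
    · exact ih.trans ((hG _ _).2 ⟨h, Or.inl rfl⟩).reachable

/-- A directed cycle of length at least three is a cycle of the graph: the path along its remaining
edges shows that none of its edges is a bridge. -/
theorem not_isAcyclic_of_minimalPeriod {x : X} (hx : 3 ≤ Function.minimalPeriod P x) :
    ¬ G.IsAcyclic := by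
  intro hac
  set m := Function.minimalPeriod P x with hm
  have hinj : ∀ i < m, ∀ j < m, P^[i] x = P^[j] x → i = j := fun i hi j hj h =>
    (Function.iterate_eq_iterate_iff_of_lt_minimalPeriod hi hj).1 h
  have hadj : G.Adj x (P x) := (hG _ _).2
    ⟨fun h => by have := hinj 0 (by omega) 1 (by omega) (by simpa using h); omega, Or.inl rfl⟩
  have hb := SimpleGraph.isAcyclic_iff_forall_adj_isBridge.1 hac hadj
  rw [SimpleGraph.isBridge_iff] at hb
  apply hb
  have key : ∀ i, i + 1 ≤ m →
      (G \ SimpleGraph.fromEdgeSet {s(x, P x)}).Reachable (P x) (P^[i + 1] x) := by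
    intro i
    induction i with
    | zero => intro _; exact SimpleGraph.Reachable.refl _
    | succ i ih =>
      intro hi
      refine (ih (by omega)).trans (SimpleGraph.Adj.reachable ?_)
      have e1 : P^[i + 1 + 1] x = P (P^[i + 1] x) := Function.iterate_succ_apply' _ _ _
      have hne : P^[i + 1] x ≠ P^[i + 1 + 1] x := by
        intro h
        by_cases hi' : i + 1 + 1 = m
        · rw [hi', hm, Function.iterate_minimalPeriod] at h
          have := hinj (i + 1) (by omega) 0 (by omega) h
          omega
        · have := hinj _ (by omega) _ (by omega) h
          omega
      rw [SimpleGraph.sdiff_adj]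
      refine ⟨(hG _ _).2 ⟨hne, Or.inl e1.symm⟩, ?_⟩
      rw [SimpleGraph.fromEdgeSet_adj]
      rintro ⟨h, -⟩
      rw [Set.mem_singleton_iff, Sym2.eq_iff] at h
      have h0 : P^[i + 1] x ≠ x := fun h => by
        have := hinj (i + 1) (by omega) 0 (by omega) h
        omega
      rcases h with ⟨h, -⟩ | ⟨h, h2⟩
      · exact h0 h
      · have := hinj (i + 1) (by omega) 1 (by omega) h
        have hi0 : i = 0 := by omega
        subst hi0
        have h3 : 2 = m := by
          by_contra h3
          have := hinj 2 (by omega) 0 (by omega) h2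
          omega
        omega
  have := key (m - 1) (by omega)
  rw [Nat.sub_add_cancel (by omega), hm, Function.iterate_minimalPeriod] at this
  exact this.symm

/-- Without directed cycles, every edge is a bridge: it separates the descendants of its lower end
from the other nodes. -/
theorem isAcyclic_of_periodicPts (hP : ∀ x ∈ Function.periodicPts P, P x = x) :
    G.IsAcyclic := by
  rw [SimpleGraph.isAcyclic_iff_forall_adj_isBridge]
  have key : ∀ x, x ≠ P x → G.IsBridge s(x, P x) := by
    intro x hx
    rw [SimpleGraph.isBridge_iff]
    rintro ⟨w⟩
    have inv : ∀ a b (w : (G \ SimpleGraph.fromEdgeSet {s(x, P x)}).Walk a b),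
        (∃ j, P^[j] a = x) → ∃ j, P^[j] b = x := by
      intro a b w
      induction w with
      | nil => exact id
      | cons h w ih =>
        rename_i u v _
        rintro ⟨j, hj⟩
        apply ih
        rw [SimpleGraph.sdiff_adj, SimpleGraph.fromEdgeSet_adj, hG] at h
        obtain ⟨⟨hne, h1⟩, h2⟩ := h
        rcases h1 with h1 | h1
        · cases j with
          | zero =>
            exfalso
            apply h2
            simp only [Function.iterate_zero, id_eq] at hj
            subst hj
            subst h1
            exact ⟨rfl, hne⟩
          | succ j => exact ⟨j, by rw [← h1, ← Function.iterate_succ_apply, hj]⟩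
        · exact ⟨j + 1, by rw [Function.iterate_succ_apply, h1, hj]⟩
    obtain ⟨j, hj⟩ := inv _ _ w ⟨0, rfl⟩
    apply hx
    refine (hP x (Function.mk_mem_periodicPts (n := j + 1) (by omega) ?_)).symm
    exact hj
  intro x y hxy
  obtain ⟨hne, h | h⟩ := (hG x y).1 hxy
  · subst h; exact key x hne
  · subst h; rw [Sym2.eq_swap]; exact key y hne.symm

variable [Finite X] (hP : ∀ x ∈ Function.periodicPts P, P x = x)
include hP

theorem rootOf_eq_of_adj {x y : X} (h : G.Adj x y) : rootOf P x = rootOf P y := by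
  obtain ⟨-, h | h⟩ := (hG x y).1 h
  · rw [← h, rootOf_parent hP]
  · rw [← h, rootOf_parent hP]

theorem reachable_iff_rootOf {x y : X} : G.Reachable x y ↔ rootOf P x = rootOf P y := by
  constructor
  · rintro ⟨w⟩
    induction w with
    | nil => rfl
    | cons h w ih => rw [rootOf_eq_of_adj hG hP h, ih]
  · intro h
    have h1 : G.Reachable x (rootOf P x) := reachable_iterate hG x _
    have h2 : G.Reachable y (rootOf P y) := reachable_iterate hG y _
    rw [← h] at h2
    exact h1.trans h2.symm

/-- The depth changes by at most one along an edge, so no path to the root is shorter than the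
one along the parent map. -/
theorem dist_rootOf (x : X) : G.dist x (rootOf P x) = depth P x := by
  apply le_antisymm
  · have : ∀ d x, depth P x = d → ∃ w : G.Walk x (rootOf P x), w.length = d := by
      intro d
      induction d with
      | zero =>
        intro x hx
        have : rootOf P x = x := by simp [rootOf, hx]
        rw [this]
        exact ⟨.nil, rfl⟩
      | succ d ih =>
        intro x hx
        have hne : P x ≠ x := fun h => by rw [depth_of_eq h] at hx; omega
        have h1 := depth_of_ne hP hne
        have h2 := ih (P x) (by omega)
        rw [rootOf_parent hP] at h2
        obtain ⟨w, hw⟩ := h2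
        exact ⟨.cons ((hG _ _).2 ⟨hne.symm, Or.inl rfl⟩) w, by simp [hw]⟩
    obtain ⟨w, hw⟩ := this _ x rfl
    rw [← hw]
    exact SimpleGraph.dist_le w
  · obtain ⟨w, hw⟩ := (reachable_iterate hG x (depth P x)).exists_walk_length_eq_dist
    have : ∀ a b (w : G.Walk a b), depth P a ≤ depth P b + w.length := by
      intro a b w
      induction w with
      | nil => simp
      | cons h w ih =>
        rename_i u v _
        have : depth P u ≤ depth P v + 1 := by
          obtain ⟨hne, h | h⟩ := (hG u v).1 h
          · rw [← h] at hne ⊢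
            rw [depth_of_ne hP hne.symm]
          · rw [← h] at hne ⊢
            rw [depth_of_ne hP hne]; omega
        rw [SimpleGraph.Walk.length_cons]
        omega
    have h2 := this _ _ w
    have h3 : depth P (P^[depth P x] x) = 0 := depth_of_eq (parent_rootOf hP x)
    rw [h3, hw, zero_add] at h2
    exact h2

/-- Every connected component contains exactly one fixed point of the parent map. -/
theorem card_connectedComponent :
    Nat.card G.ConnectedComponent = Nat.card {x // P x = x} := by
  refine (Nat.card_congr (Equiv.ofBijective (fun r : {x // P x = x} =>
    G.connectedComponentMk r.1) ⟨?_, ?_⟩)).symm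
  · rintro ⟨x, hx⟩ ⟨y, hy⟩ h
    have := (reachable_iff_rootOf hG hP).1 (SimpleGraph.ConnectedComponent.eq.1 h)
    rw [rootOf_of_eq hx, rootOf_of_eq hy] at this
    exact Subtype.ext this
  · intro T
    induction T using SimpleGraph.ConnectedComponent.ind with
    | h x =>
      refine ⟨⟨rootOf P x, parent_rootOf hP x⟩, SimpleGraph.ConnectedComponent.eq.2 ?_⟩
      exact (reachable_iterate hG x _).symm

end

end ParentMap

/-! ### Charges and the forest structure -/

/-- The charge of a letter; derivatives do not change the charge. -/
def Letter.charge : Letter → ℤ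
  | .a => -1
  | .aBar => -1
  | .c => -1
  | .gamma => 1
  | .gammaBar => 1
  | .b => 1
  | .db => 1
  | .dbBar => 1

theorem Letter.charge_eq (x : Letter) : x.charge = 1 ∨ x.charge = -1 := by
  cases x <;> simp [Letter.charge]

theorem Contractible.charge_eq {x y : Letter} (h : Contractible x y) : y.charge = -x.charge := by
  cases x <;> cases y <;> simp_all [Contractible, Letter.charge]

theorem Contractible.symm {x y : Letter} (h : Contractible x y) : Contractible y x := by
  cases x <;> cases y <;> simp_all [Contractible]

theorem Insertion.charge_letter (F : Insertion) : F.letter.charge = F.charge := by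
  obtain ⟨s, p, q⟩ := F
  cases s <;> cases p <;> cases q <;>
    simp [Insertion.letter, Letter.charge, Insertion.charge, Species.charge]

theorem VertexKind.charge_letter_zero (ν : VertexKind) : (ν.letter 0).charge = 1 := by
  cases ν <;> simp [VertexKind.letter, Letter.charge]

theorem VertexKind.charge_letter_of_ne (ν : VertexKind) {s : Fin 3} (hs : s ≠ 0) :
    (ν.letter s).charge = -1 := by
  fin_cases s
  · exact absurd rfl hs
  all_goals cases ν <;> simp [VertexKind.letter, Letter.charge]

section

variable {n N : ℕ} {Φ : Fin n → Insertion}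

theorem Pairing.apply_apply {H : Type} (σ : Pairing H) (h : H) : σ.1 (σ.1 h) = h := σ.2.1 h

theorem Pairing.apply_ne {H : Type} (σ : Pairing H) (h : H) : σ.1 h ≠ h := σ.2.2 h

/-- The charge of the field on a half-edge does not depend on the monomials at the vertices. -/
def hCharge (Φ : Fin n → Insertion) : HalfEdge n N → ℤ
  | .inl i => (Φ i).charge
  | .inr (_, s) => if s = 0 then 1 else -1

theorem charge_letters (ν : Fin N → VertexKind) (h : HalfEdge n N) :
    (letters Φ ν h).charge = hCharge Φ h := by
  rcases h with i | ⟨k, s⟩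
  · exact Insertion.charge_letter _
  · by_cases hs : s = 0
    · subst hs
      simpa [hCharge, letters] using VertexKind.charge_letter_zero _
    · simpa [hCharge, letters, hs] using VertexKind.charge_letter_of_ne _ hs

theorem hCharge_eq (h : HalfEdge n N) : hCharge Φ h = 1 ∨ hCharge Φ h = -1 := by
  rw [← charge_letters (fun _ => .gamma)]
  exact Letter.charge_eq _

namespace Diagram

variable (Γ : Diagram Φ N)

theorem hCharge_pairing (h : HalfEdge n N) : hCharge Φ (Γ.pairing.1 h) = -hCharge Φ h := by
  rw [← charge_letters Γ.kind, ← charge_letters Γ.kind]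
  exact (Γ.admissible h).charge_eq

/-- Both ends of an edge have opposite charges, so the total charge of all half-edges vanishes. -/
theorem card_vertices (Γ : Diagram Φ N) : (N : ℤ) = ∑ i, (Φ i).charge := by
  have h1 : ∑ h : HalfEdge n N, hCharge Φ h = -∑ h : HalfEdge n N, hCharge Φ h := by
    conv_lhs => rw [← Equiv.sum_comp Γ.pairing.1]
    rw [← Finset.sum_neg_distrib]
    exact Finset.sum_congr rfl fun h _ => Γ.hCharge_pairing h
  have h2 : ∑ h : HalfEdge n N, hCharge Φ h = ∑ i, (Φ i).charge - N := by
    rw [Fintype.sum_sum_type, Fintype.sum_prod_type]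
    simp [hCharge, Fin.sum_univ_three]
    ring
  omega

/-- The next node in the direction of the orientation, from charge `+1` to charge `-1` along edges
and from the incoming to the outgoing half-edges at vertices; fixed vertices of charge `-1` are
sinks. -/
def parent (Γ : Diagram Φ N) : Node n N → Node n N
  | .inl (.inl i) => if (Φ i).charge = 1 then .inl (Γ.pairing.1 (.inl i)) else .inl (.inl i)
  | .inl (.inr (k, s)) => if s = 0 then .inl (Γ.pairing.1 (.inr (k, s))) else .inr k
  | .inr k => .inl (.inr (k, 0))

theorem parent_of_charge {h : HalfEdge n N} (hh : hCharge Φ h = 1) :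
    Γ.parent (.inl h) = .inl (Γ.pairing.1 h) := by
  rcases h with i | ⟨k, s⟩
  · simp only [hCharge] at hh; simp [parent, hh]
  · simp only [hCharge] at hh
    have : s = 0 := by by_contra h; simp [h] at hh
    simp [parent, this]

theorem parent_inr (k : Fin N) : Γ.parent (.inr k) = .inl (.inr (k, 0)) := rfl

theorem parent_incoming (k : Fin N) {s : Fin 3} (hs : s ≠ 0) :
    Γ.parent (.inl (.inr (k, s))) = .inr k := by simp [parent, hs]

theorem parent_root {i : Fin n} (hi : (Φ i).charge = -1) :
    Γ.parent (.inl (.inl i)) = .inl (.inl i) := by simp [parent, hi]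

theorem parent_eq_self {x : Node n N} :
    Γ.parent x = x ↔ ∃ i, (Φ i).charge = -1 ∧ x = .inl (.inl i) := by
  constructor
  · intro h
    rcases x with h' | k
    · rcases hCharge_eq (Φ := Φ) h' with hc | hc
      · rw [Γ.parent_of_charge hc] at h
        exact absurd (Sum.inl_injective h) (Γ.pairing.apply_ne _)
      · rcases h' with i | ⟨k, s⟩
        · exact ⟨i, hc, rfl⟩
        · have hs : s ≠ 0 := by rintro rfl; simp [hCharge] at hc
          rw [Γ.parent_incoming k hs] at h
          cases h
    · cases h
  · rintro ⟨i, hi, rfl⟩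
    exact Γ.parent_root hi

/-- The edges of the graph of a diagram are those of its parent map: at every edge, and at every
half-edge of a vertex, exactly one of the two directions agrees with the orientation. -/
theorem graph_adj (x y : Node n N) :
    Γ.graph.Adj x y ↔ x ≠ y ∧ (Γ.parent x = y ∨ Γ.parent y = x) := by
  unfold graph
  rw [SimpleGraph.fromRel_adj]
  refine and_congr_right fun hne => ?_
  have hσ : ∀ h h' : HalfEdge n N, Γ.pairing.1 h = h' →
      Γ.parent (.inl h) = .inl h' ∨ Γ.parent (.inl h') = .inl h := by
    rintro h h' rfl
    rcases hCharge_eq (Φ := Φ) h with hc | hc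
    · exact Or.inl (Γ.parent_of_charge hc)
    · right
      rw [Γ.parent_of_charge (by rw [Γ.hCharge_pairing, hc]; rfl), Γ.pairing.apply_apply]
  have hP : ∀ x y, x ≠ y → Γ.parent x = y →
      (match x, y with
      | .inl h, .inl h' => Γ.pairing.1 h = h'
      | .inl (.inr (k, _)), .inr k' => k = k'
      | _, _ => False) ∨ (match y, x with
      | .inl h, .inl h' => Γ.pairing.1 h = h'
      | .inl (.inr (k, _)), .inr k' => k = k'
      | _, _ => False) := by
    intro x y hne h
    rcases x with h' | k
    · rcases hCharge_eq (Φ := Φ) h' with hc | hc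
      · rw [Γ.parent_of_charge hc] at h
        subst h
        exact Or.inl rfl
      · rcases h' with i | ⟨k, s⟩
        · rw [Γ.parent_root hc] at h; exact absurd h hne
        · have hs : s ≠ 0 := by rintro rfl; simp [hCharge] at hc
          rw [Γ.parent_incoming k hs] at h
          subst h
          exact Or.inl rfl
    · rw [parent_inr] at h
      subst h
      exact Or.inr rfl
  constructor
  · have key : ∀ x y : Node n N, (match x, y with
      | .inl h, .inl h' => Γ.pairing.1 h = h'
      | .inl (.inr (k, _)), .inr k' => k = k'
      | _, _ => False) → Γ.parent x = y ∨ Γ.parent y = x := by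
      intro x y h
      rcases x with (i | ⟨k, s⟩) | k <;> rcases y with (i' | ⟨k', s'⟩) | k'
      · exact hσ _ _ h
      · exact hσ _ _ h
      · exact h.elim
      · exact hσ _ _ h
      · exact hσ _ _ h
      · obtain rfl : k = k' := h
        by_cases hs : s = 0
        · subst hs; exact Or.inr rfl
        · exact Or.inl (Γ.parent_incoming k hs)
      all_goals exact h.elim
    rintro (h | h)
    · exact key _ _ h
    · exact (key _ _ h).symm
  · rintro (h | h)
    · exact hP _ _ hne h
    · exact (hP _ _ hne.symm h).symm

/-- The orientation has no directed cycle of length two. -/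
theorem parent_parent_ne {x : Node n N} (hx : Γ.parent x ≠ x) : Γ.parent (Γ.parent x) ≠ x := by
  intro h
  have hadj : ∀ k : Fin N, Γ.parent (Γ.parent (.inr k)) ≠ .inr k := by
    intro k h
    rw [parent_inr, Γ.parent_of_charge (by simp [hCharge])] at h
    cases h
  rcases x with h' | k
  · rcases hCharge_eq (Φ := Φ) h' with hc | hc
    · rw [Γ.parent_of_charge hc] at h
      have hc' := Γ.hCharge_pairing h'
      rw [hc] at hc'
      rcases hh : Γ.pairing.1 h' with i | ⟨k, s⟩
      · rw [hh] at h hc'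
        rw [Γ.parent_root hc'] at h
        exact Γ.pairing.apply_ne h' (hh.trans (Sum.inl_injective h))
      · rw [hh] at h hc'
        have hs : s ≠ 0 := by rintro rfl; simp [hCharge] at hc'
        rw [Γ.parent_incoming k hs] at h
        cases h
    · rcases h' with i | ⟨k, s⟩
      · exact hx (Γ.parent_root hc)
      · have hs : s ≠ 0 := by rintro rfl; simp [hCharge] at hc
        rw [Γ.parent_incoming k hs, parent_inr] at h
        simp at h
        exact hs h.symm
  · exact hadj k h

/-- A diagram is a forest if and only if its orientation has no directed cycles. -/
theorem isForest_iff :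
    Γ.IsForest ↔ ∀ x ∈ Function.periodicPts Γ.parent, Γ.parent x = x := by
  constructor
  · intro hF x hx
    by_contra hne
    refine not_isAcyclic_of_minimalPeriod (P := Γ.parent) Γ.graph_adj (x := x) ?_ hF
    have h0 := Function.minimalPeriod_pos_of_mem_periodicPts hx
    have hit := Function.iterate_minimalPeriod (f := Γ.parent) (x := x)
    by_contra hlt
    obtain h1 | h1 : Function.minimalPeriod Γ.parent x = 1 ∨
      Function.minimalPeriod Γ.parent x = 2 := by omega
    · rw [h1] at hit; exact hne hit
    · rw [h1] at hit; exact Γ.parent_parent_ne hne hit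
  · exact isAcyclic_of_periodicPts Γ.graph_adj

theorem IsForest.isBinaryRootedTree {Γ : Diagram Φ N} (hΓ : Γ.IsForest)
    (T : Γ.graph.ConnectedComponent) : Γ.IsBinaryRootedTree T := by
  have hP := Γ.isForest_iff.1 hΓ
  refine ⟨⟨T.connected_toSimpleGraph, hΓ.induce _⟩, ?_⟩
  induction T using SimpleGraph.ConnectedComponent.ind with
  | h x =>
  obtain ⟨r, hr, hxr⟩ := Γ.parent_eq_self.1 (parent_rootOf hP x)
  have hmem : ∀ y, y ∈ (Γ.graph.connectedComponentMk x).supp ↔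
      rootOf Γ.parent y = Sum.inl (Sum.inl r) := by
    intro y
    rw [SimpleGraph.ConnectedComponent.mem_supp_iff, SimpleGraph.ConnectedComponent.eq,
      reachable_iff_rootOf Γ.graph_adj hP, hxr]
  refine ⟨r, hr, ?_, ?_, ?_⟩
  · rw [hmem]; exact rootOf_of_eq (Γ.parent_root hr)
  · intro i hi hc
    rw [hmem, rootOf_of_eq (Γ.parent_root hc)] at hi
    simpa using hi
  · intro k hk
    rw [hmem] at hk
    have hd : ∀ y, rootOf Γ.parent y = Sum.inl (Sum.inl r) →
        Γ.graph.dist y (Sum.inl (Sum.inl r)) = depth Γ.parent y := by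
      intro y hy
      rw [← hy]; exact dist_rootOf Γ.graph_adj hP y
    constructor
    · rw [hd _ hk, hd, depth_of_ne hP (x := Sum.inr k)]
      · rfl
      · simp [parent]
      · rw [← Γ.parent_inr, rootOf_parent hP, hk]
    · intro s hs
      have hp := Γ.parent_incoming k hs
      rw [hd _ hk, hd, depth_of_ne hP (x := Sum.inl (Sum.inr (k, s))), hp]
      · rw [hp]; simp
      · rw [← rootOf_parent hP, hp, hk]

theorem IsForest.card_connectedComponent {Γ : Diagram Φ N} (hΓ : Γ.IsForest) :
    Nat.card Γ.graph.ConnectedComponent = Nat.card {i : Fin n // (Φ i).charge = -1} := by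
  rw [BF.card_connectedComponent Γ.graph_adj (Γ.isForest_iff.1 hΓ)]
  refine (Nat.card_congr (Equiv.ofBijective
    (fun i : {i : Fin n // (Φ i).charge = -1} =>
      (⟨.inl (.inl i.1), Γ.parent_root i.2⟩ : {x // Γ.parent x = x})) ⟨?_, ?_⟩)).symm
  · intro i j h
    simpa [Subtype.ext_iff] using h
  · rintro ⟨x, hx⟩
    obtain ⟨i, hi, rfl⟩ := Γ.parent_eq_self.1 hx
    exact ⟨⟨i, hi⟩, rfl⟩

end Diagram

end

/-! ### The expansion into diagrams -/

open Classical in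
theorem green_of_not_contractible {C : ℂ} {x y : Letter} {w z : ℂ} (h : ¬ Contractible x y) :
    green C x y w z = 0 := by
  cases x <;> cases y <;> simp_all [Contractible, green]

theorem propagator_of_not_contractible {S : Scheme} {x y : Letter} {w z : ℂ}
    (h : ¬ Contractible x y) : propagator S x y w z = 0 := by
  unfold propagator
  split_ifs <;> simp [green_of_not_contractible h]

theorem rank_injective {n N : ℕ} : Function.Injective (rank : HalfEdge n N → ℕ) := by
  rintro (i | ⟨k, s⟩) (j | ⟨l, t⟩) h
  · simp only [rank] at h; rw [Fin.ext h]
  · simp only [rank] at h; omega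
  · simp only [rank] at h; omega
  · simp only [rank] at h
    have h1 : k = l := Fin.ext (by omega)
    have h2 : s = t := Fin.ext (by omega)
    rw [h1, h2]

theorem chordProduct_eq_zero {n N : ℕ} {S : Scheme} {x : HalfEdge n N → Letter}
    {pt : HalfEdge n N → ℂ} {σ : Pairing (HalfEdge n N)} {h : HalfEdge n N}
    (hh : ¬ Contractible (x h) (x (σ.1 h))) : chordProduct S x pt σ = 0 := by
  unfold chordProduct
  rcases lt_or_gt_of_ne (rank_injective.ne (σ.apply_ne h)) with hr | hr
  · refine Finset.prod_eq_zero (i := σ.1 h) ?_ (propagator_of_not_contractible fun hc => hh ?_)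
    · simp [σ.apply_apply, hr]
    · rw [σ.apply_apply] at hc; exact hc.symm
  · exact Finset.prod_eq_zero (i := h) (by simpa using hr) (propagator_of_not_contractible hh)

section

variable {𝕜 L ι : Type*} [Field 𝕜] [Algebra 𝕜 ℂ] [LieRing L] [LieAlgebra 𝕜 L]
  [Fintype ι] {n : ℕ}

/-- Wick contractions that are not diagrams contain a vanishing propagator, so only diagrams
contribute to the integrand. -/
theorem integrand_eq_sum_diagram (S : Scheme) (B : Module.Basis ι 𝕜 L) (Φ : Fin n → Insertion)
    (e : Fin n → ι) (N : ℕ) (z : Fin n → ℂ) (u : Fin N → ℂ) :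
    integrand S B Φ e N z u = ∑ Γ : Diagram Φ N, Γ.integrand S B e z u := by
  classical
  symm
  calc ∑ Γ : Diagram Φ N, Γ.integrand S B e z u
      = ∑ p : (Fin N → VertexKind) × Pairing (HalfEdge n N),
          (∏ k, (p.1 k).sign) * koszulSign (letters Φ p.1) p.2 *
            (∑ κ : Fin N → Fin 3 → ι, (∏ k, structConst B (κ k 0) (κ k 1) (κ k 2)) *
              colorDelta (colors e κ) p.2) *
            chordProduct S (letters Φ p.1) (points z u) p.2 := by
        refine Fintype.sum_of_injective (fun Γ : Diagram Φ N => (Γ.kind, Γ.pairing)) ?_ _ _ ?_ ?_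
        · rintro ⟨ν, σ, h⟩ ⟨ν', σ', h'⟩ heq
          simp only [Prod.mk.injEq] at heq
          obtain ⟨rfl, rfl⟩ := heq
          rfl
        · rintro ⟨ν, σ⟩ hp
          have : ∃ h, ¬ Contractible (letters Φ ν h) (letters Φ ν (σ.1 h)) := by
            by_contra hcon
            push Not at hcon
            exact hp ⟨⟨ν, σ, hcon⟩, rfl⟩
          obtain ⟨h, hh⟩ := this
          rw [chordProduct_eq_zero hh, mul_zero]
        · intro Γ; rfl
    _ = integrand S B Φ e N z u := by
        rw [Fintype.sum_prod_type]
        unfold integrand freeCorrelator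
        refine Finset.sum_congr rfl fun ν _ => ?_
        simp_rw [Finset.mul_sum, Finset.sum_mul]
        rw [Finset.sum_comm]
        refine Finset.sum_congr rfl fun κ _ => Finset.sum_congr rfl fun σ _ => ?_
        rw [Finset.prod_mul_distrib]
        ring

end

/-! ### The sign of a Wick contraction -/

open Classical in
/-- The indicator of a proposition, modulo two. -/
def ind (p : Prop) : ZMod 2 := if p then 1 else 0

theorem ind_true {p : Prop} (h : p) : ind p = 1 := if_pos h

theorem ind_false {p : Prop} (h : ¬ p) : ind p = 0 := if_neg h

theorem ind_not (p : Prop) : ind (¬ p) = 1 + ind p := by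
  by_cases h : p
  · rw [ind_false (not_not.2 h), ind_true h]; decide
  · rw [ind_true h, ind_false h]; decide

theorem neg_one_pow_eq_of_zmod {a b : ℕ} (h : (a : ZMod 2) = b) : (-1 : ℂ) ^ a = (-1) ^ b := by
  refine neg_one_pow_congr ?_
  rw [← ZMod.natCast_eq_zero_iff_even, ← ZMod.natCast_eq_zero_iff_even, h]

/-- Modulo two, a double sum depends only on the diagonal and on the symmetrized summand. -/
theorem sum_sum_eq_of_symm {α : Type*} (O : Finset α) (F G : α → α → ZMod 2)
    (h1 : ∀ o ∈ O, F o o = G o o)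
    (h2 : ∀ o ∈ O, ∀ o' ∈ O, o ≠ o' → F o o' + F o' o = G o o' + G o' o) :
    ∑ o ∈ O, ∑ o' ∈ O, F o o' = ∑ o ∈ O, ∑ o' ∈ O, G o o' := by
  classical
  have h2' : ∀ x : ZMod 2, x + x = 0 := by decide
  have key : ∑ x ∈ O ×ˢ O, (F x.1 x.2 + G x.1 x.2) = 0 := by
    refine Finset.sum_involution (fun x _ => (x.2, x.1)) ?_ ?_ ?_ ?_
    · rintro ⟨a, b⟩ hx
      simp only [Finset.mem_product] at hx
      by_cases hab : a = b
      · subst hab; exact h2' _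
      · have := h2 a hx.1 b hx.2 hab
        simp only
        rw [add_add_add_comm, this, h2']
    · rintro ⟨a, b⟩ hx hne heq
      simp only [Finset.mem_product, Prod.mk.injEq] at hx heq
      obtain ⟨rfl, -⟩ := heq
      apply hne
      simp only
      rw [h1 _ hx.1, h2']
    · rintro ⟨a, b⟩ hx
      simp only [Finset.mem_product] at hx ⊢
      exact hx.symm
    · rintro ⟨a, b⟩ _; rfl
  rw [Finset.sum_add_distrib, Finset.sum_product, Finset.sum_product] at key
  have : ∀ x y : ZMod 2, x + y = 0 → x = y := by decide
  exact this _ _ key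

/-- The parity of the number of crossings of a set `O` of oriented chords, chord `o` leading from
`p o` to `q o`, increased by the number of chords with `p o < q o`. -/
def chordParity {α : Type*} (O : Finset α) (p q : α → ℕ) : ZMod 2 :=
  ∑ o ∈ O, ∑ o' ∈ O, (ind (p o < p o') * ind (q o < q o') + ind (p o < q o'))

/-- The parity of the crossing of two disjoint chords. -/
theorem crossing_parity {p q p' q' : ℕ} (h1 : p ≠ q) (h2 : p' ≠ q') (h3 : p ≠ p') (h4 : p ≠ q')
    (h5 : q ≠ p') (h6 : q ≠ q') :
    (ind (p < p' ∧ p' < q ∧ q < q') + ind (q < p' ∧ p' < p ∧ p < q')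
      + (ind (p < q' ∧ q' < q ∧ q < p') + ind (q < q' ∧ q' < p ∧ p < p')))
    + (ind (p' < p ∧ p < q' ∧ q' < q) + ind (q' < p ∧ p < p' ∧ p' < q)
      + (ind (p' < q ∧ q < q' ∧ q' < p) + ind (q' < q ∧ q < p' ∧ p' < p)))
    = (ind (p < p') * ind (q < q') + ind (p < q')) + (ind (p' < p) * ind (q' < q) + ind (p' < q)) := by
  have e1 : (q < p) = ¬ (p < q) := by apply propext; omega
  have e2 : (q' < p') = ¬ (p' < q') := by apply propext; omega
  have e3 : (p' < p) = ¬ (p < p') := by apply propext; omega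
  have e4 : (q' < p) = ¬ (p < q') := by apply propext; omega
  have e5 : (p' < q) = ¬ (q < p') := by apply propext; omega
  have e6 : (q' < q) = ¬ (q < q') := by apply propext; omega
  rw [e3, e4, e5, e6]
  by_cases a3 : p < p' <;> by_cases a4 : p < q' <;> by_cases a5 : q < p' <;> by_cases a6 : q < q' <;>
    simp only [a3, a4, a5, a6, ind, not_true, not_false_iff, if_true, if_false, and_true,
      and_false] <;> rfl

theorem IsOdd_of_contractible {x y : Letter} (h : Contractible x y) : x.IsOdd ↔ y.IsOdd := by
  cases x <;> cases y <;> simp_all [Contractible, Letter.IsOdd]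

namespace Diagram

variable {n N : ℕ} {Φ : Fin n → Insertion} (Γ : Diagram Φ N)

open Classical in
/-- The half-edges of charge `+1`: one at each edge. -/
def outgoing (_ : Diagram Φ N) : Finset (HalfEdge n N) :=
  Finset.univ.filter fun h => hCharge Φ h = 1

open Classical in
/-- The half-edges of charge `+1` decorated by ghosts: one at each ghost edge. -/
def oddOutgoing : Finset (HalfEdge n N) := Γ.outgoing.filter fun h => (letters Φ Γ.kind h).IsOdd

theorem mem_outgoing {h : HalfEdge n N} : h ∈ Γ.outgoing ↔ hCharge Φ h = 1 := by
  simp [outgoing]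

theorem mem_oddOutgoing {h : HalfEdge n N} :
    h ∈ Γ.oddOutgoing ↔ hCharge Φ h = 1 ∧ (letters Φ Γ.kind h).IsOdd := by
  simp [oddOutgoing, mem_outgoing]

theorem isOdd_pairing (h : HalfEdge n N) :
    (letters Φ Γ.kind (Γ.pairing.1 h)).IsOdd ↔ (letters Φ Γ.kind h).IsOdd :=
  (IsOdd_of_contractible (Γ.admissible h)).symm

theorem pairing_ne_of_outgoing {h h' : HalfEdge n N} (hh : hCharge Φ h = 1)
    (hh' : hCharge Φ h' = 1) : Γ.pairing.1 h ≠ h' := by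
  rintro rfl
  rw [Γ.hCharge_pairing, hh] at hh'
  norm_num at hh'

/-- The number of crossings in the Koszul sign, in terms of the ghost chords oriented from charge
`+1` to charge `-1`. -/
theorem koszulSign_mul (E : ℕ) (hE : (E : ZMod 2) =
      chordParity Γ.oddOutgoing rank (fun h => rank (Γ.pairing.1 h))) :
    koszulSign (letters Φ Γ.kind) Γ.pairing *
      ∏ h ∈ Γ.oddOutgoing, (if rank h < rank (Γ.pairing.1 h) then -1 else 1) = (-1) ^ E := by
  classical
  set σ := Γ.pairing.1 with hσ
  have hprod : (∏ h ∈ Γ.oddOutgoing, (if rank h < rank (σ h) then (-1 : ℂ) else 1)) =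
      (-1) ^ (Γ.oddOutgoing.filter fun h => rank h < rank (σ h)).card := by
    rw [Finset.prod_ite, Finset.prod_const, Finset.prod_const_one, mul_one]
  rw [hprod, koszulSign, ← pow_add]
  apply neg_one_pow_eq_of_zmod
  rw [hE, Nat.cast_add, Finset.card_filter, Finset.card_filter, Nat.cast_sum, Nat.cast_sum,
    ← Finset.univ_product_univ, Finset.sum_product]
  have hX : ∀ (h k : HalfEdge n N) [Decidable ((letters Φ Γ.kind h).IsOdd ∧
      (letters Φ Γ.kind k).IsOdd ∧ rank h < rank k ∧ rank k < rank (σ h) ∧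
        rank (σ h) < rank (σ k))], (((if (letters Φ Γ.kind h).IsOdd ∧
      (letters Φ Γ.kind k).IsOdd ∧ rank h < rank k ∧ rank k < rank (σ h) ∧
        rank (σ h) < rank (σ k) then 1 else 0 : ℕ)) : ZMod 2)
      = if (letters Φ Γ.kind h).IsOdd then if (letters Φ Γ.kind k).IsOdd then
        ind (rank h < rank k ∧ rank k < rank (σ h) ∧ rank (σ h) < rank (σ k)) else 0 else 0 := by
    intro h k _
    by_cases a : (letters Φ Γ.kind h).IsOdd <;> by_cases b : (letters Φ Γ.kind k).IsOdd <;>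
      simp [a, b, ind]
  -- a sum over the ghost half-edges collects both ends of each oriented ghost chord
  have hodd : ∀ F : HalfEdge n N → ZMod 2,
      (∑ h, if (letters Φ Γ.kind h).IsOdd then F h else 0) =
        ∑ o ∈ Γ.oddOutgoing, (F o + F (σ o)) := by
    intro F
    rw [← Finset.sum_filter, Finset.sum_add_distrib,
      ← Finset.sum_filter_add_sum_filter_not _ (fun h => hCharge Φ h = 1)]
    congr 1
    · refine Finset.sum_congr ?_ fun _ _ => rfl
      ext h
      simp [mem_oddOutgoing, and_comm]
    · refine Finset.sum_nbij' (fun h => σ h) (fun h => σ h) ?_ ?_ ?_ ?_ ?_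
      · intro h hh
        simp only [Finset.mem_filter, Finset.mem_univ, true_and] at hh
        rw [mem_oddOutgoing, Γ.hCharge_pairing, Γ.isOdd_pairing]
        rcases hCharge_eq (Φ := Φ) h with hc | hc
        · exact absurd hc hh.2
        · exact ⟨by rw [hc]; rfl, hh.1⟩
      · intro h hh
        rw [mem_oddOutgoing] at hh
        simp only [Finset.mem_filter, Finset.mem_univ, true_and]
        rw [Γ.isOdd_pairing, Γ.hCharge_pairing, hh.1]
        exact ⟨hh.2, by norm_num⟩
      · intro h _; exact Γ.pairing.apply_apply h
      · intro h _; exact Γ.pairing.apply_apply h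
      · intro h _; rw [Γ.pairing.apply_apply h]
  refine (congrArg (· + _) (Finset.sum_congr rfl fun h _ =>
    Finset.sum_congr rfl fun k _ => hX h k)).trans ?_
  have hpull : ∀ (P : Prop) [Decidable P] (f : HalfEdge n N → ZMod 2),
      (∑ k, if P then f k else 0) = if P then ∑ k, f k else 0 := by
    intro P _ f; split_ifs <;> simp
  simp_rw [hpull, hodd]
  -- the signs of the propagators are put on the diagonal of the double sum over chords
  have hdiag : ∑ h ∈ Γ.oddOutgoing, ((if rank h < rank (σ h) then 1 else 0 : ℕ) : ZMod 2) =
      ∑ o ∈ Γ.oddOutgoing, ∑ o' ∈ Γ.oddOutgoing,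
        (if o = o' then ind (rank o < rank (σ o)) else 0) := by
    refine Finset.sum_congr rfl fun o ho => ?_
    rw [Finset.sum_ite_eq, if_pos ho]
    simp [ind]
  rw [hdiag]
  simp_rw [← Finset.sum_add_distrib]
  unfold chordParity
  apply sum_sum_eq_of_symm
  · intro o _
    have h1 : σ (σ o) = o := Γ.pairing.apply_apply o
    simp [ind, h1]
  · intro o ho o' ho' hne
    rw [mem_oddOutgoing] at ho ho'
    rw [if_neg hne, if_neg hne.symm, Γ.pairing.apply_apply, Γ.pairing.apply_apply, add_zero,
      add_zero]
    have hr := fun {a b : HalfEdge n N} (h : a ≠ b) => rank_injective.ne h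
    rw [← crossing_parity (p := rank o) (q := rank (σ o)) (p' := rank o') (q' := rank (σ o'))
      (hr (Γ.pairing.apply_ne o).symm) (hr (Γ.pairing.apply_ne o').symm) (hr hne)
      (hr (Γ.pairing_ne_of_outgoing ho'.1 ho.1).symm) (hr (Γ.pairing_ne_of_outgoing ho.1 ho'.1))
      (hr (σ.injective.ne hne))]
    ring

end Diagram

/-- The propagator from a letter of charge `+1` at `w` to its partner of charge `-1` at `z`, with
the partner written first. -/
def outGreen (C : ℂ) : Letter → ℂ → ℂ → ℂ
  | .gamma, w, z => 1 / (z - w)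
  | .gammaBar, w, z => 1 / ((starRingEnd ℂ) z - (starRingEnd ℂ) w)
  | .b, w, z => 2 * (Real.log ‖z - w‖ : ℂ) + C
  | .db, w, z => 1 / (w - z)
  | .dbBar, w, z => 1 / ((starRingEnd ℂ) w - (starRingEnd ℂ) z)
  | _, _, _ => 0

open Classical in
theorem green_eq_outGreen {C : ℂ} {x y : Letter} {w z : ℂ} (h : Contractible x y)
    (hx : x.charge = 1) :
    green C x y w z = (if x.IsOdd then -1 else 1) * outGreen C x w z := by
  cases x <;> cases y <;>
    simp_all [Contractible, green, outGreen, Letter.IsOdd, Letter.charge]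

theorem green_eq_outGreen' {C : ℂ} {x y : Letter} {w z : ℂ} (h : Contractible x y)
    (hx : x.charge = -1) : green C x y w z = outGreen C y z w := by
  cases x <;> cases y <;>
    simp_all [Contractible, green, outGreen, Letter.charge]

namespace Diagram

variable {n N : ℕ} {Φ : Fin n → Insertion} (Γ : Diagram Φ N)

open Classical in
/-- The product of propagators, with the sign for the transposition of every ghost propagator in
which the field of charge `+1` comes first. -/
theorem chordProduct_eq (S : Scheme) (pt : HalfEdge n N → ℂ)
    (hpt : ∀ h, pt h ≠ pt (Γ.pairing.1 h)) :
    chordProduct S (letters Φ Γ.kind) pt Γ.pairing =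
      (∏ h ∈ Γ.oddOutgoing, (if rank h < rank (Γ.pairing.1 h) then -1 else 1)) *
        ∏ h ∈ Γ.outgoing, outGreen S.C (letters Φ Γ.kind h) (pt h) (pt (Γ.pairing.1 h)) := by
  set σ := Γ.pairing.1 with hσ
  unfold chordProduct
  rw [oddOutgoing, Finset.prod_filter (fun h => (letters Φ Γ.kind h).IsOdd), ← Finset.prod_mul_distrib,
    ← Finset.prod_filter_mul_prod_filter_not _ (fun h => h ∈ Γ.outgoing)]
  conv_rhs => rw [← Finset.prod_filter_mul_prod_filter_not _ (fun h => rank h < rank (σ h))]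
  congr 1
  · rw [Finset.filter_filter]
    refine Finset.prod_congr ?_ ?_
    · ext h; simp [and_comm, hσ]
    · intro h hh
      simp only [Finset.mem_filter, Γ.mem_outgoing] at hh
      rw [propagator, if_neg (hpt h), green_eq_outGreen (Γ.admissible h)
        (by rw [charge_letters]; exact hh.1)]
      rw [if_pos (show rank h < rank (σ h) from hh.2)]
  · refine Finset.prod_nbij' (fun h => σ h) (fun h => σ h) ?_ ?_ ?_ ?_ ?_
    · intro h hh
      simp only [Finset.mem_filter, Finset.mem_univ, true_and, Γ.mem_outgoing] at hh ⊢
      rw [Γ.hCharge_pairing, Γ.pairing.apply_apply]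
      refine ⟨?_, by rw [not_lt]; exact hh.1.le⟩
      rcases hCharge_eq (Φ := Φ) h with hc | hc
      · exact absurd hc hh.2
      · rw [hc]; rfl
    · intro h hh
      simp only [Finset.mem_filter, Finset.mem_univ, true_and, Γ.mem_outgoing] at hh ⊢
      rw [Γ.hCharge_pairing, Γ.pairing.apply_apply, hh.1]
      exact ⟨lt_of_le_of_ne (not_lt.1 hh.2) (rank_injective.ne (Γ.pairing.apply_ne h)),
        by norm_num⟩
    · intro h _; exact Γ.pairing.apply_apply h
    · intro h _; exact Γ.pairing.apply_apply h
    · intro h hh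
      simp only [Finset.mem_filter, Finset.mem_univ, true_and, Γ.mem_outgoing] at hh
      have hc : hCharge Φ h = -1 := by
        rcases hCharge_eq (Φ := Φ) h with hc | hc
        · exact absurd hc hh.2
        · exact hc
      rw [propagator, if_neg (hpt h), green_eq_outGreen' (Γ.admissible h)
        (by rw [charge_letters]; exact hc), Γ.pairing.apply_apply, if_neg (not_lt.2 hh.1.le)]
      simp [hσ]

/-- The sign of the Wick contraction when every propagator is written with its field of charge
`-1` first. -/
def wickSign : ℂ :=
  (-1) ^ (chordParity Γ.oddOutgoing rank (fun h => rank (Γ.pairing.1 h))).val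

/-- The sign and the propagators of a Wick contraction, with every propagator oriented. -/
theorem koszulSign_mul_chordProduct (S : Scheme) (pt : HalfEdge n N → ℂ)
    (hpt : ∀ h, pt h ≠ pt (Γ.pairing.1 h)) :
    koszulSign (letters Φ Γ.kind) Γ.pairing * chordProduct S (letters Φ Γ.kind) pt Γ.pairing =
      Γ.wickSign *
        ∏ h ∈ Γ.outgoing, outGreen S.C (letters Φ Γ.kind h) (pt h) (pt (Γ.pairing.1 h)) := by
  rw [Γ.chordProduct_eq S pt hpt, ← mul_assoc, Γ.koszulSign_mul _ (ZMod.natCast_zmod_val _)]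
  rfl

end Diagram

/-! ### The sign of a ghost loop -/

theorem zmod_two_add_self (x : ZMod 2) : x + x = 0 := by revert x; decide

theorem ind_and (p q : Prop) : ind (p ∧ q) = ind p * ind q := by
  by_cases hp : p <;> by_cases hq : q <;> simp [ind, hp, hq]

/-- The parity of the number of inversions of a cycle. -/
theorem parity_isCycle {N : ℕ} {π : Equiv.Perm (Fin N)} (hπ : π.IsCycle) :
    ∑ v, ∑ w, ind (v < w) * ind (π w < π v) = (π.support.card : ZMod 2) + 1 := by
  classical
  have h1 : (Equiv.Perm.sign π : ℤˣ) = (-1) ^ (∑ v, ∑ w, if v < w ∧ π w < π v then 1 else 0 : ℕ) := by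
    rw [Equiv.Perm.sign_eq_prod_prod_Ioi, ← Finset.prod_pow_eq_pow_sum]
    refine Finset.prod_congr rfl fun v _ => ?_
    rw [← Finset.prod_pow_eq_pow_sum, ← Finset.filter_lt_eq_Ioi, Finset.prod_filter]
    refine Finset.prod_congr rfl fun w _ => ?_
    by_cases hvw : v < w
    · have : π v ≠ π w := π.injective.ne hvw.ne
      rcases lt_or_gt_of_ne this with h | h
      · simp [hvw, h, not_lt.2 h.le]
      · simp [hvw, h, not_lt.2 h.le]
    · simp [hvw]
  have h2 := hπ.sign
  rw [h1] at h2
  have h3 : ((-1 : ℂ)) ^ (∑ v, ∑ w, if v < w ∧ π w < π v then 1 else 0 : ℕ) =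
      (-1) ^ (π.support.card + 1) := by
    have := congrArg (fun x : ℤˣ => ((x : ℤ) : ℂ)) h2
    push_cast at this
    rw [this]; ring
  have h4 : (((∑ v, ∑ w, if v < w ∧ π w < π v then 1 else 0 : ℕ)) : ZMod 2) =
      ((π.support.card + 1 : ℕ) : ZMod 2) := by
    generalize (∑ v, ∑ w, if v < w ∧ π w < π v then 1 else 0 : ℕ) = a at h3
    generalize (π.support.card + 1 : ℕ) = b at h3
    have key : ∀ c : ℕ, (-1 : ℂ) ^ c = 1 ↔ (c : ZMod 2) = 0 := by
      intro c
      rw [ZMod.natCast_eq_zero_iff_even]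
      exact neg_one_pow_eq_one_iff_even (by norm_num)
    have h5 : (((a + b : ℕ)) : ZMod 2) = 0 := by
      rw [← key, pow_add, h3, ← pow_add]
      exact Even.neg_one_pow ⟨b, rfl⟩
    have : ∀ x y : ZMod 2, x + y = 0 → x = y := by decide
    exact this _ _ (by exact_mod_cast h5)
  push_cast at h4
  rw [← h4]
  refine Finset.sum_congr rfl fun v _ => Finset.sum_congr rfl fun w _ => ?_
  rw [← ind_and]
  simp [ind]

/-- A sum over the points moved by a permutation is invariant under the permutation. -/
theorem sum_support_comp {N : ℕ} (π : Equiv.Perm (Fin N)) {M : Type*} [AddCommMonoid M]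
    (F : Fin N → M) : ∑ v ∈ π.support, F (π v) = ∑ v ∈ π.support, F v := by
  refine Finset.sum_nbij' (fun v => π v) (fun v => π.symm v) ?_ ?_ ?_ ?_ ?_
  · intro v hv; exact Equiv.Perm.apply_mem_support.2 hv
  · intro v hv
    rw [← Equiv.Perm.apply_mem_support, Equiv.apply_symm_apply]; exact hv
  · intro v _; simp
  · intro v _; simp
  · intro v _; rfl

/-- The inversions between a moved and a fixed point come in even number. -/
theorem parity_isCycle_support {N : ℕ} {π : Equiv.Perm (Fin N)} (hπ : π.IsCycle) :
    ∑ v ∈ π.support, ∑ w ∈ π.support, ind (v < w) * ind (π w < π v) =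
      (π.support.card : ZMod 2) + 1 := by
  classical
  rw [← parity_isCycle hπ]
  have hfix : ∀ v, v ∉ π.support → π v = v := fun v hv => Equiv.Perm.notMem_support.1 hv
  have hsplit : ∀ F : Fin N → ZMod 2, ∑ v, F v = ∑ v ∈ π.support, F v + ∑ v ∈ π.supportᶜ, F v :=
    fun F => (Finset.sum_add_sum_compl _ _).symm
  rw [hsplit (fun v => ∑ w, ind (v < w) * ind (π w < π v))]
  simp_rw [hsplit (fun w => ind (_ < w) * ind (π w < π _))]
  rw [Finset.sum_add_distrib, Finset.sum_add_distrib]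
  -- two fixed points are not inverted
  have h0 : ∑ v ∈ π.supportᶜ, ∑ w ∈ π.supportᶜ, ind (v < w) * ind (π w < π v) = 0 := by
    refine Finset.sum_eq_zero fun v hv => Finset.sum_eq_zero fun w hw => ?_
    rw [hfix v (by simpa using hv), hfix w (by simpa using hw), ← ind_and]
    exact ind_false (by omega)
  -- a fixed point `x` is inverted with `v` if exactly one of `v` and `π v` is below `x`
  have h1 : ∑ v ∈ π.support, ∑ w ∈ π.supportᶜ, ind (v < w) * ind (π w < π v) +
      ∑ v ∈ π.supportᶜ, ∑ w ∈ π.support, ind (v < w) * ind (π w < π v) = 0 := by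
    rw [Finset.sum_comm, ← Finset.sum_add_distrib]
    refine Finset.sum_eq_zero fun x hx => ?_
    rw [← Finset.sum_add_distrib]
    have hx' := hfix x (by simpa using hx)
    have : ∀ v ∈ π.support, ind (v < x) * ind (π x < π v) + ind (x < v) * ind (π v < π x) =
        ind (v < x) + ind (π v < x) := by
      intro v hv
      have hne : v ≠ x := by rintro rfl; exact Finset.mem_compl.1 hx hv
      have hne' : π v ≠ x := by
        intro h
        rw [← hx'] at h
        exact hne (π.injective h)
      rw [hx']
      rw [show (x < v) = ¬ (v < x) by apply propext; omega,
        show (x < π v) = ¬ (π v < x) by apply propext; omega]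
      by_cases a : v < x <;> by_cases b : π v < x <;> simp [ind, a, b]
      decide
    rw [Finset.sum_congr rfl this, Finset.sum_add_distrib,
      sum_support_comp π (fun v => ind (v < x)), zmod_two_add_self]
  rw [h0, add_zero, add_assoc, h1, add_zero]

/-- A ghost loop, whose half-edges are adjacent in the order of `rank` at each of its vertices,
contributes a factor `-1`: it crosses every other chord an even number of times, and its own
crossings are counted by the sign of a cyclic permutation. -/
theorem chordParity_loop {n N : ℕ} {π : Equiv.Perm (Fin N)} (hπ : π.IsCycle)
    {O R : Finset (HalfEdge n N)} {p q : HalfEdge n N → ℕ}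
    (hO : ∀ F : HalfEdge n N → ZMod 2,
      ∑ o ∈ O, F o = ∑ o ∈ R, F o + ∑ v ∈ π.support, F (.inr (v, 0)))
    (hp : ∀ v ∈ π.support, p (.inr (v, 0)) = n + 3 * v)
    (hq : ∀ v ∈ π.support, q (.inr (v, 0)) = n + 3 * (π v : ℕ) + 2)
    (hR : ∀ o ∈ R, ∀ v ∈ π.support, (p o < n + 3 * v ∨ n + 3 * v + 2 < p o) ∧
      (q o < n + 3 * v ∨ n + 3 * v + 2 < q o)) :
    chordParity O p q = chordParity R p q + 1 := by
  classical
  unfold chordParity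
  rw [hO]
  simp_rw [hO]
  rw [Finset.sum_add_distrib, Finset.sum_add_distrib]
  -- the crossings of the chords of the loop among themselves
  have hLL : ∑ v ∈ π.support, ∑ w ∈ π.support,
      (ind (p (.inr (v, 0)) < p (.inr (w, 0))) * ind (q (.inr (v, 0)) < q (.inr (w, 0))) +
        ind (p (.inr (v, 0)) < q (.inr (w, 0)))) = 1 := by
    have h1 : ∀ v ∈ π.support, ∀ w ∈ π.support,
        (ind (p (.inr (v, 0)) < p (.inr (w, 0))) * ind (q (.inr (v, 0)) < q (.inr (w, 0))) +
        ind (p (.inr (v, 0)) < q (.inr (w, 0)))) =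
        ind (v < w) * (1 + ind (π w < π v)) + ind (v ≤ π w) := by
      intro v hv w hw
      rw [hp v hv, hp w hw, hq v hv, hq w hw]
      rw [show (n + 3 * (v : ℕ) < n + 3 * (w : ℕ)) = (v < w) by apply propext; omega,
        show (n + 3 * (v : ℕ) < n + 3 * (π w : ℕ) + 2) = (v ≤ π w) by apply propext; omega]
      by_cases hvw : v < w
      · have : π v ≠ π w := π.injective.ne hvw.ne
        rw [show (n + 3 * (π v : ℕ) + 2 < n + 3 * (π w : ℕ) + 2) = ¬ (π w < π v) by
          apply propext; omega, ind_not]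
      · rw [ind_false hvw]; ring
    rw [Finset.sum_congr rfl fun v hv => Finset.sum_congr rfl fun w hw => h1 v hv w hw]
    simp_rw [Finset.sum_add_distrib]
    have h3 : ∀ v, ∑ w ∈ π.support, ind (v ≤ π w) = ∑ w ∈ π.support, ind (v ≤ w) :=
      fun v => sum_support_comp π (fun w => ind (v ≤ w))
    simp_rw [h3, mul_add, mul_one, Finset.sum_add_distrib]
    rw [parity_isCycle_support hπ]
    have h2 : ∑ v ∈ π.support, ∑ w ∈ π.support, ind (v ≤ w) =
        ∑ v ∈ π.support, ∑ w ∈ π.support, ind (v < w) + π.support.card := by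
      rw [Finset.card_eq_sum_ones, Nat.cast_sum, ← Finset.sum_add_distrib]
      refine Finset.sum_congr rfl fun v hv => ?_
      have : ∀ w, ind (v ≤ w) = ind (v < w) + if v = w then 1 else 0 := by
        intro w
        rcases lt_trichotomy v w with h | h | h
        · simp [ind, h, h.le, h.ne]
        · simp [ind, h]
        · simp [ind, not_lt.2 h.le, not_le.2 h, h.ne']
      simp_rw [this, Finset.sum_add_distrib]
      rw [Finset.sum_ite_eq, if_pos hv]; simp
    rw [h2]
    generalize ∑ v ∈ π.support, ∑ w ∈ π.support, ind (v < w) = a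
    generalize (π.support.card : ZMod 2) = b
    revert a b; decide
  -- the crossings with another chord `o`: each end of `o` lies on the same side of the two ends of
  -- loop chords at a vertex, so that these two contribute equally
  have hRL : ∑ o ∈ R, ∑ v ∈ π.support,
        (ind (p o < p (.inr (v, 0))) * ind (q o < q (.inr (v, 0))) + ind (p o < q (.inr (v, 0)))) +
      ∑ v ∈ π.support, ∑ o ∈ R,
        (ind (p (.inr (v, 0)) < p o) * ind (q (.inr (v, 0)) < q o) + ind (p (.inr (v, 0)) < q o))
      = 0 := by
    rw [Finset.sum_comm (s := π.support), ← Finset.sum_add_distrib]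
    refine Finset.sum_eq_zero fun o ho => ?_
    rw [← Finset.sum_add_distrib]
    have h1 : ∀ v ∈ π.support,
        (ind (p o < p (.inr (v, 0))) * ind (q o < q (.inr (v, 0))) + ind (p o < q (.inr (v, 0)))) +
        (ind (p (.inr (v, 0)) < p o) * ind (q (.inr (v, 0)) < q o) + ind (p (.inr (v, 0)) < q o))
        = (ind (p o < n + 3 * v) + ind (p o < n + 3 * (π v : ℕ))) +
          (ind (q o < n + 3 * v) + ind (q o < n + 3 * (π v : ℕ))) := by
      intro v hv
      have a1 := hR o ho v hv
      have a2 := hR o ho (π v) (Equiv.Perm.apply_mem_support.2 hv)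
      rw [hp v hv, hq v hv]
      rw [show (q o < n + 3 * (π v : ℕ) + 2) = (q o < n + 3 * (π v : ℕ)) by apply propext; omega,
        show (p o < n + 3 * (π v : ℕ) + 2) = (p o < n + 3 * (π v : ℕ)) by apply propext; omega,
        show (n + 3 * (v : ℕ) < p o) = ¬ (p o < n + 3 * (v : ℕ)) by apply propext; omega,
        show (n + 3 * (v : ℕ) < q o) = ¬ (q o < n + 3 * (v : ℕ)) by apply propext; omega,
        show (n + 3 * (π v : ℕ) + 2 < q o) = ¬ (q o < n + 3 * (π v : ℕ)) by apply propext; omega]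
      simp_rw [ind_not]
      generalize ind (p o < n + 3 * (v : ℕ)) = a
      generalize ind (q o < n + 3 * (v : ℕ)) = b
      generalize ind (p o < n + 3 * (π v : ℕ)) = c
      generalize ind (q o < n + 3 * (π v : ℕ)) = d
      revert a b c d; decide
    rw [Finset.sum_congr rfl h1]
    simp_rw [Finset.sum_add_distrib]
    rw [sum_support_comp π (fun v => ind (p o < n + 3 * (v : ℕ))),
      sum_support_comp π (fun v => ind (q o < n + 3 * (v : ℕ))), zmod_two_add_self,
      zmod_two_add_self, add_zero]
  rw [hLL]
  linear_combination hRL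

/-! ### Traces of products as sums over closed paths -/

section Trace

variable {ι R : Type*} [Fintype ι] [DecidableEq ι] [CommRing R]

/-- An entry of a product of matrices is a sum over paths. -/
theorem prod_ofFn_apply {m : ℕ} (M : Fin m → Matrix ι ι R) (a b : ι) :
    (List.ofFn M).prod a b = ∑ c : Fin (m + 1) → ι,
      if c 0 = a ∧ c (Fin.last m) = b then ∏ j, M j (c j.castSucc) (c j.succ) else 0 := by
  induction m generalizing a with
  | zero =>
    rw [List.ofFn_zero, List.prod_nil, Matrix.one_apply,
      ← (Equiv.funUnique (Fin 1) ι).symm.sum_comp]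
    rw [Finset.sum_eq_single a]
    · simp
    · intro c _ hc; simp [hc]
    · simp
  | succ m ih =>
    rw [List.ofFn_succ, List.prod_cons, Matrix.mul_apply, ← (Fin.consEquiv fun _ => ι).sum_comp,
      Fintype.sum_prod_type]
    have h1 : ∀ i ∈ Finset.univ, i ≠ a → ∑ c : Fin (m + 1) → ι,
        (if (Fin.consEquiv fun _ => ι) (i, c) 0 = a ∧
          (Fin.consEquiv fun _ => ι) (i, c) (Fin.last (m + 1)) = b then
          ∏ j, M j ((Fin.consEquiv fun _ => ι) (i, c) j.castSucc)
            ((Fin.consEquiv fun _ => ι) (i, c) j.succ) else 0) = 0 := by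
      intro i _ hi
      refine Finset.sum_eq_zero fun c _ => ?_
      simp [Fin.consEquiv, hi]
    conv_rhs => rw [Finset.sum_eq_single a h1 (by simp)]
    simp_rw [ih, Finset.mul_sum]
    rw [Finset.sum_comm]
    refine Finset.sum_congr rfl fun c _ => ?_
    rw [Finset.sum_eq_single (c 0)]
    · simp [Fin.consEquiv, Fin.prod_univ_succ, ← Fin.succ_last]
    · intro i _ hi; simp [hi.symm]
    · simp

/-- A trace of a product of matrices is a sum over closed paths; the addition in `Fin (m + 1)` is
cyclic. -/
theorem trace_prod_ofFn {m : ℕ} (M : Fin (m + 1) → Matrix ι ι R) :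
    (List.ofFn M).prod.trace = ∑ c : Fin (m + 1) → ι, ∏ j, M j (c j) (c (j + 1)) := by
  simp_rw [Matrix.trace, Matrix.diag_apply, prod_ofFn_apply]
  rw [Finset.sum_comm, ← (Fin.snocEquiv fun _ => ι).sum_comp, Fintype.sum_prod_type_right]
  refine Finset.sum_congr rfl fun c _ => ?_
  rw [Finset.sum_eq_single (c 0), Finset.sum_eq_single (c 0)]
  · have h0 : (Fin.snoc c (c 0) : Fin (m + 2) → ι) 0 = c 0 := by
      exact Fin.snoc_castSucc (α := fun _ => ι) _ _ (0 : Fin (m + 1))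
    rw [if_pos (by simp [Fin.snocEquiv, h0])]
    refine Finset.prod_congr rfl fun j _ => ?_
    have h1 : (Fin.snoc c (c 0) : Fin (m + 2) → ι) j.succ = c (j + 1) := by
      by_cases hj : j = Fin.last m
      · subst hj; simp
      · obtain ⟨i, rfl⟩ := Fin.exists_castSucc_eq.2 hj
        rw [Fin.succ_castSucc, Fin.snoc_castSucc]
        simp
    simp [Fin.snocEquiv, h1]
  · intro i _ hi
    have h0 : (Fin.snoc c (c 0) : Fin (m + 2) → ι) 0 = c 0 := by
      exact Fin.snoc_castSucc (α := fun _ => ι) _ _ (0 : Fin (m + 1))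
    rw [if_neg]
    simp [Fin.snocEquiv, h0, hi.symm]
  · simp
  · intro i _ hi
    have h0 : (Fin.snoc c i : Fin (m + 2) → ι) 0 = c 0 := by
      exact Fin.snoc_castSucc (α := fun _ => ι) _ _ (0 : Fin (m + 1))
    refine Finset.sum_eq_zero fun a _ => ?_
    rw [if_neg]
    simp only [Fin.snocEquiv, Equiv.coe_fn_mk, h0, Fin.snoc_last]
    rintro ⟨rfl, h⟩
    exact hi h
  · simp

theorem trace_prod_ofFn_reverse {m : ℕ} (M : Fin (m + 1) → Matrix ι ι R) :
    (List.ofFn M).reverse.prod.trace = ∑ c : Fin (m + 1) → ι, ∏ j, M j (c (j + 1)) (c j) := by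
  rw [← Matrix.trace_transpose, Matrix.transpose_list_prod, List.map_reverse, List.reverse_reverse,
    List.map_ofFn, trace_prod_ofFn]
  rfl

end Trace

section Lie

variable {𝕜 L ι : Type*} [Field 𝕜] [Algebra 𝕜 ℂ] [LieRing L] [LieAlgebra 𝕜 L]
  [Fintype ι] (B : Module.Basis ι 𝕜 L)

omit [Fintype ι] in
theorem structConst_antisymm (k i j : ι) : structConst B k i j = -structConst B k j i := by
  unfold structConst
  rw [← lie_skew, map_neg, Finsupp.neg_apply, map_neg]

open Classical in
theorem algebraMap_trace_prod_ad {m : ℕ} (x : Fin (m + 1) → ι) :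
    algebraMap 𝕜 ℂ (LinearMap.trace 𝕜 L
      ((List.ofFn fun j => B (x j)).map
        fun x => (LieAlgebra.ad 𝕜 L x : Module.End 𝕜 L)).prod) =
      ∑ c : Fin (m + 1) → ι, ∏ j, structConst B (c j) (x j) (c (j + 1)) := by
  have h1 : ∀ f : Module.End 𝕜 L, LinearMap.toMatrix B B f = LinearMap.toMatrixAlgEquiv B f :=
    fun _ => rfl
  rw [LinearMap.trace_eq_matrix_trace 𝕜 B, h1, map_list_prod, List.map_map, List.map_ofFn,
    trace_prod_ofFn, map_sum]
  refine Finset.sum_congr rfl fun c _ => ?_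
  rw [map_prod]
  refine Finset.prod_congr rfl fun j _ => ?_
  simp only [Function.comp_apply, LinearMap.toMatrixAlgEquiv_apply, LieAlgebra.ad_apply]
  rfl

open Classical in
theorem algebraMap_trace_prod_ad_reverse {m : ℕ} (x : Fin (m + 1) → ι) :
    algebraMap 𝕜 ℂ (LinearMap.trace 𝕜 L
      ((List.ofFn fun j => B (x j)).reverse.map
        fun x => (LieAlgebra.ad 𝕜 L x : Module.End 𝕜 L)).prod) =
      ∑ c : Fin (m + 1) → ι, ∏ j, structConst B (c (j + 1)) (x j) (c j) := by
  have h1 : ∀ f : Module.End 𝕜 L, LinearMap.toMatrix B B f = LinearMap.toMatrixAlgEquiv B f :=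
    fun _ => rfl
  rw [LinearMap.trace_eq_matrix_trace 𝕜 B, h1, map_list_prod, List.map_reverse, List.map_reverse,
    List.map_map, List.map_ofFn, trace_prod_ofFn_reverse, map_sum]
  refine Finset.sum_congr rfl fun c _ => ?_
  rw [map_prod]
  refine Finset.prod_congr rfl fun j _ => ?_
  simp only [Function.comp_apply, LinearMap.toMatrixAlgEquiv_apply, LieAlgebra.ad_apply]
  rfl

variable {B} (hL : StronglyUnimodular 𝕜 L)
include hL

/-- Strong unimodularity as an identity between sums over closed paths in both directions. -/
theorem StronglyUnimodular.sum_closed_paths {m : ℕ} (x : Fin (m + 1) → ι) :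
    ∑ c : Fin (m + 1) → ι, ∏ j, structConst B (c j) (x j) (c (j + 1)) =
      (-1) ^ (m + 1) * ∑ c : Fin (m + 1) → ι, ∏ j, structConst B (c (j + 1)) (x j) (c j) := by
  rw [← algebraMap_trace_prod_ad, ← algebraMap_trace_prod_ad_reverse, hL]
  simp

/-- The case `k = 1` of strong unimodularity is unimodularity: the adjoint operators are traceless. -/
theorem StronglyUnimodular.sum_structConst (x : ι) : ∑ c, structConst B c x c = 0 := by
  have h := hL.sum_closed_paths (B := B) (m := 0) fun _ => x
  have e : ∀ F : (Fin 1 → ι) → ℂ, ∑ c, F c = ∑ i, F fun _ => i := fun F =>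
    ((Equiv.funUnique (Fin 1) ι).symm.sum_comp F).symm
  rw [e, e] at h
  simp only [Finset.prod_const, Finset.card_univ, Fintype.card_fin, zero_add, pow_one] at h
  linear_combination h / 2

/-- The closed-path identity for the vertices on a cycle of a permutation. -/
theorem StronglyUnimodular.sum_isCycle {N : ℕ} {π : Equiv.Perm (Fin N)} (hπ : π.IsCycle)
    (x : Fin N → ι) :
    ∑ c : {v // v ∈ π.support} → ι, ∏ v : {v // v ∈ π.support}, structConst B (c v) (x v)
        (c ⟨π v, Equiv.Perm.apply_mem_support.2 v.2⟩) =
      (-1) ^ π.support.card * ∑ c : {v // v ∈ π.support} → ι, ∏ v : {v // v ∈ π.support},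
        structConst B (c ⟨π v, Equiv.Perm.apply_mem_support.2 v.2⟩) (x v) (c v) := by
  -- the points of the cycle are enumerated by `j ↦ π ^ j v₀`
  obtain ⟨v₀, hv₀, hs⟩ := id hπ
  have hv₀' : v₀ ∈ π.support := Equiv.Perm.mem_support.2 hv₀
  obtain ⟨m, hm⟩ : ∃ m, π.support.card = m + 1 :=
    Nat.exists_eq_succ_of_ne_zero (Finset.card_pos.2 ⟨v₀, hv₀'⟩).ne'
  have ho : orderOf π = m + 1 := by rw [hπ.orderOf, hm]
  let g : Fin (m + 1) → {v // v ∈ π.support} := fun j =>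
    ⟨(π ^ (j : ℕ)) v₀, Equiv.Perm.pow_apply_mem_support.2 hv₀'⟩
  have hg : Function.Bijective g := by
    rw [Fintype.bijective_iff_surjective_and_card]
    refine ⟨?_, by rw [Fintype.card_fin, Fintype.card_coe, hm]⟩
    rintro ⟨v, hv⟩
    obtain ⟨i, hi, h⟩ := (hs (Equiv.Perm.mem_support.1 hv)).exists_pow_eq'
    exact ⟨⟨i, by omega⟩, Subtype.ext h⟩
  have hstep : ∀ j, (⟨π (g j), Equiv.Perm.apply_mem_support.2 (g j).2⟩ : {v // v ∈ π.support}) =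
      g (j + 1) := by
    intro j
    apply Subtype.ext
    change π ((π ^ (j : ℕ)) v₀) = (π ^ ((j + 1 : Fin (m + 1)) : ℕ)) v₀
    have h1 : ((j : ℕ) + ((1 : Fin (m + 1)) : ℕ)) % (m + 1) = (j + 1) % (m + 1) := by
      simp [Nat.add_mod]
    rw [← Equiv.Perm.mul_apply, ← pow_succ', Fin.val_add, h1, ← pow_mod_orderOf, ho]
  let G : Fin (m + 1) ≃ {v // v ∈ π.support} := Equiv.ofBijective g hg
  have key := hL.sum_closed_paths (B := B) (fun j => x (g j))
  rw [hm, ← (G.arrowCongr (Equiv.refl ι)).sum_comp, ← (G.arrowCongr (Equiv.refl ι)).sum_comp]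
  have hc : ∀ (c : Fin (m + 1) → ι) j, (G.arrowCongr (Equiv.refl ι)) c (g j) = c j := by
    intro c j
    change c (G.symm (G j)) = c j
    rw [Equiv.symm_apply_apply]
  convert key using 3 with c _ c _
  · rw [← G.prod_comp]
    refine Finset.prod_congr rfl fun j _ => ?_
    change structConst B ((G.arrowCongr (Equiv.refl ι)) c (g j)) (x (g j))
      ((G.arrowCongr (Equiv.refl ι)) c ⟨π (g j), _⟩) = _
    rw [hstep, hc, hc]
  · rw [← G.prod_comp]
    refine Finset.prod_congr rfl fun j _ => ?_
    change structConst B ((G.arrowCongr (Equiv.refl ι)) c ⟨π (g j), _⟩) (x (g j))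
      ((G.arrowCongr (Equiv.refl ι)) c (g j)) = _
    rw [hstep, hc, hc]

omit hL in
/-- A sum over functions, in which the values on `s` enter only through the last factor. -/
theorem sum_eq_sum_of_sum_subtype {α R : Type*} [Fintype α] [DecidableEq α] [CommRing R]
    (s : Finset α) (W : (α → ι) → R) (F F' : (α → ι) → R)
    (hW : ∀ k k', (∀ v ∉ s, k v = k' v) → W k = W k')
    (hF : ∀ k : α → ι, ∑ c : {v // v ∈ s} → ι, F (fun v => if h : v ∈ s then c ⟨v, h⟩ else k v) =
      ∑ c : {v // v ∈ s} → ι, F' (fun v => if h : v ∈ s then c ⟨v, h⟩ else k v)) :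
    ∑ k, W k * F k = ∑ k, W k * F' k := by
  have key : ∀ F : (α → ι) → R, ∑ k, W k * F k = ∑ r : {v // ¬ v ∈ s} → ι,
      ∑ c : {v // v ∈ s} → ι, W (fun v => if h : v ∈ s then c ⟨v, h⟩ else r ⟨v, h⟩) *
        F (fun v => if h : v ∈ s then c ⟨v, h⟩ else r ⟨v, h⟩) := by
    intro F
    rw [← (Equiv.piEquivPiSubtypeProd (fun v => v ∈ s) fun _ => ι).symm.sum_comp,
      Fintype.sum_prod_type_right]
    rfl
  rw [key, key]
  refine Finset.sum_congr rfl fun r _ => ?_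
  rcases isEmpty_or_nonempty ({v // v ∈ s} → ι) with he | ⟨⟨c₀⟩⟩
  · simp
  · set k₀ : α → ι := fun v => if h : v ∈ s then c₀ ⟨v, h⟩ else r ⟨v, h⟩ with hk₀
    have e1 : ∀ c : {v // v ∈ s} → ι, (fun v => if h : v ∈ s then c ⟨v, h⟩ else r ⟨v, h⟩) =
        fun v => if h : v ∈ s then c ⟨v, h⟩ else k₀ v := by
      intro c; funext v
      by_cases h : v ∈ s <;> simp [h, hk₀]
    have e2 : ∀ c : {v // v ∈ s} → ι, W (fun v => if h : v ∈ s then c ⟨v, h⟩ else k₀ v) = W k₀ := by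
      intro c
      apply hW
      intro v hv
      simp [hv]
    simp_rw [e1, e2, ← Finset.mul_sum, hF]

/-- Reversing the direction of a cycle in a sum over colors. -/
theorem StronglyUnimodular.sum_colors {N : ℕ} {π : Equiv.Perm (Fin N)} (hπ : π.IsCycle)
    (W : (Fin N → ι) → ℂ) (x : Fin N → (Fin N → ι) → ι)
    (hW : ∀ k k', (∀ v ∉ π.support, k v = k' v) → W k = W k')
    (hx : ∀ v ∈ π.support, ∀ k k', (∀ v ∉ π.support, k v = k' v) → x v k = x v k') :
    ∑ k, W k * ∏ v ∈ π.support, structConst B (k v) (x v k) (k (π v)) =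
      (-1) ^ π.support.card *
        ∑ k, W k * ∏ v ∈ π.support, structConst B (k v) (x v k) (k (π.symm v)) := by
  classical
  rw [Finset.mul_sum]
  simp_rw [mul_left_comm _ (W _)]
  refine sum_eq_sum_of_sum_subtype π.support W _ _ hW fun k => ?_
  have h := hL.sum_isCycle (B := B) hπ (fun v => x v k)
  have hx' : ∀ v ∈ π.support, ∀ c : {v // v ∈ π.support} → ι,
      x v (fun v => if h : v ∈ π.support then c ⟨v, h⟩ else k v) = x v k := by
    intro v hv c
    apply hx v hv
    intro w hw
    simp [hw]
  calc _ = ∑ c : {v // v ∈ π.support} → ι, ∏ v : {v // v ∈ π.support}, structConst B (c v) (x v k)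
        (c ⟨π v, Equiv.Perm.apply_mem_support.2 v.2⟩) := by
        refine Finset.sum_congr rfl fun c _ => ?_
        rw [← Finset.prod_coe_sort]
        refine Finset.prod_congr rfl fun v _ => ?_
        simp only [hx' v v.2, dif_pos v.2, dif_pos (Equiv.Perm.apply_mem_support.2 v.2)]
    _ = _ := h
    _ = _ := by
        rw [← Finset.mul_sum]
        congr 1
        -- the colors are shifted by one step along the cycle
        let P : Equiv.Perm {v // v ∈ π.support} :=
          π.subtypePerm fun v => Equiv.Perm.apply_mem_support
        rw [← (P.arrowCongr (Equiv.refl ι)).sum_comp]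
        refine Finset.sum_congr rfl fun c _ => ?_
        conv_rhs => rw [← Finset.prod_coe_sort]
        refine Finset.prod_congr rfl fun v _ => ?_
        have hmem : π.symm v ∈ π.support := by
          rw [← Equiv.Perm.apply_mem_support, Equiv.apply_symm_apply]; exact v.2
        simp only [hx' v v.2, dif_pos v.2, dif_pos hmem]
        change structConst B (c (P.symm (P v))) (x v k) (c (P.symm v)) = _
        rw [Equiv.symm_apply_apply]
        rfl

/-- A vertex contracted with itself contributes the trace of an adjoint operator. -/
theorem StronglyUnimodular.sum_colors_self {N : ℕ} (v : Fin N)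
    (W : (Fin N → ι) → ℂ) (x : (Fin N → ι) → ι)
    (hW : ∀ k k', (∀ w ≠ v, k w = k' w) → W k = W k')
    (hx : ∀ k k', (∀ w ≠ v, k w = k' w) → x k = x k') :
    ∑ k, W k * structConst B (k v) (x k) (k v) = 0 := by
  classical
  rw [sum_eq_sum_of_sum_subtype {v} W _ (fun _ => 0) (by simpa using hW)]
  · simp
  · intro k
    rw [Finset.sum_const_zero, ← hL.sum_structConst (B := B) (x k)]
    rw [← (Equiv.funUnique {w // w ∈ ({v} : Finset (Fin N))} ι).symm.sum_comp]
    refine Finset.sum_congr rfl fun c _ => ?_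
    rw [hx _ k]
    · simp
    · intro w hw; simp [hw]

end Lie

/-! ### Color factors in terms of the outgoing half-edges -/

section Colors

variable {𝕜 L ι : Type*} [Field 𝕜] [Algebra 𝕜 ℂ] [LieRing L] [LieAlgebra 𝕜 L]
  [Fintype ι] {n N : ℕ} {Φ : Fin n → Insertion}

/-- The color of a half-edge of charge `+1`, if the outgoing half-edge at the vertex `v` has
color `k v`. -/
def outColor (e : Fin n → ι) (k : Fin N → ι) : HalfEdge n N → ι
  | .inl i => e i
  | .inr (v, _) => k v

open Classical in
/-- The condition that the colors of the roots agree with those of the adjacent half-edges. -/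
def rootDelta (Γ : Diagram Φ N) (e : Fin n → ι) (k : Fin N → ι) : ℂ :=
  if ∀ i, (Φ i).charge = -1 → e i = outColor e k (Γ.pairing.1 (.inl i)) then 1 else 0

/-- The colors of the outgoing half-edges determine those of all half-edges at the vertices. -/
theorem colorFactor_eq (B : Module.Basis ι 𝕜 L) (e : Fin n → ι) (Γ : Diagram Φ N) :
    Γ.colorFactor B e = ∑ k : Fin N → ι, rootDelta Γ e k *
      ∏ v, structConst B (k v) (outColor e k (Γ.pairing.1 (.inr (v, 1))))
        (outColor e k (Γ.pairing.1 (.inr (v, 2)))) := by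
  classical
  set σ := Γ.pairing.1 with hσ
  unfold Diagram.colorFactor colorDelta rootDelta
  simp_rw [mul_ite, mul_one, mul_zero, ite_mul, one_mul, zero_mul]
  rw [← Finset.sum_filter, ← Finset.sum_filter]
  have hout : ∀ (κ : Fin N → Fin 3 → ι) (h : HalfEdge n N), hCharge Φ h = 1 →
      outColor e (fun v => κ v 0) h = colors e κ h := by
    rintro κ (i | ⟨v, s⟩) hh
    · rfl
    · simp only [hCharge] at hh
      have : s = 0 := by by_contra h; simp [h] at hh
      subst this; rfl
  have hin : ∀ (κ : Fin N → Fin 3 → ι), (∀ h, colors e κ h = colors e κ (σ h)) →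
      ∀ v s, s ≠ 0 → outColor e (fun v => κ v 0) (σ (.inr (v, s))) = κ v s := by
    intro κ hκ v s hs
    rw [hout _ _ (by rw [Γ.hCharge_pairing]; simp [hCharge, hs]), ← hκ]
    rfl
  refine Finset.sum_nbij' (fun κ v => κ v 0)
    (fun k v s => if s = 0 then k v else outColor e k (σ (.inr (v, s)))) ?_ ?_ ?_ ?_ ?_
  · intro κ hκ
    simp only [Finset.mem_filter, Finset.mem_univ, true_and] at hκ ⊢
    intro i hi
    rw [hout _ _ (by rw [Γ.hCharge_pairing]; simp [hCharge, hi]), ← hκ]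
    rfl
  · intro k hk
    simp only [Finset.mem_filter, Finset.mem_univ, true_and] at hk ⊢
    have key : ∀ h, hCharge Φ h = 1 →
        colors e (fun v s => if s = 0 then k v else outColor e k (σ (.inr (v, s)))) (σ h) =
        colors e (fun v s => if s = 0 then k v else outColor e k (σ (.inr (v, s)))) h := by
      intro h hh
      have h1 : colors e (fun v s => if s = 0 then k v else outColor e k (σ (.inr (v, s)))) h =
          outColor e k h := by
        rcases h with i | ⟨v, s⟩
        · rfl
        · have : s = 0 := by by_contra h; simp [hCharge, h] at hh
          subst this; rfl
      have h2 : hCharge Φ (σ h) = -1 := by rw [Γ.hCharge_pairing, hh]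
      have h3 : σ (σ h) = h := Γ.pairing.apply_apply h
      rw [h1]
      rcases hh' : σ h with i | ⟨v, s⟩
      · rw [hh'] at h2 h3
        rw [← h3, ← hk i h2]
        rfl
      · rw [hh'] at h2 h3
        have hs : s ≠ 0 := by rintro rfl; simp [hCharge] at h2
        simp [colors, hs, h3]
    intro h
    rcases hCharge_eq (Φ := Φ) h with hc | hc
    · exact (key h hc).symm
    · have := key (σ h) (by rw [Γ.hCharge_pairing, hc]; rfl)
      rwa [show σ (σ h) = h from Γ.pairing.apply_apply h] at this
  · intro κ hκ
    simp only [Finset.mem_filter, Finset.mem_univ, true_and] at hκ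
    funext v s
    by_cases hs : s = 0
    · simp [hs]
    · simp only [hs, if_false]
      exact hin κ hκ v s hs
  · intro k _; simp
  · intro κ hκ
    simp only [Finset.mem_filter, Finset.mem_univ, true_and] at hκ
    refine Finset.prod_congr rfl fun v _ => ?_
    rw [hin κ hκ v 1 (by decide), hin κ hκ v 2 (by decide)]

/-- Self-contractions of a vertex vanish by unimodularity. -/
theorem colorFactor_eq_zero (hL : StronglyUnimodular 𝕜 L) (B : Module.Basis ι 𝕜 L) (e : Fin n → ι)
    (Γ : Diagram Φ N) {v : Fin N} {s : Fin 3} (hv : Γ.pairing.1 (.inr (v, 0)) = .inr (v, s)) :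
    Γ.colorFactor B e = 0 := by
  classical
  rw [colorFactor_eq]
  have hs : s ≠ 0 := by
    rintro rfl
    exact Γ.pairing.apply_ne _ hv
  have hv' : Γ.pairing.1 (.inr (v, s)) = .inr (v, 0) := by rw [← hv, Γ.pairing.apply_apply]
  have hout : ∀ h, hCharge Φ h = -1 → h ≠ .inr (v, s) → ∀ k k' : Fin N → ι,
      (∀ w ≠ v, k w = k' w) →
      outColor e k (Γ.pairing.1 h) = outColor e k' (Γ.pairing.1 h) := by
    intro h hh hne k k' hk
    have hc := Γ.hCharge_pairing h
    rcases hh' : Γ.pairing.1 h with i | ⟨w, t⟩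
    · rfl
    · refine hk w ?_
      rintro rfl
      rw [hh', hh] at hc
      have : t = 0 := by by_contra ht; norm_num [hCharge, ht] at hc
      subst this
      apply hne
      rw [← hv, ← hh', Γ.pairing.apply_apply]
  -- the factors that do not depend on the color of the line from `v` to itself
  set W : (Fin N → ι) → ℂ := fun k => rootDelta Γ e k * ∏ w ∈ Finset.univ.erase v,
    structConst B (k w) (outColor e k (Γ.pairing.1 (.inr (w, 1))))
        (outColor e k (Γ.pairing.1 (.inr (w, 2)))) with hWdef
  have hW : ∀ k k' : Fin N → ι, (∀ w ≠ v, k w = k' w) → W k = W k' := by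
    intro k k' hk
    simp only [hWdef, rootDelta]
    congr 1
    · have : ∀ i, (Φ i).charge = -1 → outColor e k (Γ.pairing.1 (.inl i)) =
          outColor e k' (Γ.pairing.1 (.inl i)) := fun i hi => hout (.inl i) hi (by simp) k k' hk
      congr 1
      apply propext
      exact forall₂_congr fun i hi => by rw [this i hi]
    · refine Finset.prod_congr rfl fun w hw => ?_
      have hw := Finset.ne_of_mem_erase hw
      rw [hk w hw, hout _ (by simp [hCharge]) (by simp [hw]) k k' hk,
        hout _ (by simp [hCharge]) (by simp [hw]) k k' hk]
  have hs' : s = 1 ∨ s = 2 := by omega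
  rcases hs' with rfl | rfl
  · rw [← neg_eq_zero, ← hL.sum_colors_self (B := B) v W
      (fun k => outColor e k (Γ.pairing.1 (.inr (v, 2)))) hW
      (fun k k' hk => hout _ (by simp [hCharge]) (by simp) k k' hk), ← Finset.sum_neg_distrib]
    refine Finset.sum_congr rfl fun k _ => ?_
    rw [← Finset.mul_prod_erase _ _ (Finset.mem_univ v), hv', structConst_antisymm]
    simp only [hWdef, outColor]
    ring
  · rw [← hL.sum_colors_self (B := B) v W
      (fun k => outColor e k (Γ.pairing.1 (.inr (v, 1)))) hW
      (fun k k' hk => hout _ (by simp [hCharge]) (by simp) k k' hk)]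
    refine Finset.sum_congr rfl fun k _ => ?_
    rw [← Finset.mul_prod_erase _ _ (Finset.mem_univ v), hv']
    simp only [hWdef, outColor]
    ring

end Colors

/-! ### Reversing a loop -/

namespace VertexKind

/-- The outgoing half-edge is a ghost. -/
def isGhost : VertexKind → Bool
  | gamma => false
  | gammaBar => false
  | db => true
  | dbBar => true

/-- The propagator of the outgoing half-edge is holomorphic. -/
def isHol : VertexKind → Bool
  | gamma => true
  | gammaBar => false
  | db => true
  | dbBar => false

/-- The exchange of the vertices with bosonic and with ghost outgoing half-edge that preserves the
holomorphy of the propagator. -/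
def toggle : VertexKind → VertexKind
  | gamma => db
  | gammaBar => dbBar
  | db => gamma
  | dbBar => gammaBar

/-- Whether the half-edge that is not on the loop carries `ā`, at a vertex of kind `κ` on a loop
whose preceding vertex is of kind `κ'`. -/
def legIsBar (κ κ' : VertexKind) : Bool := if κ.isGhost then κ.isHol else κ'.isHol

/-- The slot through which a loop enters a vertex of kind `κ` from a vertex of kind `κ'`. -/
def loopSlot (κ κ' : VertexKind) : Fin 3 := if !κ.isGhost && κ'.isHol then 1 else 2

/-- The permutation of the slots of a vertex on a loop when the loop is reversed. -/
def slotPerm (κ κ' : VertexKind) : Equiv.Perm (Fin 3) :=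
  if legIsBar κ κ' then Equiv.swap 1 2 else 1

theorem toggle_toggle (κ : VertexKind) : κ.toggle.toggle = κ := by cases κ <;> rfl

theorem isGhost_toggle (κ : VertexKind) : κ.toggle.isGhost = !κ.isGhost := by cases κ <;> rfl

theorem loopSlot_ne_zero (κ κ' : VertexKind) : loopSlot κ κ' ≠ 0 := by
  unfold loopSlot; split_ifs <;> decide

theorem slotPerm_zero (κ κ' : VertexKind) : slotPerm κ κ' 0 = 0 := by
  unfold slotPerm; split_ifs <;> decide

theorem slotPerm_slotPerm (κ κ' : VertexKind) (s : Fin 3) :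
    slotPerm κ κ' (slotPerm κ κ' s) = s := by
  unfold slotPerm; split_ifs <;> simp

theorem slotPerm_toggle {κ κ' : VertexKind} (h : κ.isGhost = κ'.isGhost) :
    slotPerm κ'.toggle κ.toggle = slotPerm κ κ' := by
  cases κ <;> cases κ' <;> first | rfl | exact absurd h (by decide)

/-- The field on the half-edge that is not on the loop is the same after the reversal. -/
theorem letter_slotPerm {κ κ' : VertexKind} (h : κ.isGhost = κ'.isGhost) {s : Fin 3} (hs : s ≠ 0)
    (hs' : s ≠ loopSlot κ κ') : κ'.toggle.letter (slotPerm κ κ' s) = κ.letter s := by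
  fin_cases s <;> cases κ <;> cases κ' <;>
    first | rfl | exact absurd h (by decide) | exact absurd rfl hs | exact absurd rfl hs'

/-- The fields along the reversed loop can be contracted. -/
theorem contractible_toggle {κ κ' : VertexKind} (h : κ.isGhost = κ'.isGhost) :
    Contractible (κ.toggle.letter 0) (κ'.toggle.letter (slotPerm κ κ' (loopSlot κ κ'))) := by
  cases κ <;> cases κ' <;>
    first | exact absurd h (by decide) | exact trivial

/-- A vertex with an incoming ghost line has an outgoing ghost line. -/
theorem isGhost_of_contractible {κ κ' : VertexKind} {s : Fin 3}
    (h : Contractible (κ'.letter 0) (κ.letter s)) (hg : κ'.isGhost = true) : κ.isGhost = true := by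
  fin_cases s <;> cases κ <;> cases κ' <;>
    first | rfl | exact absurd hg (by decide) | exact h.elim

/-- The kinds of two consecutive vertices on a loop determine the slot at which the loop enters the
second one. -/
theorem loopSlot_of_contractible {κ κ' : VertexKind} {s : Fin 3}
    (h : Contractible (κ'.letter 0) (κ.letter s)) (hg : κ.isGhost = κ'.isGhost) :
    s = loopSlot κ κ' := by
  fin_cases s <;> cases κ <;> cases κ' <;>
    first | rfl | exact absurd hg (by decide) | exact h.elim

/-- The propagators of bosons and ghosts agree up to the direction of the line. -/
theorem outGreen_toggle (C : ℂ) (κ : VertexKind) (w z : ℂ) :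
    outGreen C (κ.toggle.letter 0) z w = outGreen C (κ.letter 0) w z := by
  cases κ <;> rfl

end VertexKind

open VertexKind

namespace Diagram

variable {n N : ℕ} {Φ : Fin n → Insertion}

/-- The vertices moved by `π` form a loop of the diagram, with `π v` following `v`. -/
structure IsLoop (Γ : Diagram Φ N) (π : Equiv.Perm (Fin N)) : Prop where
  isCycle : π.IsCycle
  exists_slot : ∀ v ∈ π.support, ∃ s, Γ.pairing.1 (.inr (v, 0)) = .inr (π v, s)

/-- The permutation of the slots of each vertex when the loop `π` is reversed. -/
def loopSlotPerm (ν : Fin N → VertexKind) (π : Equiv.Perm (Fin N)) (v : Fin N) :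
    Equiv.Perm (Fin 3) :=
  if v ∈ π.support then slotPerm (ν v) (ν (π.symm v)) else 1

/-- The conjugation by this permutation reverses the loop `π`: it moves the outgoing half-edges by
two steps along the loop and permutes the incoming half-edges of each vertex. -/
def flipPerm (ν : Fin N → VertexKind) (π : Equiv.Perm (Fin N)) : Equiv.Perm (HalfEdge n N) :=
  Equiv.sumCongr (Equiv.refl _)
    { toFun := fun x => if x.2 = 0 then (π (π x.1), 0) else (x.1, loopSlotPerm ν π x.1 x.2)
      invFun := fun x =>
        if x.2 = 0 then (π.symm (π.symm x.1), 0) else (x.1, (loopSlotPerm ν π x.1).symm x.2)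
      left_inv := by
        rintro ⟨v, s⟩
        by_cases hs : s = 0
        · simp [hs]
        · have : loopSlotPerm ν π v s ≠ 0 := by
            unfold loopSlotPerm
            split_ifs
            · rw [← slotPerm_zero (ν v) (ν (π.symm v))]
              exact (Equiv.injective _).ne hs
            · exact hs
          simp [hs, this]
      right_inv := by
        rintro ⟨v, s⟩
        by_cases hs : s = 0
        · simp [hs]
        · have : (loopSlotPerm ν π v).symm s ≠ 0 := by
            intro h
            rw [Equiv.symm_apply_eq] at h
            apply hs
            rw [h]
            unfold loopSlotPerm
            split_ifs
            · exact slotPerm_zero _ _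
            · rfl
          simp [hs, this] }

section

variable (ν : Fin N → VertexKind) (π : Equiv.Perm (Fin N))

theorem flipPerm_inl (i : Fin n) : flipPerm ν π (.inl i : HalfEdge n N) = .inl i := rfl

theorem flipPerm_zero (v : Fin N) :
    flipPerm ν π (.inr (v, 0) : HalfEdge n N) = .inr (π (π v), 0) := rfl

theorem flipPerm_slot (v : Fin N) {s : Fin 3} (hs : s ≠ 0) :
    flipPerm ν π (.inr (v, s) : HalfEdge n N) = .inr (v, loopSlotPerm ν π v s) := by
  simp [flipPerm, hs]

theorem loopSlotPerm_ne_zero (v : Fin N) {s : Fin 3} (hs : s ≠ 0) : loopSlotPerm ν π v s ≠ 0 := by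
  unfold loopSlotPerm
  split_ifs
  · rw [← slotPerm_zero (ν v) (ν (π.symm v))]
    exact (Equiv.injective _).ne hs
  · exact hs

theorem flipPerm_of_notMem {v : Fin N} (hv : v ∉ π.support) (s : Fin 3) :
    flipPerm ν π (.inr (v, s) : HalfEdge n N) = .inr (v, s) := by
  have h := Equiv.Perm.notMem_support.1 hv
  by_cases hs : s = 0
  · subst hs; rw [flipPerm_zero, h, h]
  · rw [flipPerm_slot ν π v hs, loopSlotPerm, if_neg hv]; rfl

theorem points_flipPerm (z : Fin n → ℂ) (u : Fin N → ℂ) {h : HalfEdge n N}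
    (hh : hCharge Φ h = -1) : points z u (flipPerm ν π h) = points z u h := by
  rcases h with i | ⟨v, s⟩
  · rfl
  · have hs : s ≠ 0 := by rintro rfl; simp [hCharge] at hh
    rw [flipPerm_slot ν π v hs]; rfl

/-- The kinds of the vertices after the loop `π` is reversed. -/
def flipKind (v : Fin N) : VertexKind :=
  if v ∈ π.support then (ν (π.symm v)).toggle else ν v

end

theorem symm_mem_support {π : Equiv.Perm (Fin N)} {v : Fin N} :
    π.symm v ∈ π.support ↔ v ∈ π.support := by
  rw [← Equiv.Perm.apply_mem_support, Equiv.apply_symm_apply]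

namespace IsLoop

variable {Γ : Diagram Φ N} {π : Equiv.Perm (Fin N)} (hπ : Γ.IsLoop π)
include hπ

/-- The outgoing lines along a loop are all bosonic or all ghosts. -/
theorem isGhost_apply {v : Fin N} (hv : v ∈ π.support) :
    (Γ.kind (π v)).isGhost = (Γ.kind v).isGhost := by
  have hstep : ∀ v ∈ π.support, (Γ.kind v).isGhost = true → (Γ.kind (π v)).isGhost = true := by
    intro v hv hg
    obtain ⟨s, hs⟩ := hπ.exists_slot v hv
    have := Γ.admissible (.inr (v, 0))
    rw [hs] at this
    exact isGhost_of_contractible this hg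
  have hinv := Equiv.Perm.perm_symm_mapsTo_of_mapsTo π
    (s := {v | v ∈ π.support ∧ (Γ.kind v).isGhost = true})
    fun x hx => ⟨Equiv.Perm.apply_mem_support.2 hx.1, hstep x hx.1 hx.2⟩
  rw [Bool.eq_iff_iff]
  constructor
  · intro hg
    have := hinv (x := π v) ⟨Equiv.Perm.apply_mem_support.2 hv, hg⟩
    rw [Equiv.symm_apply_apply] at this
    exact this.2
  · exact hstep v hv

theorem isGhost_symm {v : Fin N} (hv : v ∈ π.support) :
    (Γ.kind v).isGhost = (Γ.kind (π.symm v)).isGhost := by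
  have := hπ.isGhost_apply (symm_mem_support.2 hv)
  rwa [Equiv.apply_symm_apply] at this

theorem pairing_out {v : Fin N} (hv : v ∈ π.support) :
    Γ.pairing.1 (.inr (v, 0)) = .inr (π v, loopSlot (Γ.kind (π v)) (Γ.kind v)) := by
  obtain ⟨s, hs⟩ := hπ.exists_slot v hv
  have := Γ.admissible (.inr (v, 0))
  rw [hs] at this
  rw [hs, ← loopSlot_of_contractible this (hπ.isGhost_apply hv)]

theorem pairing_in {v : Fin N} (hv : v ∈ π.support) :
    Γ.pairing.1 (.inr (v, loopSlot (Γ.kind v) (Γ.kind (π.symm v)))) = .inr (π.symm v, 0) := by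
  have := hπ.pairing_out (symm_mem_support.2 hv)
  rw [Equiv.apply_symm_apply] at this
  rw [← this, Γ.pairing.apply_apply]

/-- An incoming half-edge is on the loop, or its partner is not. -/
theorem in_cases (h : HalfEdge n N) :
    (∃ v ∈ π.support, h = .inr (v, loopSlot (Γ.kind v) (Γ.kind (π.symm v)))) ∨
      ∀ v ∈ π.support, Γ.pairing.1 h ≠ .inr (v, 0) := by
  by_contra hcon
  push Not at hcon
  obtain ⟨h1, v, hv, h2⟩ := hcon
  refine h1 (π v) (Equiv.Perm.apply_mem_support.2 hv) ?_
  rw [Equiv.symm_apply_apply, ← hπ.pairing_out hv, ← h2, Γ.pairing.apply_apply]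

end IsLoop

theorem flipPerm_of_out (ν : Fin N → VertexKind) {π : Equiv.Perm (Fin N)} {h : HalfEdge n N}
    (hh : hCharge Φ h = 1) (hne : ∀ v ∈ π.support, h ≠ .inr (v, 0)) :
    flipPerm ν π h = h := by
  rcases h with i | ⟨v, s⟩
  · rfl
  · have : s = 0 := by by_contra h; simp [hCharge, h] at hh
    subst this
    exact flipPerm_of_notMem ν π (fun hv => hne v hv rfl) 0

/-- Off the loop, the reversal does not change the fields on the half-edges. -/
theorem letters_flipPerm {Γ : Diagram Φ N} {π : Equiv.Perm (Fin N)} (hπ : Γ.IsLoop π)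
    {h : HalfEdge n N} (h1 : ∀ v ∈ π.support, h ≠ .inr (v, 0))
    (h2 : ∀ v ∈ π.support, h ≠ .inr (v, loopSlot (Γ.kind v) (Γ.kind (π.symm v)))) :
    letters Φ (flipKind Γ.kind π) (flipPerm Γ.kind π h) = letters Φ Γ.kind h := by
  rcases h with i | ⟨v, s⟩
  · rfl
  · by_cases hv : v ∈ π.support
    · have hs : s ≠ 0 := by rintro rfl; exact h1 v hv rfl
      have hs' : s ≠ loopSlot (Γ.kind v) (Γ.kind (π.symm v)) := by
        intro h; exact h2 v hv (by rw [h])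
      rw [flipPerm_slot _ _ _ hs]
      simp only [letters, Sum.elim_inr, flipKind, loopSlotPerm, if_pos hv]
      exact letter_slotPerm (hπ.isGhost_symm hv) hs hs'
    · rw [flipPerm_of_notMem _ _ hv]
      simp only [letters, Sum.elim_inr, flipKind, if_neg hv]

/-- The diagram in which the loop `π` is reversed, and bosonic and ghost lines are exchanged along
it. -/
def flip (Γ : Diagram Φ N) (π : Equiv.Perm (Fin N)) (hπ : Γ.IsLoop π) : Diagram Φ N where
  kind := flipKind Γ.kind π
  pairing := ⟨(flipPerm Γ.kind π).symm.trans (Γ.pairing.1.trans (flipPerm Γ.kind π)), by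
    intro h
    simp [Γ.pairing.apply_apply], by
    intro h
    simp only [Equiv.trans_apply]
    rw [ne_eq, ← Equiv.eq_symm_apply]
    exact Γ.pairing.apply_ne _⟩
  admissible := by
    have hloop : ∀ v ∈ π.support, Contractible
        (letters Φ (flipKind Γ.kind π) (flipPerm Γ.kind π (.inr (v, 0))))
        (letters Φ (flipKind Γ.kind π) (flipPerm Γ.kind π (Γ.pairing.1 (.inr (v, 0))))) := by
      intro v hv
      have hv1 := Equiv.Perm.apply_mem_support.2 hv
      have hv2 := Equiv.Perm.apply_mem_support.2 hv1
      rw [hπ.pairing_out hv, flipPerm_zero, flipPerm_slot _ _ _ (loopSlot_ne_zero _ _)]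
      simp only [letters, Sum.elim_inr, flipKind, loopSlotPerm, if_pos hv1, if_pos hv2,
        Equiv.symm_apply_apply]
      exact contractible_toggle (hπ.isGhost_apply hv)
    intro h'
    obtain ⟨h, rfl⟩ := (flipPerm Γ.kind π).surjective h'
    simp only [Equiv.trans_apply, Equiv.symm_apply_apply]
    by_cases h1 : ∃ v ∈ π.support, h = .inr (v, 0)
    · obtain ⟨v, hv, rfl⟩ := h1
      exact hloop v hv
    by_cases h2 : ∃ v ∈ π.support, h = .inr (v, loopSlot (Γ.kind v) (Γ.kind (π.symm v)))
    · obtain ⟨v, hv, rfl⟩ := h2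
      have := (hloop _ (symm_mem_support.2 hv)).symm
      rw [hπ.pairing_out (symm_mem_support.2 hv), Equiv.apply_symm_apply] at this
      rwa [hπ.pairing_in hv]
    push Not at h1 h2
    rw [letters_flipPerm hπ h1 h2, letters_flipPerm hπ]
    · exact Γ.admissible h
    · intro v hv h3
      apply h2 (π v) (Equiv.Perm.apply_mem_support.2 hv)
      rw [Equiv.symm_apply_apply, ← hπ.pairing_out hv, ← h3, Γ.pairing.apply_apply]
    · intro v hv h3
      apply h1 (π.symm v) (symm_mem_support.2 hv)
      rw [← hπ.pairing_in hv, ← h3, Γ.pairing.apply_apply]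

section

variable {Γ : Diagram Φ N} {π : Equiv.Perm (Fin N)} (hπ : Γ.IsLoop π)

/-- The reversal conjugates the pairing by `flipPerm`. -/
theorem flip_pairing (h : HalfEdge n N) :
    (Γ.flip π hπ).pairing.1 (flipPerm Γ.kind π h) = flipPerm Γ.kind π (Γ.pairing.1 h) := by
  simp [flip]

theorem flip_kind (v : Fin N) : (Γ.flip π hπ).kind v = flipKind Γ.kind π v := rfl

/-- The reversed loop is a loop of the new diagram. -/
theorem isLoop_flip : (Γ.flip π hπ).IsLoop π⁻¹ := by
  refine ⟨hπ.isCycle.inv, ?_⟩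
  intro v hv
  rw [Equiv.Perm.support_inv] at hv
  have hv1 := symm_mem_support.2 hv
  have hv2 := symm_mem_support.2 hv1
  have h := flip_pairing hπ (.inr (π.symm (π.symm v), 0))
  rw [hπ.pairing_out hv2, flipPerm_zero, flipPerm_slot _ _ _ (loopSlot_ne_zero _ _)] at h
  simp only [Equiv.apply_symm_apply] at h
  exact ⟨_, h⟩

theorem ext' {Γ Γ' : Diagram Φ N} (h1 : Γ.kind = Γ'.kind)
    (h2 : ∀ h, Γ.pairing.1 h = Γ'.pairing.1 h) : Γ = Γ' := by
  obtain ⟨k, p, a⟩ := Γ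
  obtain ⟨k', p', a'⟩ := Γ'
  obtain rfl : k = k' := h1
  obtain rfl : p = p' := Subtype.ext (Equiv.ext h2)
  rfl

/-- Reversing a loop twice gives back the diagram. -/
theorem flip_flip : (Γ.flip π hπ).flip π⁻¹ (isLoop_flip hπ) = Γ := by
  -- the permutations of the half-edges in the two reversals are inverse to each other
  have hμ : ∀ h : HalfEdge n N,
      flipPerm (Γ.flip π hπ).kind π⁻¹ (flipPerm Γ.kind π h) = h := by
    rintro (i | ⟨v, s⟩)
    · rfl
    · by_cases hs : s = 0
      · subst hs
        rw [flipPerm_zero, flipPerm_zero]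
        simp
      · rw [flipPerm_slot _ _ _ hs, flipPerm_slot _ _ _ (loopSlotPerm_ne_zero _ _ _ hs)]
        by_cases hv : v ∈ π.support
        · have hv1 := Equiv.Perm.apply_mem_support.2 hv
          simp only [loopSlotPerm, Equiv.Perm.support_inv, if_pos hv]
          have e1 : (Γ.flip π hπ).kind v = (Γ.kind (π.symm v)).toggle := by
            rw [flip_kind, flipKind, if_pos hv]
          have e2 : (Γ.flip π hπ).kind (Equiv.symm π⁻¹ v) = (Γ.kind v).toggle := by
            change (Γ.flip π hπ).kind (π v) = _
            rw [flip_kind, flipKind, if_pos hv1, Equiv.symm_apply_apply]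
          rw [e1, e2, slotPerm_toggle (hπ.isGhost_symm hv), slotPerm_slotPerm]
        · simp [loopSlotPerm, hv]
  apply ext'
  · funext v
    rw [flip_kind]
    unfold flipKind
    rw [Equiv.Perm.support_inv]
    by_cases hv : v ∈ π.support
    · rw [if_pos hv]
      change ((Γ.flip π hπ).kind (π v)).toggle = _
      rw [flip_kind, flipKind, if_pos (Equiv.Perm.apply_mem_support.2 hv), toggle_toggle,
        Equiv.symm_apply_apply]
    · rw [if_neg hv, flip_kind, flipKind, if_neg hv]
  · intro h
    have := flip_pairing (isLoop_flip hπ) (flipPerm Γ.kind π h)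
    rwa [hμ, flip_pairing, hμ] at this

end

end Diagram

open VertexKind

namespace Diagram

/-! ### Cancellation of bosonic and ghost loops -/

variable {n N : ℕ} {Φ : Fin n → Insertion} {Γ : Diagram Φ N} {π : Equiv.Perm (Fin N)}

theorem neg_one_pow_val_add_one (x : ZMod 2) : (-1 : ℂ) ^ (x + 1).val = -(-1) ^ x.val := by
  have : x = 0 ∨ x = 1 := by revert x; decide
  rcases this with rfl | rfl
  · simp [show (0 + 1 : ZMod 2) = 1 from rfl, ZMod.val_one]
  · simp [show (1 + 1 : ZMod 2) = 0 from rfl, ZMod.val_one]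

section

variable (hπ : Γ.IsLoop π)
include hπ

/-- The partner of an incoming half-edge off the loop. The half-edge moves to another slot, but its
partner stays. -/
theorem flipPerm_pairing_in {h : HalfEdge n N} (hh : hCharge Φ h = -1)
    (hne : ∀ v ∈ π.support, Γ.pairing.1 h ≠ .inr (v, 0)) :
    (Γ.flip π hπ).pairing.1 (flipPerm Γ.kind π h) = Γ.pairing.1 h := by
  rw [flip_pairing, flipPerm_of_out _ (by rw [Γ.hCharge_pairing, hh]; rfl) hne]

/-- The partner of an outgoing half-edge off the loop. -/
theorem flip_pairing_out {h : HalfEdge n N} (hh : hCharge Φ h = 1)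
    (hne : ∀ v ∈ π.support, h ≠ .inr (v, 0)) :
    (Γ.flip π hπ).pairing.1 h = flipPerm Γ.kind π (Γ.pairing.1 h) := by
  conv_lhs => rw [← flipPerm_of_out Γ.kind hh hne]
  rw [flip_pairing]

theorem letters_flip_out {h : HalfEdge n N} (hh : hCharge Φ h = 1)
    (hne : ∀ v ∈ π.support, h ≠ .inr (v, 0)) :
    letters Φ (Γ.flip π hπ).kind h = letters Φ Γ.kind h := by
  rcases h with i | ⟨v, s⟩
  · rfl
  · have : s = 0 := by by_contra h; simp [hCharge, h] at hh
    subst this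
    have hv : v ∉ π.support := fun hv => hne v hv rfl
    simp only [letters, Sum.elim_inr, flip_kind, flipKind, if_neg hv]

theorem flip_pairing_notMem {v : Fin N} (hv : v ∉ π.support) {s : Fin 3} (hs : s ≠ 0) :
    (Γ.flip π hπ).pairing.1 (.inr (v, s)) = Γ.pairing.1 (.inr (v, s)) := by
  rw [← flipPerm_pairing_in hπ (by simp [hCharge, hs]), flipPerm_of_notMem _ _ hv]
  intro w hw h
  apply hv
  have := congrArg Γ.pairing.1 h
  rw [Γ.pairing.apply_apply, hπ.pairing_out hw] at this
  simp only [Sum.inr.injEq, Prod.mk.injEq] at this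
  rw [this.1]
  exact Equiv.Perm.apply_mem_support.2 hw

theorem flip_pairing_inl {i : Fin n} (hi : (Φ i).charge = -1) :
    (Γ.flip π hπ).pairing.1 (.inl i) = Γ.pairing.1 (.inl i) := by
  rw [← flipPerm_pairing_in hπ (by simpa [hCharge] using hi), flipPerm_inl]
  intro w hw h
  have := congrArg Γ.pairing.1 h
  rw [Γ.pairing.apply_apply, hπ.pairing_out hw] at this
  cases this

theorem flip_pairing_loop {v : Fin N} (hv : v ∈ π.support) :
    ∃ s, s ≠ 0 ∧ (Γ.flip π hπ).pairing.1 (.inr (v, 0)) = .inr (π.symm v, s) := by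
  have hv' : v ∈ π⁻¹.support := by rwa [Equiv.Perm.support_inv]
  exact ⟨_, loopSlot_ne_zero _ _, (isLoop_flip hπ).pairing_out hv'⟩

end

/-- The outgoing half-edges of the vertices in `s` are separated from the other half-edges of
charge `+1`. -/
theorem prod_outgoing (Γ : Diagram Φ N) {M : Type*} [CommMonoid M] (F : HalfEdge n N → M)
    (s : Finset (Fin N)) :
    ∏ h ∈ Γ.outgoing, F h =
      (∏ h ∈ Γ.outgoing with ∀ v ∈ s, h ≠ .inr (v, 0), F h) * ∏ v ∈ s, F (.inr (v, 0)) := by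
  classical
  rw [← Finset.prod_filter_mul_prod_filter_not _ (fun h => ∀ v ∈ s, h ≠ .inr (v, 0))]
  congr 1
  symm
  refine Finset.prod_bij (fun v _ => .inr (v, 0)) ?_ ?_ ?_ ?_
  · intro v hv
    simp only [Finset.mem_filter, Γ.mem_outgoing]
    refine ⟨rfl, fun h => h v hv rfl⟩
  · intro v _ w _ h
    simpa using h
  · intro h hh
    simp only [Finset.mem_filter, Γ.mem_outgoing] at hh
    have := hh.2
    push Not at this
    obtain ⟨v, hv, rfl⟩ := this
    exact ⟨v, hv, rfl⟩
  · intro v _; rfl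

/-- The product of the oriented propagators does not change when a loop is reversed. -/
theorem prod_outGreen_flip (hπ : Γ.IsLoop π) (C : ℂ) (z : Fin n → ℂ) (u : Fin N → ℂ) :
    ∏ h ∈ (Γ.flip π hπ).outgoing, outGreen C (letters Φ (Γ.flip π hπ).kind h) (points z u h)
        (points z u ((Γ.flip π hπ).pairing.1 h)) =
      ∏ h ∈ Γ.outgoing, outGreen C (letters Φ Γ.kind h) (points z u h)
        (points z u (Γ.pairing.1 h)) := by
  classical
  rw [prod_outgoing _ _ π.support, prod_outgoing _ _ π.support]
  congr 1
  · refine Finset.prod_congr rfl fun h hh => ?_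
    simp only [Finset.mem_filter, mem_outgoing] at hh
    rw [letters_flip_out hπ hh.1 hh.2, flip_pairing_out hπ hh.1 hh.2, points_flipPerm]
    rw [Γ.hCharge_pairing, hh.1]
  · refine Finset.prod_nbij' (fun v => π.symm v) (fun v => π v) ?_ ?_ ?_ ?_ ?_
    · intro v hv; exact symm_mem_support.2 hv
    · intro v hv; exact Equiv.Perm.apply_mem_support.2 hv
    · intro v _; simp
    · intro v _; simp
    · intro v hv
      obtain ⟨s, -, hs⟩ := flip_pairing_loop hπ hv
      rw [hs, hπ.pairing_out (symm_mem_support.2 hv)]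
      simp only [letters, Sum.elim_inr, flip_kind, flipKind, if_pos hv, points,
        Equiv.apply_symm_apply]
      exact outGreen_toggle _ _ _ _

section

variable (hπ : Γ.IsLoop π) (hb : ∀ v ∈ π.support, (Γ.kind v).isGhost = false)
include hb

theorem isGhost_flip {v : Fin N} (hv : v ∈ π.support) :
    ((Γ.flip π hπ).kind v).isGhost = true := by
  rw [flip_kind, flipKind, if_pos hv, isGhost_toggle, hb _ (symm_mem_support.2 hv)]
  rfl

omit hb in
theorem not_isOdd_letter {κ : VertexKind} (hκ : κ.isGhost = false) (s : Fin 3) :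
    ¬ (κ.letter s).IsOdd := by
  fin_cases s <;> cases κ <;> first | exact absurd hκ (by decide) | exact id

/-- Replacing a bosonic loop by a ghost loop changes the sign of the Wick contraction. -/
theorem wickSign_flip : (Γ.flip π hπ).wickSign = -Γ.wickSign := by
  classical
  have hoff : ∀ h : HalfEdge n N, (letters Φ Γ.kind h).IsOdd → ∀ v ∈ π.support, ∀ s,
      h ≠ .inr (v, s) := by
    rintro h hh v hv s rfl
    exact not_isOdd_letter (hb v hv) s hh
  have hpar : chordParity (Γ.flip π hπ).oddOutgoing rank
        (fun h => rank ((Γ.flip π hπ).pairing.1 h)) =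
      chordParity Γ.oddOutgoing rank (fun h => rank (Γ.pairing.1 h)) + 1 := by
    -- the ghost lines outside of the bosonic loop do not change
    have hq : ∀ o ∈ Γ.oddOutgoing, (Γ.flip π hπ).pairing.1 o = Γ.pairing.1 o := by
      intro o ho
      rw [mem_oddOutgoing] at ho
      rw [flip_pairing_out hπ ho.1 fun v hv => hoff o ho.2 v hv 0]
      have h1 := hoff (Γ.pairing.1 o) (by rw [Γ.isOdd_pairing]; exact ho.2)
      rcases h2 : Γ.pairing.1 o with i | ⟨w, s⟩
      · rfl
      · rw [flipPerm_of_notMem]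
        intro hw
        exact h1 w hw s h2
    -- the ghost lines after the reversal are the old ones and those of the loop, which enters each
    -- vertex through the slot `2`
    rw [chordParity_loop (π := π⁻¹) hπ.isCycle.inv (R := Γ.oddOutgoing)]
    · congr 1
      refine Finset.sum_congr rfl fun o ho => Finset.sum_congr rfl fun o' ho' => ?_
      simp only [hq o ho, hq o' ho']
    · intro F
      rw [Equiv.Perm.support_inv, oddOutgoing, oddOutgoing, Finset.sum_filter]
      have := prod_outgoing (Γ.flip π hπ) (M := Multiplicative (ZMod 2))
        (fun h => Multiplicative.ofAdd
          (if (letters Φ (Γ.flip π hπ).kind h).IsOdd then F h else 0)) π.support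
      have h3 := congrArg Multiplicative.toAdd this
      simp only [toAdd_mul, toAdd_prod, toAdd_ofAdd] at h3
      rw [h3]
      congr 1
      · rw [← Finset.sum_filter, Finset.filter_filter]
        refine Finset.sum_congr ?_ fun _ _ => rfl
        ext h
        simp only [Finset.mem_filter, mem_outgoing]
        constructor
        · rintro ⟨h4, h5, h6⟩
          rw [letters_flip_out hπ h4 h5] at h6
          exact ⟨h4, h6⟩
        · rintro ⟨h4, h6⟩
          have h5 := fun v hv => hoff h h6 v hv 0
          rw [letters_flip_out hπ h4 h5]
          exact ⟨h4, h5, h6⟩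
      · refine Finset.sum_congr rfl fun v hv => if_pos ?_
        have := isGhost_flip hπ hb hv
        simp only [letters, Sum.elim_inr]
        revert this
        cases (Γ.flip π hπ).kind v
        · intro h; exact absurd h (by decide)
        · intro h; exact absurd h (by decide)
        · intro _; exact trivial
        · intro _; exact trivial
    · intro v _; simp [rank]
    · intro v hv
      have hloop := isLoop_flip hπ
      have hv' := hv
      rw [Equiv.Perm.support_inv] at hv'
      rw [hloop.pairing_out hv]
      have : loopSlot ((Γ.flip π hπ).kind (π⁻¹ v)) ((Γ.flip π hπ).kind v) = 2 := by
        have h1 : ((Γ.flip π hπ).kind (π⁻¹ v)).isGhost = true :=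
          isGhost_flip hπ hb (symm_mem_support.2 hv')
        rw [loopSlot, h1]
        rfl
      rw [this]
      rfl
    · intro o ho v hv
      rw [Equiv.Perm.support_inv] at hv
      rw [hq o ho]
      rw [mem_oddOutgoing] at ho
      have key : ∀ h : HalfEdge n N, (∀ s, h ≠ .inr (v, s)) →
          rank h < n + 3 * v ∨ n + 3 * v + 2 < rank h := by
        rintro (i | ⟨w, s⟩) h
        · left; simp only [rank]; omega
        · have : w ≠ v := by rintro rfl; exact h s rfl
          have : (w : ℕ) ≠ v := fun h => this (Fin.ext h)
          simp only [rank]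
          omega
      exact ⟨key _ (hoff o ho.2 v hv),
        key _ (hoff _ (by rw [Γ.isOdd_pairing]; exact ho.2) v hv)⟩
  unfold wickSign
  rw [hpar, neg_one_pow_val_add_one]

/-- Each `γ̄` on the bosonic loop comes with the sign from `γ - γ̄` in the interaction. -/
theorem prod_sign_flip : ∏ v, (Γ.kind v).sign =
    (∏ v ∈ π.support, if (Γ.kind v).isHol then 1 else -1) *
      ∏ v, ((Γ.flip π hπ).kind v).sign := by
  classical
  rw [← Finset.prod_mul_prod_compl π.support, ← Finset.prod_mul_prod_compl π.support
    (fun v => ((Γ.flip π hπ).kind v).sign), ← mul_assoc]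
  congr 1
  · rw [← Finset.prod_mul_distrib]
    refine Finset.prod_congr rfl fun v hv => ?_
    have h1 := hb v hv
    have h2 := isGhost_flip hπ hb hv
    revert h1 h2
    cases Γ.kind v <;> cases (Γ.flip π hπ).kind v <;>
      simp [isGhost, isHol, VertexKind.sign]
  · refine Finset.prod_congr rfl fun v hv => ?_
    rw [flip_kind, flipKind, if_neg (by simpa using hv)]

section Colors

variable {𝕜 L ι : Type*} [Field 𝕜] [Algebra 𝕜 ℂ] [LieRing L] [LieAlgebra 𝕜 L]
  [Fintype ι]

/-- The colors of a bosonic loop and of the reversed ghost loop are traces of products of adjoint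
operators in opposite orders. -/
theorem colorFactor_flip (hL : StronglyUnimodular 𝕜 L) (B : Module.Basis ι 𝕜 L) (e : Fin n → ι) :
    (∏ v ∈ π.support, if (Γ.kind v).isHol then (1 : ℂ) else -1) * Γ.colorFactor B e =
      (Γ.flip π hπ).colorFactor B e := by
  classical
  set σ := Γ.pairing.1 with hσ
  -- the slot of the half-edge of a loop vertex that is not on the loop
  set x : Fin N → Fin 3 := fun v => loopSlotPerm Γ.kind π v 1 with hxdef
  have hx0 : ∀ v, x v ≠ 0 := fun v => loopSlotPerm_ne_zero _ _ _ (by decide)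
  have hslots : ∀ v ∈ π.support, (x v = 2 ∧ loopSlot (Γ.kind v) (Γ.kind (π.symm v)) = 1 ∧
      (Γ.kind (π.symm v)).isHol = true) ∨ (x v = 1 ∧
        loopSlot (Γ.kind v) (Γ.kind (π.symm v)) = 2 ∧ (Γ.kind (π.symm v)).isHol = false) := by
    intro v hv
    have h1 := hb v hv
    cases h2 : (Γ.kind (π.symm v)).isHol
    · right
      simp only [hxdef, loopSlotPerm, if_pos hv, slotPerm, legIsBar, loopSlot, h1, h2]
      simp
    · left
      simp only [hxdef, loopSlotPerm, if_pos hv, slotPerm, legIsBar, loopSlot, h1, h2]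
      simp
  have hleg : ∀ v ∈ π.support, ∀ w ∈ π.support, σ (.inr (v, x v)) ≠ .inr (w, 0) := by
    intro v hv
    rcases hπ.in_cases (.inr (v, x v)) with ⟨w, hw, h⟩ | h
    · exfalso
      simp only [Sum.inr.injEq, Prod.mk.injEq] at h
      obtain ⟨rfl, h⟩ := h
      rcases hslots v hv with h' | h'
      · rw [h'.1, h'.2.1] at h; exact absurd h (by decide)
      · rw [h'.1, h'.2.1] at h; exact absurd h (by decide)
    · exact h
  have hleg' : ∀ v ∈ π.support, (Γ.flip π hπ).pairing.1 (.inr (v, 1)) = σ (.inr (v, x v)) := by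
    intro v hv
    rw [← flipPerm_pairing_in hπ (by simp [hCharge, hx0]) (hleg v hv),
      flipPerm_slot _ _ _ (hx0 v)]
    congr 3
    simp only [hxdef, loopSlotPerm, if_pos hv, slotPerm_slotPerm]
  have hloop' : ∀ v ∈ π.support, (Γ.flip π hπ).pairing.1 (.inr (v, 2)) = .inr (π v, 0) := by
    intro v hv
    have hv' : v ∈ π⁻¹.support := by rwa [Equiv.Perm.support_inv]
    have := (isLoop_flip hπ).pairing_in hv'
    have h1 := isGhost_flip hπ hb hv
    rwa [loopSlot, h1, Bool.not_true, Bool.false_and, if_neg (by decide)] at this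
  -- off the loop, colors do not depend on those of the vertices on the loop
  have hnot : ∀ h, hCharge Φ h = -1 → (∀ w ∈ π.support, σ h ≠ .inr (w, 0)) →
      ∀ k k' : Fin N → ι, (∀ v ∉ π.support, k v = k' v) →
      outColor e k (σ h) = outColor e k' (σ h) := by
    intro h hh hne k k' hk
    have hc := Γ.hCharge_pairing h
    rcases hh' : σ h with i | ⟨w, t⟩
    · rfl
    · refine hk w ?_
      intro hw
      have : t = 0 := by
        by_contra ht
        rw [show Γ.pairing.1 h = _ from hh', hh] at hc
        norm_num [hCharge, ht] at hc
      subst this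
      exact hne w hw hh'
  -- the factors off the loop
  set W : (Fin N → ι) → ℂ := fun k => rootDelta Γ e k * ∏ v ∈ π.supportᶜ,
    structConst B (k v) (outColor e k (σ (.inr (v, 1)))) (outColor e k (σ (.inr (v, 2))))
    with hWdef
  have hoff : ∀ v ∉ π.support, ∀ s, s ≠ 0 → ∀ w ∈ π.support, σ (.inr (v, s)) ≠ .inr (w, 0) := by
    intro v hv s _ w hw h
    apply hv
    have := congrArg Γ.pairing.1 h
    rw [show Γ.pairing.1 (σ (.inr (v, s))) = .inr (v, s) from Γ.pairing.apply_apply _,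
      hπ.pairing_out hw] at this
    simp only [Sum.inr.injEq, Prod.mk.injEq] at this
    rw [this.1]
    exact Equiv.Perm.apply_mem_support.2 hw
  have hW : ∀ k k' : Fin N → ι, (∀ v ∉ π.support, k v = k' v) → W k = W k' := by
    intro k k' hk
    simp only [hWdef, rootDelta]
    congr 1
    · have : ∀ i, (Φ i).charge = -1 → outColor e k (σ (.inl i)) =
          outColor e k' (σ (.inl i)) := by
        intro i hi
        refine hnot (.inl i) hi ?_ k k' hk
        intro w hw h
        have := congrArg Γ.pairing.1 h
        rw [show Γ.pairing.1 (σ (.inl i)) = .inl i from Γ.pairing.apply_apply _,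
          hπ.pairing_out hw] at this
        cases this
      congr 1
      apply propext
      exact forall₂_congr fun i hi => by rw [this i hi]
    · refine Finset.prod_congr rfl fun v hv => ?_
      have hv' : v ∉ π.support := by simpa using hv
      rw [hk v hv', hnot _ (by simp [hCharge]) (hoff v hv' 1 (by decide)) k k' hk,
        hnot _ (by simp [hCharge]) (hoff v hv' 2 (by decide)) k k' hk]
  -- at the vertices of the ghost loop, the line not on the loop is at the slot `1`
  have hflip : (Γ.flip π hπ).colorFactor B e = ∑ k, W k * ∏ v ∈ π.support,
      structConst B (k v) (outColor e k (σ (.inr (v, x v)))) (k (π v)) := by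
    rw [colorFactor_eq]
    refine Finset.sum_congr rfl fun k _ => ?_
    rw [← Finset.prod_mul_prod_compl π.support, mul_comm (∏ v ∈ π.support, _), ← mul_assoc]
    congr 1
    · simp only [hWdef]
      congr 1
      · unfold rootDelta
        congr 1
        apply propext
        exact forall₂_congr fun i hi => by rw [flip_pairing_inl hπ hi]
      · refine Finset.prod_congr rfl fun v hv => ?_
        have hv' : v ∉ π.support := by simpa using hv
        rw [flip_pairing_notMem hπ hv' (by decide), flip_pairing_notMem hπ hv' (by decide)]
    · refine Finset.prod_congr rfl fun v hv => ?_
      rw [hleg' v hv, hloop' v hv]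
      rfl
  -- the antisymmetry of the structure constants gives a sign for each vertex of the bosonic loop
  -- at which the line not on the loop is at the slot `2`
  have hΓ : Γ.colorFactor B e = (∏ v ∈ π.support, if (Γ.kind v).isHol then (-1 : ℂ) else 1) *
      ∑ k, W k * ∏ v ∈ π.support,
        structConst B (k v) (outColor e k (σ (.inr (v, x v)))) (k (π.symm v)) := by
    rw [colorFactor_eq, Finset.mul_sum]
    refine Finset.sum_congr rfl fun k _ => ?_
    rw [← Finset.prod_mul_prod_compl π.support, mul_comm (∏ v ∈ π.support, _), ← mul_assoc,
      mul_left_comm _ (W k)]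
    change W k * _ = _
    congr 1
    have hre : (∏ v ∈ π.support, if (Γ.kind v).isHol then (-1 : ℂ) else 1) =
        ∏ v ∈ π.support, if (Γ.kind (π.symm v)).isHol then (-1 : ℂ) else 1 := by
      refine Finset.prod_nbij' (fun v => π v) (fun v => π.symm v) ?_ ?_ ?_ ?_ ?_
      · intro v hv; exact Equiv.Perm.apply_mem_support.2 hv
      · intro v hv; exact symm_mem_support.2 hv
      · intro v _; simp
      · intro v _; simp
      · intro v _; simp
    rw [hre, ← Finset.prod_mul_distrib]
    refine Finset.prod_congr rfl fun v hv => ?_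
    have hin := hπ.pairing_in hv
    rcases hslots v hv with ⟨h1, h2, h3⟩ | ⟨h1, h2, h3⟩
    · rw [h2] at hin
      rw [h1, h3, hin, structConst_antisymm, if_pos rfl]
      simp [outColor]
      rfl
    · rw [h2] at hin
      rw [h1, h3, hin]
      simp [outColor]
      rfl
  rw [hflip, hL.sum_colors hπ.isCycle W (fun v k => outColor e k (σ (.inr (v, x v)))) hW
    (fun v hv k k' hk => hnot _ (by simp [hCharge, hx0]) (hleg v hv) k k' hk), hΓ, ← mul_assoc]
  congr 1
  rw [← Finset.prod_mul_distrib, ← Finset.prod_const]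
  refine Finset.prod_congr rfl fun v _ => ?_
  split_ifs <;> norm_num

omit hb in
/-- The integrand without self-contractions of points, in terms of oriented propagators. -/
theorem integrand_eq_of_ne (S : Scheme) (B : Module.Basis ι 𝕜 L) (e : Fin n → ι)
    (Γ : Diagram Φ N) {z : Fin n → ℂ} {u : Fin N → ℂ}
    (hpt : ∀ h, points z u h ≠ points z u (Γ.pairing.1 h)) :
    Γ.integrand S B e z u = (∏ k, (Γ.kind k).sign) * Γ.colorFactor B e * (Γ.wickSign *
      ∏ h ∈ Γ.outgoing, outGreen S.C (letters Φ Γ.kind h) (points z u h)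
        (points z u (Γ.pairing.1 h))) := by
  rw [← Γ.koszulSign_mul_chordProduct S _ hpt]
  unfold Diagram.integrand
  ring

/-- The integrands of a diagram with a bosonic loop and of the reversed diagram cancel. -/
theorem integrand_flip (hL : StronglyUnimodular 𝕜 L) (S : Scheme) (B : Module.Basis ι 𝕜 L)
    (e : Fin n → ι) {z : Fin n → ℂ} {u : Fin N → ℂ}
    (hpt : ∀ h, points z u h ≠ points z u (Γ.pairing.1 h))
    (hpt' : ∀ h, points z u h ≠ points z u ((Γ.flip π hπ).pairing.1 h)) :
    Γ.integrand S B e z u + (Γ.flip π hπ).integrand S B e z u = 0 := by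
  rw [integrand_eq_of_ne S B e Γ hpt, integrand_eq_of_ne S B e _ hpt', prod_outGreen_flip,
    wickSign_flip hπ hb, prod_sign_flip hπ hb, ← colorFactor_flip hπ hb hL]
  ring

end Colors

end

end Diagram

/-! ### The involution on diagrams with cycles -/

namespace Diagram

variable {n N : ℕ} {Φ : Fin n → Insertion} {Γ : Diagram Φ N} {π : Equiv.Perm (Fin N)}

/-- A vertex that lies on a loop. -/
def OnLoop (Γ : Diagram Φ N) (v : Fin N) : Prop := ∃ π, Γ.IsLoop π ∧ v ∈ π.support

/-- No vertex is contracted with itself. -/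
def NoSelfContraction (Γ : Diagram Φ N) : Prop :=
  ∀ v s, Γ.pairing.1 (.inr (v, 0)) ≠ .inr (v, s)

/-- Different loops are disjoint, as each vertex has only one outgoing half-edge. -/
theorem IsLoop.eq_of_mem {π' : Equiv.Perm (Fin N)} (hπ : Γ.IsLoop π) (hπ' : Γ.IsLoop π')
    {v : Fin N} (hv : v ∈ π.support) (hv' : v ∈ π'.support) : π = π' := by
  have key : ∀ x ∈ π.support ∩ π'.support, π x = π' x := by
    intro x hx
    rw [Finset.mem_inter] at hx
    have h1 := hπ.pairing_out hx.1
    rw [hπ'.pairing_out hx.2] at h1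
    simp only [Sum.inr.injEq, Prod.mk.injEq] at h1
    exact h1.1.symm
  exact hπ.isCycle.eq_on_support_inter_nonempty_congr hπ'.isCycle key
    (key v (Finset.mem_inter.2 ⟨hv, hv'⟩)) hv

/-- Reversing a loop preserves the other loops. -/
theorem OnLoop.flip (hπ : Γ.IsLoop π) {v : Fin N} (hv : Γ.OnLoop v) :
    (Γ.flip π hπ).OnLoop v := by
  obtain ⟨π₂, h₂, hv₂⟩ := hv
  by_cases hdis : ∃ w, w ∈ π.support ∧ w ∈ π₂.support
  · obtain ⟨w, hw, hw₂⟩ := hdis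
    obtain rfl := hπ.eq_of_mem h₂ hw hw₂
    exact ⟨π⁻¹, isLoop_flip hπ, by rwa [Equiv.Perm.support_inv]⟩
  · push Not at hdis
    refine ⟨π₂, ⟨h₂.isCycle, fun w hw => ?_⟩, hv₂⟩
    obtain ⟨s, hs⟩ := h₂.exists_slot w hw
    refine ⟨s, ?_⟩
    rw [flip_pairing_out hπ rfl, hs, flipPerm_of_notMem]
    · intro h
      exact hdis _ h (Equiv.Perm.apply_mem_support.2 hw)
    · rintro x hx h
      simp only [Sum.inr.injEq, Prod.mk.injEq] at h
      obtain ⟨rfl, -⟩ := h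
      exact hdis _ hx hw

theorem onLoop_flip_iff (hπ : Γ.IsLoop π) {v : Fin N} :
    (Γ.flip π hπ).OnLoop v ↔ Γ.OnLoop v := by
  refine ⟨fun h => ?_, OnLoop.flip hπ⟩
  have := h.flip (isLoop_flip hπ)
  rwa [flip_flip] at this

theorem NoSelfContraction.flip (hπ : Γ.IsLoop π) (hΓ : Γ.NoSelfContraction) :
    (Γ.flip π hπ).NoSelfContraction := by
  intro v s h
  by_cases hv : v ∈ π.support
  · obtain ⟨t, -, ht⟩ := flip_pairing_loop hπ hv
    rw [ht] at h
    simp only [Sum.inr.injEq, Prod.mk.injEq] at h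
    exact Equiv.Perm.mem_support.1 (symm_mem_support.2 hv) (by rw [Equiv.apply_symm_apply, h.1])
  · rw [flip_pairing_out hπ rfl] at h
    · have hc := Γ.hCharge_pairing (.inr (v, 0))
      rcases h1 : Γ.pairing.1 (.inr (v, 0)) with i | ⟨w, t⟩
      · rw [h1] at h; cases h
      · rw [h1] at h hc
        have ht : t ≠ 0 := by rintro rfl; norm_num [hCharge] at hc
        rw [flipPerm_slot _ _ _ ht] at h
        simp only [Sum.inr.injEq, Prod.mk.injEq] at h
        rw [h.1] at h1
        exact hΓ v t h1
    · rintro w hw h'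
      simp only [Sum.inr.injEq, Prod.mk.injEq] at h'
      obtain ⟨rfl, -⟩ := h'
      exact hv hw

theorem not_isForest_of_isLoop (hπ : Γ.IsLoop π) : ¬ Γ.IsForest := by
  rw [isForest_iff]
  intro h
  obtain ⟨v, hv, -⟩ := id hπ.isCycle
  have hv' : v ∈ π.support := Equiv.Perm.mem_support.2 hv
  have hstep : ∀ v ∈ π.support, Γ.parent^[3] (.inr v) = .inr (π v) := by
    intro v hv
    simp only [Function.iterate_succ, Function.iterate_zero, Function.comp_apply, id_eq]
    rw [Γ.parent_inr, Γ.parent_of_charge rfl, hπ.pairing_out hv,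
      Γ.parent_incoming _ (VertexKind.loopSlot_ne_zero _ _)]
  -- three steps of the parent map lead from a vertex to the next one
  have hit : ∀ m : ℕ, Γ.parent^[3 * m] (.inr v) = .inr ((π ^ m) v) := by
    intro m
    induction m with
    | zero => rfl
    | succ m ih =>
      rw [Nat.mul_succ, add_comm, Function.iterate_add_apply, ih,
        hstep _ (Equiv.Perm.pow_apply_mem_support.2 hv'), pow_succ', Equiv.Perm.mul_apply]
  have hp : (.inr v : Node n N) ∈ Function.periodicPts Γ.parent := by
    refine Function.mk_mem_periodicPts (n := 3 * orderOf π)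
      (Nat.mul_pos (by norm_num) (orderOf_pos π)) ?_
    change Γ.parent^[3 * orderOf π] (.inr v) = .inr v
    rw [hit, pow_orderOf_eq_one]
    rfl
  have := h _ hp
  cases this

/-- A diagram that is not a forest has a directed cycle. -/
theorem exists_isLoop (hΓ : Γ.NoSelfContraction) (hF : ¬ Γ.IsForest) : ∃ π, Γ.IsLoop π := by
  classical
  rw [isForest_iff] at hF
  push Not at hF
  obtain ⟨x, hx, hne⟩ := hF
  set P := Γ.parent with hP
  -- the parent map permutes its periodic points
  have hbij := Function.bijOn_periodicPts P
  have hfix : ∀ y ∈ Function.periodicPts P, P y ≠ y → P (P y) ≠ P y := by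
    intro y hy h1 h2
    exact h1 (hbij.injOn (hbij.mapsTo hy) hy h2)
  have hin : ∀ h : HalfEdge n N, hCharge Φ h = -1 → P (.inl h) ≠ .inl h →
      ∃ v s, s ≠ 0 ∧ h = .inr (v, s) ∧ P (.inl h) = .inr v := by
    rintro (i | ⟨v, s⟩) hc h1
    · exact absurd (Γ.parent_root hc) h1
    · have hs : s ≠ 0 := by rintro rfl; simp [hCharge] at hc
      exact ⟨v, s, hs, rfl, Γ.parent_incoming v hs⟩
  -- a directed cycle passes through a vertex, as half-edges are followed by at most one more
  have hvert : ∃ v, (.inr v : Node n N) ∈ Function.periodicPts P := by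
    rcases x with h | v
    · rcases hCharge_eq (Φ := Φ) h with hc | hc
      · have h1 : P (.inl h) = .inl (Γ.pairing.1 h) := Γ.parent_of_charge hc
        have h2 := hfix _ hx hne
        rw [h1] at h2
        obtain ⟨v, s, -, -, h3⟩ := hin _ (by rw [Γ.hCharge_pairing, hc]) h2
        refine ⟨v, ?_⟩
        rw [← h3, ← h1]
        exact hbij.mapsTo (hbij.mapsTo hx)
      · obtain ⟨v, s, -, -, h3⟩ := hin h hc hne
        exact ⟨v, h3 ▸ hbij.mapsTo hx⟩
    · exact ⟨v, hx⟩
  obtain ⟨v₀, hv₀⟩ := hvert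
  set D : Set (Fin N) := {v | (.inr v : Node n N) ∈ Function.periodicPts P} with hD
  have hnext : ∀ v, ∃ w, v ∈ D → (∃ s, Γ.pairing.1 (.inr (v, 0)) = .inr (w, s)) ∧
      P (P (P (.inr v))) = .inr w := by
    intro v
    by_cases hv : v ∈ D
    · have h1 : P (.inr v) = .inl (.inr (v, 0)) := Γ.parent_inr v
      have h2 : P (.inl (.inr (v, 0))) = .inl (Γ.pairing.1 (.inr (v, 0))) :=
        Γ.parent_of_charge rfl
      have h3 := hfix _ (hbij.mapsTo hv) (by
        rw [h1, h2]
        exact fun h => Γ.pairing.apply_ne _ (Sum.inl_injective h))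
      rw [h1, h2] at h3
      obtain ⟨w, s, -, h4, h5⟩ := hin _ (by rw [Γ.hCharge_pairing]; rfl) h3
      exact ⟨w, fun _ => ⟨⟨s, h4⟩, by rw [h1, h2, h5]⟩⟩
    · exact ⟨v, fun h => absurd h hv⟩
  choose next hnext using hnext
  have hmem : ∀ v ∈ D, next v ∈ D := by
    intro v hv
    change (.inr (next v) : Node n N) ∈ Function.periodicPts P
    rw [← (hnext v hv).2]
    exact hbij.mapsTo (hbij.mapsTo (hbij.mapsTo hv))
  have hinj : Function.Injective fun v => if v ∈ D then next v else v := by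
    intro v w h
    simp only at h
    by_cases hv : v ∈ D <;> by_cases hw : w ∈ D
    · rw [if_pos hv, if_pos hw] at h
      have h1 := (hnext v hv).2
      rw [h, ← (hnext w hw).2] at h1
      have h2 := hbij.injOn (hbij.mapsTo (hbij.mapsTo hv)) (hbij.mapsTo (hbij.mapsTo hw)) h1
      have h3 := hbij.injOn (hbij.mapsTo hv) (hbij.mapsTo hw) h2
      exact Sum.inr_injective (hbij.injOn hv hw h3)
    · rw [if_pos hv, if_neg hw] at h
      exact absurd (h ▸ hmem v hv) hw
    · rw [if_neg hv, if_pos hw] at h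
      exact absurd (h ▸ hmem w hw) hv
    · rwa [if_neg hv, if_neg hw] at h
  -- the map to the next vertex on the directed cycles, extended by the identity
  let g : Equiv.Perm (Fin N) := Equiv.ofBijective _ (Finite.injective_iff_bijective.1 hinj)
  have hg : ∀ v ∈ D, g v = next v := fun v hv => if_pos hv
  have hg' : ∀ v, g v ≠ v → v ∈ D := by
    intro v hv
    by_contra h
    exact hv (if_neg h)
  have hg₀ : g v₀ ≠ v₀ := by
    rw [hg v₀ hv₀]
    intro h
    obtain ⟨s, hs⟩ := (hnext v₀ hv₀).1
    rw [h] at hs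
    exact hΓ v₀ s hs
  refine ⟨g.cycleOf v₀, Equiv.Perm.isCycle_cycleOf _ hg₀, ?_⟩
  intro v hv
  have hsc := (Equiv.Perm.mem_support_cycleOf_iff.1 hv).1
  have hπv : g.cycleOf v₀ v = g v := hsc.cycleOf_apply
  have hvD : v ∈ D := hg' v (by rw [← hπv]; exact Equiv.Perm.mem_support.1 hv)
  rw [hπv, hg v hvD]
  exact (hnext v hvD).1

/-- The loop with the smallest vertex among all loops. -/
def IsFirstLoop (Γ : Diagram Φ N) (π : Equiv.Perm (Fin N)) : Prop :=
  Γ.IsLoop π ∧ ∃ v ∈ π.support, ∀ w, Γ.OnLoop w → v ≤ w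

theorem exists_isFirstLoop (h : ∃ π, Γ.IsLoop π) : ∃ π, Γ.IsFirstLoop π := by
  classical
  obtain ⟨π, hπ⟩ := h
  obtain ⟨v, hv, -⟩ := id hπ.isCycle
  have hne : (Finset.univ.filter fun v => Γ.OnLoop v).Nonempty :=
    ⟨v, by simpa using ⟨π, hπ, Equiv.Perm.mem_support.2 hv⟩⟩
  obtain ⟨π', hπ', hv'⟩ := (Finset.mem_filter.1 (Finset.min'_mem _ hne)).2
  exact ⟨π', hπ', _, hv', fun w hw => Finset.min'_le _ _ (by simpa using hw)⟩

theorem IsFirstLoop.unique {π' : Equiv.Perm (Fin N)} (h : Γ.IsFirstLoop π)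
    (h' : Γ.IsFirstLoop π') : π = π' := by
  obtain ⟨h1, v, hv, hmin⟩ := h
  obtain ⟨h1', v', hv', hmin'⟩ := h'
  obtain rfl : v = v' := le_antisymm (hmin _ ⟨_, h1', hv'⟩) (hmin' _ ⟨_, h1, hv⟩)
  exact h1.eq_of_mem h1' hv hv'

theorem IsFirstLoop.flip (h : Γ.IsFirstLoop π) : (Γ.flip π h.1).IsFirstLoop π⁻¹ := by
  obtain ⟨h1, v, hv, hmin⟩ := h
  refine ⟨isLoop_flip h1, v, by rwa [Equiv.Perm.support_inv], fun w hw => ?_⟩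
  exact hmin w ((onLoop_flip_iff h1).1 hw)

open Classical in
/-- The involution that reverses the first loop. -/
def flipFirst (Γ : Diagram Φ N) : Diagram Φ N :=
  if h : ∃ π, Γ.IsFirstLoop π then Γ.flip h.choose h.choose_spec.1 else Γ

theorem flipFirst_eq (h : Γ.IsFirstLoop π) : Γ.flipFirst = Γ.flip π h.1 := by
  have h' : ∃ π, Γ.IsFirstLoop π := ⟨π, h⟩
  unfold flipFirst
  rw [dif_pos h']
  have e := h'.choose_spec.unique h
  congr

theorem flipFirst_flipFirst (h : Γ.IsFirstLoop π) : Γ.flipFirst.flipFirst = Γ := by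
  have e := flipFirst_eq h.flip
  rw [flip_flip] at e
  rw [flipFirst_eq h, e]

theorem IsLoop.isGhost_const (hπ : Γ.IsLoop π) {v w : Fin N} (hv : v ∈ π.support)
    (hw : w ∈ π.support) : (Γ.kind w).isGhost = (Γ.kind v).isGhost := by
  obtain ⟨i, rfl⟩ := hπ.isCycle.exists_pow_eq (Equiv.Perm.mem_support.1 hv)
    (Equiv.Perm.mem_support.1 hw)
  clear hw
  induction i with
  | zero => rfl
  | succ i ih =>
    rw [pow_succ', Equiv.Perm.mul_apply,
      hπ.isGhost_apply (Equiv.Perm.pow_apply_mem_support.2 hv), ih]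

/-- If the points are distinct, the ends of an edge are distinct points unless the edge joins a
vertex with itself. -/
theorem points_ne (hΓ : Γ.NoSelfContraction) {z : Fin n → ℂ} {u : Fin N → ℂ}
    (hzu : Function.Injective (Sum.elim z u)) (h : HalfEdge n N) :
    points z u h ≠ points z u (Γ.pairing.1 h) := by
  intro heq
  have hpt : ∀ h : HalfEdge n N, points z u h = Sum.elim z u (Sum.map id Prod.fst h) := by
    rintro (i | ⟨v, s⟩) <;> rfl
  rw [hpt, hpt] at heq
  have h1 := hzu heq
  have hc := Γ.hCharge_pairing h
  have hne := Γ.pairing.apply_ne h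
  rcases h with i | ⟨v, s⟩
  · rcases h2 : Γ.pairing.1 (.inl i) with j | ⟨w, t⟩
    · rw [h2] at h1 hne
      simp only [Sum.map_inl, id_eq, Sum.inl.injEq] at h1
      exact hne (by rw [h1])
    · rw [h2] at h1
      cases h1
  · rcases h2 : Γ.pairing.1 (.inr (v, s)) with j | ⟨w, t⟩
    · rw [h2] at h1
      cases h1
    · rw [h2] at h1 hc
      simp only [Sum.map_inr, Sum.inr.injEq] at h1
      subst h1
      by_cases hs : s = 0
      · subst hs; exact hΓ v t h2
      · have ht : t = 0 := by
          by_contra ht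
          norm_num [hCharge, hs, ht] at hc
        subst ht
        have := congrArg Γ.pairing.1 h2
        rw [Γ.pairing.apply_apply] at this
        exact hΓ v s this.symm

section

variable {𝕜 L ι : Type*} [Field 𝕜] [Algebra 𝕜 ℂ] [LieRing L] [LieAlgebra 𝕜 L]
  [Fintype ι]

/-- The integrand of a diagram cancels with that of the diagram in which a loop is reversed. -/
theorem integrand_add_flip (hL : StronglyUnimodular 𝕜 L) (S : Scheme) (B : Module.Basis ι 𝕜 L)
    (e : Fin n → ι) {z : Fin n → ℂ} {u : Fin N → ℂ}
    (hzu : Function.Injective (Sum.elim z u)) (hΓ : Γ.NoSelfContraction) (hπ : Γ.IsLoop π) :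
    Γ.integrand S B e z u + (Γ.flip π hπ).integrand S B e z u = 0 := by
  have h1 := points_ne hΓ hzu
  have h2 := points_ne (hΓ.flip hπ) hzu
  obtain ⟨v, hv, -⟩ := id hπ.isCycle
  have hv' : v ∈ π.support := Equiv.Perm.mem_support.2 hv
  cases hg : (Γ.kind v).isGhost
  · exact integrand_flip hπ (fun w hw => by rw [hπ.isGhost_const hv' hw, hg]) hL S B e h1 h2
  -- a ghost loop is the reversal of a bosonic one
  · have hπ' := isLoop_flip hπ
    have := integrand_flip hπ' (fun w hw => by
      rw [Equiv.Perm.support_inv] at hw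
      rw [flip_kind, flipKind, if_pos hw, VertexKind.isGhost_toggle,
        hπ.isGhost_const hv' (symm_mem_support.2 hw), hg]
      rfl) hL S B e h2 (by rw [flip_flip]; exact h1)
    rw [flip_flip] at this
    rw [add_comm]
    exact this

open Classical in
/-- For distinct points, the diagrams with cycles cancel in pairs. -/
theorem sum_integrand_eq (hL : StronglyUnimodular 𝕜 L) (S : Scheme) (B : Module.Basis ι 𝕜 L)
    (e : Fin n → ι) {z : Fin n → ℂ} {u : Fin N → ℂ}
    (hzu : Function.Injective (Sum.elim z u)) :
    ∑ Γ : Diagram Φ N, Γ.integrand S B e z u =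
      ∑ Γ : Diagram Φ N with Γ.IsForest, Γ.integrand S B e z u := by
  rw [← Finset.sum_filter_add_sum_filter_not Finset.univ (fun Γ : Diagram Φ N => Γ.IsForest),
    add_eq_left,
    ← Finset.sum_filter_add_sum_filter_not _ (fun Γ : Diagram Φ N => Γ.NoSelfContraction)]
  have h1 : ∑ Γ ∈ (Finset.univ.filter fun Γ : Diagram Φ N => ¬ Γ.IsForest) with
      ¬ Γ.NoSelfContraction, Γ.integrand S B e z u = 0 := by
    refine Finset.sum_eq_zero fun Γ hΓ => ?_
    have := (Finset.mem_filter.1 hΓ).2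
    unfold NoSelfContraction at this
    push Not at this
    obtain ⟨v, s, hs⟩ := this
    rw [Diagram.integrand, colorFactor_eq_zero hL B e Γ hs]
    ring
  rw [h1, add_zero]
  have hfirst : ∀ Γ : Diagram Φ N, Γ ∈ (Finset.univ.filter fun Γ : Diagram Φ N => ¬ Γ.IsForest).filter
      (fun Γ => Γ.NoSelfContraction) → Γ.NoSelfContraction ∧ ∃ π, Γ.IsFirstLoop π := by
    intro Γ hΓ
    simp only [Finset.mem_filter, Finset.mem_univ, true_and] at hΓ
    exact ⟨hΓ.2, exists_isFirstLoop (exists_isLoop hΓ.2 hΓ.1)⟩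
  refine Finset.sum_involution (fun Γ _ => Γ.flipFirst) ?_ ?_ ?_ ?_
  · intro Γ hΓ
    obtain ⟨h2, π, hπ⟩ := hfirst Γ hΓ
    rw [flipFirst_eq hπ]
    exact integrand_add_flip hL S B e hzu h2 hπ.1
  -- no diagram is fixed, as the loop changes its kind
  · intro Γ hΓ _ heq
    obtain ⟨h2, π, hπ⟩ := hfirst Γ hΓ
    rw [flipFirst_eq hπ] at heq
    obtain ⟨v, hv, -⟩ := id hπ.1.isCycle
    have hv' : v ∈ π.support := Equiv.Perm.mem_support.2 hv
    have := congrArg (fun Γ => (Γ.kind v).isGhost) heq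
    simp only [flip_kind, flipKind, if_pos hv', VertexKind.isGhost_toggle] at this
    rw [hπ.1.isGhost_const hv' (symm_mem_support.2 hv')] at this
    revert this
    cases (Γ.kind v).isGhost <;> decide
  · intro Γ hΓ
    obtain ⟨h2, π, hπ⟩ := hfirst Γ hΓ
    rw [flipFirst_eq hπ]
    simp only [Finset.mem_filter, Finset.mem_univ, true_and]
    exact ⟨not_isForest_of_isLoop (isLoop_flip hπ.1), h2.flip hπ.1⟩
  · intro Γ hΓ
    obtain ⟨h2, π, hπ⟩ := hfirst Γ hΓ
    exact flipFirst_flipFirst hπ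

end

end Diagram

open MeasureTheory in
/-- The positions of the interaction vertices are almost everywhere distinct from each other and
from the fixed points. -/
theorem ae_injective {n : ℕ} {z : Fin n → ℂ} (hz : Function.Injective z) (N : ℕ) :
    ∀ᵐ u : Fin N → ℂ, Function.Injective (Sum.elim z u) := by
  have h1 : ∀ i k, ∀ᵐ u : Fin N → ℂ, u k ≠ z i := by
    intro i k
    have h0 : ∀ᵐ x : ℂ, x ≠ z i := by
      rw [ae_iff]
      simp
    exact (Measure.quasiMeasurePreserving_eval (fun _ : Fin N => (volume : Measure ℂ)) k).ae h0
  have h2 : ∀ k l : Fin N, k ≠ l → ∀ᵐ u : Fin N → ℂ, u k ≠ u l := by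
    intro k l hkl
    let E : Submodule ℝ (Fin N → ℂ) := LinearMap.ker
      ((LinearMap.proj k : (Fin N → ℂ) →ₗ[ℝ] ℂ) - LinearMap.proj l)
    have hE : E ≠ ⊤ := by
      intro h
      have : (Pi.single k 1 : Fin N → ℂ) ∈ E := h ▸ Submodule.mem_top
      simp [E, hkl.symm] at this
    have h0 := Measure.addHaar_submodule volume E hE
    rw [ae_iff]
    convert h0 using 2
    ext u
    simp [E, sub_eq_zero]
  have h3 : ∀ᵐ u : Fin N → ℂ, (∀ i k, u k ≠ z i) ∧ ∀ k l, k ≠ l → u k ≠ u l := by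
    simp only [Filter.eventually_and, ae_all_iff]
    exact ⟨h1, h2⟩
  filter_upwards [h3] with u hu
  rintro (i | k) (j | l) h
  · exact congrArg _ (hz h)
  · exact absurd h.symm (hu.1 i l)
  · exact absurd h (hu.1 j k)
  · by_contra hne
    exact hu.2 k l (fun h' => hne (by rw [h'])) h

/-! ### Convolutions of Riesz kernels in the plane -/

open MeasureTheory
open scoped ENNReal

/-- The kernel `|x|^(-a)`, with the value `∞` at `0` if `0 < a`. -/
def K (a : ℝ) (x : ℂ) : ℝ≥0∞ := ‖x‖ₑ ^ (-a)

theorem measurable_K (a : ℝ) : Measurable (K a) := by unfold K; fun_prop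

theorem K_zero {a : ℝ} (ha : 0 < a) : K a 0 = ⊤ := by
  simp [K, ha]

theorem K_ne_top {a : ℝ} {x : ℂ} (hx : x ≠ 0) : K a x ≠ ⊤ :=
  ENNReal.rpow_ne_top_of_ne_zero (by simpa using hx) (by simp)

theorem K_mul (a : ℝ) (x y : ℂ) (hx : x ≠ 0) (hy : y ≠ 0) : K a (x * y) = K a x * K a y := by
  rw [K, K, K, enorm_mul, ENNReal.mul_rpow_of_ne_zero (by simpa using hx) (by simpa using hy)]

theorem K_add (a b : ℝ) {x : ℂ} (hx : x ≠ 0) : K (a + b) x = K a x * K b x := by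
  rw [K, neg_add, ENNReal.rpow_add _ _ (by simpa using hx) (by simp), K, K]

theorem K_anti {a : ℝ} (ha : 0 ≤ a) {x y : ℂ} (h : ‖x‖ ≤ ‖y‖) : K a y ≤ K a x := by
  rw [K, K, ENNReal.rpow_neg, ENNReal.rpow_neg, ENNReal.inv_le_inv]
  exact ENNReal.rpow_le_rpow (by
    rw [enorm_eq_nnnorm, enorm_eq_nnnorm]; exact_mod_cast h) ha

theorem K_mul_le_aux {a b s : ℝ} (ha : 0 < a) (h1 : a ≤ s) (h2 : s ≤ a + b) {x y : ℂ}
    {D : ℝ} (hD : 0 < D) (hxy : ‖x‖ ≤ ‖y‖) (hy : D / 2 ≤ ‖y‖) :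
    K a x * K b y ≤ K (a + b - s) (D / 2 : ℝ) * K s x := by
  have hy0 : y ≠ 0 := by
    rintro rfl; simp at hy; linarith
  have hs : 0 < s := ha.trans_le h1
  by_cases hx : x = 0
  · subst hx
    have : K (a + b - s) ((D / 2 : ℝ) : ℂ) ≠ 0 := by
      rw [K, Ne, ENNReal.rpow_eq_zero_iff]
      simp [hD.ne']
    rw [K_zero hs, ENNReal.mul_top this]
    exact le_top
  calc K a x * K b y = K a x * (K (s - a) y * K (a + b - s) y) := by
        rw [← K_add _ _ hy0]; congr 2; ring
    _ ≤ K a x * (K (s - a) x * K (a + b - s) (D / 2 : ℝ)) := by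
        gcongr
        · exact K_anti (by linarith) hxy
        · refine K_anti (by linarith) ?_
          rw [Complex.norm_real, Real.norm_of_nonneg (by positivity)]
          exact hy
    _ = K (a + b - s) (D / 2 : ℝ) * K s x := by
        rw [← mul_assoc, ← K_add _ _ hx, mul_comm]; congr 2; ring

/-- Two singularities at a positive distance are dominated by the sum of two stronger ones. The
upper bound on the exponent `s` is what controls the behaviour at infinity. -/
theorem K_mul_le {a b s : ℝ} (ha : 0 < a) (hb : 0 < b) (h1 : a ≤ s) (h2 : b ≤ s)
    (h3 : s ≤ a + b) {x y : ℂ} {D : ℝ} (hD : 0 < D) (hxy : D ≤ ‖x‖ + ‖y‖) :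
    K a x * K b y ≤ K (a + b - s) (D / 2 : ℝ) * (K s x + K s y) := by
  rcases le_total ‖x‖ ‖y‖ with h | h
  · exact (K_mul_le_aux ha h1 h3 hD h (by linarith)).trans (by gcongr; exact le_self_add)
  · rw [mul_comm (K a x), add_comm a b]
    exact (K_mul_le_aux hb h2 (by linarith) hD h (by linarith)).trans
      (by gcongr; exact le_add_self)

/-- `|x|^(-a) (1 + |x|)^(-b)` is integrable over the plane for `a < 2 < a + b`. -/
theorem lintegral_norm_rpow_lt_top {a b : ℝ} (ha : a < 2) (_ : 0 ≤ b) (hab : 2 < a + b) :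
    ∫⁻ x : ℂ, ENNReal.ofReal (‖x‖ ^ (-a) * (1 + ‖x‖) ^ (-b)) < ⊤ := by
  have hint : Integrable (fun x : ℂ => ‖x‖ ^ (-a) * (1 + ‖x‖) ^ (-b)) := by
    refine (integrable_fun_norm_addHaar (E := ℂ) volume
      (f := fun t : ℝ => t ^ (-a) * (1 + t) ^ (-b))).2 ?_
    rw [Complex.finrank_real_complex, ← Set.Ioc_union_Ioi_eq_Ioi (zero_le_one' ℝ)]
    have hm : Measurable fun t : ℝ => t ^ (2 - 1) • (t ^ (-a) * (1 + t) ^ (-b)) := by fun_prop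
    refine IntegrableOn.union ?_ ?_
    · have h0 : IntegrableOn (fun t : ℝ => t ^ (1 - a)) (Set.Ioc 0 1) :=
        (intervalIntegrable_iff_integrableOn_Ioc_of_le zero_le_one).1
          (intervalIntegral.intervalIntegrable_rpow' (by linarith))
      refine h0.mono' hm.aestronglyMeasurable ?_
      filter_upwards [ae_restrict_mem measurableSet_Ioc] with t ht
      have ht0 : 0 < t := ht.1
      rw [smul_eq_mul, Real.norm_of_nonneg (by positivity), sub_eq_add_neg, Real.rpow_add ht0,
        Real.rpow_one, pow_one]
      have : (1 + t) ^ (-b) ≤ 1 := Real.rpow_le_one_of_one_le_of_nonpos (by linarith) (by linarith)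
      have h2 : 0 ≤ t * t ^ (-a) := by positivity
      nlinarith
    · have h0 : IntegrableOn (fun t : ℝ => t ^ (1 - a - b)) (Set.Ioi 1) :=
        integrableOn_Ioi_rpow_of_lt (by linarith) zero_lt_one
      refine h0.mono' hm.aestronglyMeasurable ?_
      filter_upwards [ae_restrict_mem measurableSet_Ioi] with t ht
      have ht0 : (0 : ℝ) < t := zero_lt_one.trans ht
      rw [smul_eq_mul, Real.norm_of_nonneg (by positivity), sub_sub, sub_eq_add_neg, neg_add,
        Real.rpow_add ht0, Real.rpow_add ht0, Real.rpow_one, pow_one]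
      have : (1 + t) ^ (-b) ≤ t ^ (-b) :=
        Real.rpow_le_rpow_of_nonpos ht0 (by linarith) (by linarith)
      have h2 : 0 ≤ t * t ^ (-a) := by positivity
      nlinarith
  have := hint.lintegral_lt_top
  exact this

theorem K_eq_ofReal {a : ℝ} {x : ℂ} (hx : x ≠ 0) : K a x = ENNReal.ofReal (‖x‖ ^ (-a)) := by
  rw [K, ← ofReal_norm, ENNReal.ofReal_rpow_of_pos (by simpa using hx)]

/-- The convolution integral at two points of distance one: near each of the two singularities, the
other factor is bounded, and the exponent at infinity is `1 + s > 2`. -/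
theorem lintegral_unit_lt_top {s : ℝ} (h1 : 1 < s) (h2 : s < 2) :
    ∫⁻ v : ℂ, K 1 (1 - v) * K s v < ⊤ := by
  have A := lintegral_norm_rpow_lt_top (a := s) (b := 1) h2 zero_le_one (by linarith)
  have B := lintegral_norm_rpow_lt_top (a := 1) (b := s) (by norm_num) (by linarith) (by linarith)
  have B' : ∫⁻ v : ℂ, ENNReal.ofReal (‖1 - v‖ ^ (-1 : ℝ) * (1 + ‖1 - v‖) ^ (-s)) < ⊤ := by
    rwa [lintegral_sub_left_eq_self
      (fun v : ℂ => ENNReal.ofReal (‖v‖ ^ (-1 : ℝ) * (1 + ‖v‖) ^ (-s))) 1]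
  have hm : Measurable fun v : ℂ =>
      ENNReal.ofReal (4 ^ s * (‖v‖ ^ (-s) * (1 + ‖v‖) ^ (-1 : ℝ))) := by fun_prop
  have key : ∀ᵐ v : ℂ, K 1 (1 - v) * K s v ≤
      ENNReal.ofReal (4 ^ s * (‖v‖ ^ (-s) * (1 + ‖v‖) ^ (-1 : ℝ))) +
      ENNReal.ofReal (4 ^ s * (‖1 - v‖ ^ (-1 : ℝ) * (1 + ‖1 - v‖) ^ (-s))) := by
    have e0 : ∀ᵐ v : ℂ, v ≠ 0 := by simp [ae_iff]
    have e1 : ∀ᵐ v : ℂ, v ≠ 1 := by simp [ae_iff]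
    filter_upwards [e0, e1] with v hv0 hv1
    have hv1' : 1 - v ≠ 0 := sub_ne_zero.2 (Ne.symm hv1)
    rw [K_eq_ofReal hv0, K_eq_ofReal hv1', ← ENNReal.ofReal_mul (by positivity)]
    have htri : 1 ≤ ‖1 - v‖ + ‖v‖ := by
      have := norm_add_le (1 - v) v
      simpa using this
    have hp : 0 < ‖1 - v‖ := norm_pos_iff.2 hv1'
    have hq : 0 < ‖v‖ := norm_pos_iff.2 hv0
    -- the larger of the two distances is comparable to one plus the smaller one
    have cmp : ∀ p q t : ℝ, 0 < p → 0 < q → q ≤ p → 1 ≤ p + q → 0 ≤ t → t ≤ s →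
        p ^ (-t) ≤ 4 ^ s * (1 + q) ^ (-t) := by
      intro p q t hp hq hqp hpq ht hts
      calc p ^ (-t) ≤ ((1 + q) / 4) ^ (-t) :=
            Real.rpow_le_rpow_of_nonpos (by positivity) (by linarith) (by linarith)
        _ = 4 ^ t * (1 + q) ^ (-t) := by
            rw [Real.div_rpow (by positivity) (by positivity), Real.rpow_neg (by positivity : (0:ℝ) ≤ 4)]
            field_simp
        _ ≤ 4 ^ s * (1 + q) ^ (-t) := by
            gcongr
            norm_num
    rcases le_total ‖v‖ ‖1 - v‖ with h | h
    · refine le_add_right (ENNReal.ofReal_le_ofReal ?_)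
      have := cmp ‖1 - v‖ ‖v‖ 1 hp hq h (by linarith) zero_le_one h1.le
      calc ‖1 - v‖ ^ (-1 : ℝ) * ‖v‖ ^ (-s) ≤ 4 ^ s * (1 + ‖v‖) ^ (-1 : ℝ) * ‖v‖ ^ (-s) := by gcongr
        _ = _ := by ring
    · refine le_add_left (ENNReal.ofReal_le_ofReal ?_)
      have := cmp ‖v‖ ‖1 - v‖ s hq hp h (by linarith) (by linarith) le_rfl
      calc ‖1 - v‖ ^ (-1 : ℝ) * ‖v‖ ^ (-s) ≤ ‖1 - v‖ ^ (-1 : ℝ) * (4 ^ s * (1 + ‖1 - v‖) ^ (-s)) := by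
            gcongr
        _ = _ := by ring
  refine (lintegral_mono_ae key).trans_lt ?_
  rw [lintegral_add_left hm]
  simp_rw [ENNReal.ofReal_mul (by positivity : (0:ℝ) ≤ 4 ^ s)]
  rw [lintegral_const_mul' _ _ ENNReal.ofReal_ne_top, lintegral_const_mul' _ _ ENNReal.ofReal_ne_top]
  exact ENNReal.add_lt_top.2 ⟨ENNReal.mul_lt_top ENNReal.ofReal_lt_top A,
    ENNReal.mul_lt_top ENNReal.ofReal_lt_top B'⟩

/-- The change of variables `u = z + c v`, whose Jacobian determinant is `|c|²`. -/
theorem lintegral_comp_affine (f : ℂ → ℝ≥0∞) (hf : Measurable f) {c : ℂ} (hc : c ≠ 0) (z : ℂ) :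
    ∫⁻ u, f u = K (-2) c * ∫⁻ v, f (z + c * v) := by
  have hdet : LinearMap.det (LinearMap.mulLeft ℝ c) = Complex.normSq c := by
    rw [← Algebra.norm_complex_apply, Algebra.norm_apply]; rfl
  have hne : LinearMap.det (LinearMap.mulLeft ℝ c) ≠ 0 := by
    rw [hdet]; simpa using hc
  have hmap := Measure.map_linearMap_addHaar_eq_smul_addHaar (volume : Measure ℂ) hne
  have h1 : ∫⁻ v, f (z + c * v) = ∫⁻ y, f (z + y) ∂(Measure.map (LinearMap.mulLeft ℝ c) volume) := by
    rw [lintegral_map (by fun_prop) (by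
      change Measurable fun v : ℂ => c * v
      fun_prop)]
    rfl
  rw [h1, hmap, lintegral_smul_measure, lintegral_add_left_eq_self, hdet, smul_eq_mul, ← mul_assoc]
  have : K (-2) c * ENNReal.ofReal |(Complex.normSq c)⁻¹| = 1 := by
    have h2 : 0 < ‖c‖ := norm_pos_iff.2 hc
    rw [K_eq_ofReal hc, ← ENNReal.ofReal_mul (by positivity), Complex.normSq_eq_norm_sq,
      abs_of_nonneg (by positivity), neg_neg, Real.rpow_two, mul_inv_cancel₀ (by positivity),
      ENNReal.ofReal_one]
  rw [this, one_mul]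

/-- The convolution of `|x|^(-1)` and `|x|^(-s)` is a multiple of `|x|^(-(s - 1))`. -/
theorem exists_lintegral_K_le {s : ℝ} (h1 : 1 < s) (h2 : s < 2) :
    ∃ C : ℝ≥0∞, C ≠ ⊤ ∧ ∀ w z : ℂ, ∫⁻ u, K 1 (w - u) * K s (u - z) ≤ C * K (s - 1) (w - z) := by
  refine ⟨1 + ∫⁻ v : ℂ, K 1 (1 - v) * K s v,
    ENNReal.add_ne_top.2 ⟨ENNReal.one_ne_top, (lintegral_unit_lt_top h1 h2).ne⟩, fun w z => ?_⟩
  rcases eq_or_ne w z with rfl | hwz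
  · rw [sub_self, K_zero (by linarith), ENNReal.mul_top (by simp)]
    exact le_top
  have hc : w - z ≠ 0 := sub_ne_zero.2 hwz
  have hm : Measurable fun u => K 1 (w - u) * K s (u - z) := by
    have h1 := measurable_K 1
    have h2 := measurable_K s
    fun_prop
  rw [lintegral_comp_affine _ hm hc z]
  -- by scaling, the integral is a power of `|w - z|` times its value at distance one
  have : ∀ᵐ v : ℂ, K 1 (w - (z + (w - z) * v)) * K s (z + (w - z) * v - z) =
      (K 1 (w - z) * K s (w - z)) * (K 1 (1 - v) * K s v) := by
    have e0 : ∀ᵐ v : ℂ, v ≠ 0 := by simp [ae_iff]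
    have e1 : ∀ᵐ v : ℂ, v ≠ 1 := by simp [ae_iff]
    filter_upwards [e0, e1] with v hv0 hv1
    have hv1' : 1 - v ≠ 0 := sub_ne_zero.2 (Ne.symm hv1)
    rw [show w - (z + (w - z) * v) = (w - z) * (1 - v) by ring,
      show z + (w - z) * v - z = (w - z) * v by ring, K_mul _ _ _ hc hv1', K_mul _ _ _ hc hv0]
    ring
  rw [lintegral_congr_ae this, lintegral_const_mul' _ _
    (ENNReal.mul_ne_top (K_ne_top hc) (K_ne_top hc)), ← mul_assoc, ← K_add _ _ hc, ← K_add _ _ hc,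
    mul_comm, show (-2 : ℝ) + (1 + s) = s - 1 by ring]
  gcongr
  exact le_add_self

/-- The effect of one interaction vertex on singularities at pairwise distinct points: exponents
`1 - δ` at the two incoming half-edges become an exponent `1 - δ'` at the outgoing one. -/
theorem exists_vertex_bound {n : ℕ} {z : Fin n → ℂ} (hz : Function.Injective z)
    {S₁ S₂ : Finset (Fin n)} (hS : Disjoint S₁ S₂) {δ₁ δ₂ δ' : ℝ} (h1 : 0 ≤ δ₁) (h2 : 0 ≤ δ₂)
    (h3 : δ₁ + δ₂ ≤ δ') (h4 : 0 < δ') (h5 : δ' < 1) :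
    ∃ C : ℝ≥0∞, C ≠ ⊤ ∧ ∀ w : ℂ,
      ∫⁻ u, K 1 (w - u) * (∑ i ∈ S₁, K (1 - δ₁) (u - z i)) * (∑ i ∈ S₂, K (1 - δ₂) (u - z i)) ≤
        C * ∑ i ∈ S₁ ∪ S₂, K (1 - δ') (w - z i) := by
  -- two singularities at distinct points are replaced by single ones of order `2 - δ'`, which the
  -- convolution with `|x|^(-1)` lowers to `1 - δ'`
  obtain ⟨C₀, hC₀, hC⟩ := exists_lintegral_K_le (s := 2 - δ') (by linarith) (by linarith)
  set c : Fin n → Fin n → ℝ≥0∞ := fun i j =>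
    K ((1 - δ₁) + (1 - δ₂) - (2 - δ')) (‖z i - z j‖ / 2 : ℝ) with hc
  have hctop : ∀ i ∈ S₁, ∀ j ∈ S₂, c i j ≠ ⊤ := by
    intro i hi j hj
    refine K_ne_top ?_
    have : z i - z j ≠ 0 := sub_ne_zero.2 fun h => Finset.disjoint_left.1 hS hi (hz h ▸ hj)
    have : ‖z i - z j‖ ≠ 0 := norm_ne_zero_iff.2 this
    exact_mod_cast div_ne_zero this two_ne_zero
  refine ⟨(∑ i ∈ S₁, ∑ j ∈ S₂, c i j) * (2 * C₀), ?_, fun w => ?_⟩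
  · refine ENNReal.mul_ne_top ?_ (ENNReal.mul_ne_top (by simp) hC₀)
    exact ENNReal.sum_ne_top.2 fun i hi => ENNReal.sum_ne_top.2 fun j hj => hctop i hi j hj
  have hmK := fun a => measurable_K a
  calc _ = ∫⁻ u, ∑ i ∈ S₁, ∑ j ∈ S₂,
        K 1 (w - u) * (K (1 - δ₁) (u - z i) * K (1 - δ₂) (u - z j)) := by
        refine lintegral_congr fun u => ?_
        rw [mul_assoc, Finset.sum_mul_sum, Finset.mul_sum]
        simp_rw [Finset.mul_sum]
    _ = ∑ i ∈ S₁, ∑ j ∈ S₂, ∫⁻ u,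
        K 1 (w - u) * (K (1 - δ₁) (u - z i) * K (1 - δ₂) (u - z j)) := by
        rw [lintegral_finsetSum _ fun i _ => by fun_prop]
        refine Finset.sum_congr rfl fun i _ => ?_
        rw [lintegral_finsetSum _ fun j _ => by fun_prop]
    _ ≤ ∑ i ∈ S₁, ∑ j ∈ S₂, c i j * (2 * C₀ * ∑ i ∈ S₁ ∪ S₂, K (1 - δ') (w - z i)) := by
        refine Finset.sum_le_sum fun i hi => Finset.sum_le_sum fun j hj => ?_
        have hne : z i - z j ≠ 0 := sub_ne_zero.2 fun h => Finset.disjoint_left.1 hS hi (hz h ▸ hj)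
        have hle : ∀ l ∈ S₁ ∪ S₂, ∫⁻ u, K 1 (w - u) * K (2 - δ') (u - z l) ≤
            C₀ * ∑ i ∈ S₁ ∪ S₂, K (1 - δ') (w - z i) := by
          intro l hl
          refine (hC w (z l)).trans ?_
          rw [show 2 - δ' - 1 = 1 - δ' by ring]
          gcongr
          exact Finset.single_le_sum (f := fun i => K (1 - δ') (w - z i))
            (fun _ _ => zero_le) hl
        calc _ ≤ ∫⁻ u, c i j * (K 1 (w - u) * K (2 - δ') (u - z i) +
              K 1 (w - u) * K (2 - δ') (u - z j)) := by
              refine lintegral_mono fun u => ?_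
              have := K_mul_le (a := 1 - δ₁) (b := 1 - δ₂) (s := 2 - δ') (x := u - z i)
                (y := u - z j) (by linarith) (by linarith) (by linarith) (by linarith)
                (by linarith) (norm_pos_iff.2 hne) (by
                  have := norm_sub_le (u - z j) (u - z i)
                  rw [show u - z j - (u - z i) = z i - z j by ring] at this
                  linarith)
              calc _ ≤ K 1 (w - u) * (c i j * (K (2 - δ') (u - z i) + K (2 - δ') (u - z j))) := by
                    gcongr
                _ = _ := by ring
          _ = c i j * ((∫⁻ u, K 1 (w - u) * K (2 - δ') (u - z i)) +
              ∫⁻ u, K 1 (w - u) * K (2 - δ') (u - z j)) := by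
              rw [lintegral_const_mul' _ _ (hctop i hi j hj), lintegral_add_left (by fun_prop)]
          _ ≤ c i j * (C₀ * ∑ i ∈ S₁ ∪ S₂, K (1 - δ') (w - z i) +
                C₀ * ∑ i ∈ S₁ ∪ S₂, K (1 - δ') (w - z i)) := by
              gcongr
              · exact hle i (Finset.mem_union_left _ hi)
              · exact hle j (Finset.mem_union_right _ hj)
          _ = _ := by ring
    _ = _ := by
        simp_rw [← Finset.sum_mul]
        ring

/-! ### Absolute convergence of the integral of a forest -/

open MeasureTheory
open scoped ENNReal

theorem measurable_points {n N : ℕ} (z : Fin n → ℂ) (h : HalfEdge n N) :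
    Measurable fun u => points z u h := by
  rcases h with i | ⟨k, t⟩
  · exact measurable_const
  · exact measurable_pi_apply k

theorem points_update {n N : ℕ} (z : Fin n → ℂ) (u : Fin N → ℂ) (k : Fin N) (x : ℂ)
    {h : HalfEdge n N} (hh : ∀ t, h ≠ .inr (k, t)) :
    points z (Function.update u k x) h = points z u h := by
  rcases h with i | ⟨v, t⟩
  · rfl
  · have : v ≠ k := fun h => hh t (by rw [h])
    simp [points, this]

theorem prod_eq_mul_three {α M : Type*} [Fintype α] [DecidableEq α] [CommMonoid M] (f : α → M)
    {a b c : α} (hab : a ≠ b) (hac : a ≠ c) (hbc : b ≠ c) :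
    ∏ x, f x = f a * (f b * f c) * ∏ x with x ≠ a ∧ x ≠ b ∧ x ≠ c, f x := by
  rw [← Finset.prod_filter_mul_prod_filter_not Finset.univ (fun x => x ≠ a ∧ x ≠ b ∧ x ≠ c),
    mul_comm]
  congr 1
  have : (Finset.univ.filter fun x => ¬(x ≠ a ∧ x ≠ b ∧ x ≠ c)) = {a, b, c} := by
    ext x; simp; tauto
  rw [this, Finset.prod_insert (by simp [hab, hac]), Finset.prod_pair hbc]

namespace Diagram

variable {n N : ℕ} {Φ : Fin n → Insertion} {Γ : Diagram Φ N}

/-- Three steps lead from a vertex to the next one: to its outgoing half-edge, along the edge, and to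
the vertex. -/
theorem IsForest.depth_out (hΓ : Γ.IsForest) {j v : Fin N} {t : Fin 3}
    (h : Γ.pairing.1 (.inr (j, 0)) = .inr (v, t)) :
    depth Γ.parent (.inr j) = depth Γ.parent (.inr v) + 3 := by
  have hP := Γ.isForest_iff.1 hΓ
  have hc : hCharge Φ (.inr (v, t) : HalfEdge n N) = -1 := by
    rw [← h, Γ.hCharge_pairing]; rfl
  have ht : t ≠ 0 := by rintro rfl; simp [hCharge] at hc
  have e1 : Γ.parent (.inr j) = .inl (.inr (j, 0)) := Γ.parent_inr j
  have e2 : Γ.parent (.inl (.inr (j, 0))) = .inl (.inr (v, t)) := by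
    rw [Γ.parent_of_charge rfl, h]
  have e3 : Γ.parent (.inl (.inr (v, t))) = .inr v := Γ.parent_incoming v ht
  rw [depth_of_ne hP (by rw [e1]; simp), e1,
    depth_of_ne hP (by rw [e2]; intro h'; rw [Sum.inl.injEq] at h'; exact Γ.pairing.apply_ne _ (h.trans h')),
    e2, depth_of_ne hP (by rw [e3]; simp), e3]

/-- After all interaction vertices outside of `s` have been cut off, the half-edge `h` is an incoming
half-edge, at a fixed vertex or at a vertex in `s`, that is not paired with a vertex in `s`. -/
def IsCut (Γ : Diagram Φ N) (s : Finset (Fin N)) (h : HalfEdge n N) : Prop :=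
  hCharge Φ h = -1 ∧ (∀ k t, h = .inr (k, t) → k ∈ s) ∧ ∀ k ∈ s, Γ.pairing.1 h ≠ .inr (k, 0)

/-- The integrand that remains after the integration over the positions of the vertices outside of
`s`: one factor for each vertex in `s`, and a function `A h` of the position of each cut half-edge
`h`, which bounds the contribution of the branch that was cut off at `h`. -/
def prunedIntegrand (Γ : Diagram Φ N) (z : Fin n → ℂ) (s : Finset (Fin N))
    (A : HalfEdge n N → ℂ → ℝ≥0∞) (u : Fin N → ℂ) : ℝ≥0∞ :=
  (∏ k ∈ s, K 1 (points z u (Γ.pairing.1 (.inr (k, 0))) - u k)) * ∏ h, A h (points z u h)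

/-- The bounds on the branches cut off: `A h` has singularities of order `1 - m h / (N + 1)` at the
leaves `L h` of the branch at `h`. Every vertex that has been integrated out contributes at most `1`
to the total of the `m h`, so that the exponents remain positive. -/
structure IsBranchBound (Γ : Diagram Φ N) (z : Fin n → ℂ) (s : Finset (Fin N))
    (A : HalfEdge n N → ℂ → ℝ≥0∞) (C : HalfEdge n N → ℝ≥0∞) (L : HalfEdge n N → Finset (Fin n))
    (m : HalfEdge n N → ℕ) : Prop where
  ne_top : ∀ h, C h ≠ ⊤
  eq_of_isCut : ∀ h, Γ.IsCut s h →
    A h = fun w => C h * ∑ i ∈ L h, K (1 - m h / (N + 1)) (w - z i)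
  eq_one : ∀ h, ¬ Γ.IsCut s h → A h = fun _ => 1
  charge : ∀ h, Γ.IsCut s h → ∀ i ∈ L h, (Φ i).charge = 1
  disjoint : ∀ h h', Γ.IsCut s h → Γ.IsCut s h' → h ≠ h' → Disjoint (L h) (L h')
  sum_le : ∑ h, m h + s.card ≤ N

theorem IsBranchBound.measurable {z : Fin n → ℂ} {s : Finset (Fin N)}
    {A : HalfEdge n N → ℂ → ℝ≥0∞} {C : HalfEdge n N → ℝ≥0∞} {L : HalfEdge n N → Finset (Fin n)}
    {m : HalfEdge n N → ℕ} (hA : Γ.IsBranchBound z s A C L m) (h : HalfEdge n N) :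
    Measurable (A h) := by
  by_cases hc : Γ.IsCut s h
  · rw [hA.eq_of_isCut h hc]
    have := fun a => measurable_K a
    fun_prop
  · rw [hA.eq_one h hc]
    exact measurable_const

theorem IsBranchBound.measurable_prunedIntegrand {z : Fin n → ℂ} {s : Finset (Fin N)}
    {A : HalfEdge n N → ℂ → ℝ≥0∞} {C : HalfEdge n N → ℝ≥0∞} {L : HalfEdge n N → Finset (Fin n)}
    {m : HalfEdge n N → ℕ} (hA : Γ.IsBranchBound z s A C L m) :
    Measurable (Γ.prunedIntegrand z s A) := by
  unfold prunedIntegrand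
  refine Measurable.mul (Finset.measurable_prod _ fun k _ => ?_)
    (Finset.measurable_prod _ fun h _ => (hA.measurable h).comp (measurable_points z h))
  exact (measurable_K 1).comp ((measurable_points z _).sub (measurable_pi_apply k))

/-- Integration over the position of a vertex that is farthest from the root. -/
theorem IsForest.exists_prune (hΓ : Γ.IsForest) {z : Fin n → ℂ} (hz : Function.Injective z)
    {s : Finset (Fin N)} {k : Fin N} (hk : k ∉ s)
    (hup : ∀ j v t, Γ.pairing.1 (.inr (j, 0)) = .inr (v, t) → j ∈ insert k s → v ∈ insert k s)
    (hmax : ∀ j ∈ insert k s, depth Γ.parent (.inr j) ≤ depth Γ.parent (.inr k))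
    {A : HalfEdge n N → ℂ → ℝ≥0∞} {C : HalfEdge n N → ℝ≥0∞} {L : HalfEdge n N → Finset (Fin n)}
    {m : HalfEdge n N → ℕ} (hA : Γ.IsBranchBound z (insert k s) A C L m) :
    ∃ A' C' L' m', Γ.IsBranchBound z s A' C' L' m' ∧
      ∀ u, ∫⁻ x, Γ.prunedIntegrand z (insert k s) A (Function.update u k x) ≤
        Γ.prunedIntegrand z s A' u := by
  classical
  -- `h₀` is the half-edge towards the root at which the vertex `k` is cut off, and `h₁`, `h₂` are the
  -- half-edges at which its two branches have been cut off before
  obtain ⟨h₀, hh₀⟩ : ∃ h₀, h₀ = Γ.pairing.1 (.inr (k, 0)) := ⟨_, rfl⟩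
  set h₁ : HalfEdge n N := .inr (k, 1) with hh₁
  set h₂ : HalfEdge n N := .inr (k, 2) with hh₂
  have hσ₀ : Γ.pairing.1 h₀ = .inr (k, 0) := by rw [hh₀, Pairing.apply_apply]
  have hnot : ∀ j ∈ insert k s, ∀ t, Γ.pairing.1 (.inr (j, 0)) ≠ .inr (k, t) := by
    intro j hj t h
    have := hΓ.depth_out h
    have := hmax j hj
    omega
  have h01 : h₀ ≠ h₁ := by rw [hh₀]; exact hnot k (Finset.mem_insert_self _ _) 1
  have h02 : h₀ ≠ h₂ := by rw [hh₀]; exact hnot k (Finset.mem_insert_self _ _) 2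
  have h12 : h₁ ≠ h₂ := by simp [hh₁, hh₂]
  have hcut : ∀ t : Fin 3, t ≠ 0 → Γ.IsCut (insert k s) (.inr (k, t)) := by
    intro t ht
    refine ⟨by simp [hCharge, ht], ?_, ?_⟩
    · rintro k' t' h
      simp only [Sum.inr.injEq, Prod.mk.injEq] at h
      exact h.1 ▸ Finset.mem_insert_self _ _
    · intro j hj h
      exact hnot j hj t (by rw [← h, Pairing.apply_apply])
  have hcut₁ := hcut 1 (by decide)
  have hcut₂ := hcut 2 (by decide)
  have hncut₀ : ¬ Γ.IsCut (insert k s) h₀ := fun h => h.2.2 k (Finset.mem_insert_self _ _) hσ₀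
  have hcut₀ : Γ.IsCut s h₀ := by
    refine ⟨by rw [hh₀, Γ.hCharge_pairing]; rfl, ?_, ?_⟩
    · intro v t h
      rw [hh₀] at h
      have h1 := hup k v t h (Finset.mem_insert_self _ _)
      rcases Finset.mem_insert.1 h1 with rfl | h1
      · exact absurd h (hnot _ (Finset.mem_insert_self _ _) t)
      · exact h1
    · intro j hj h
      rw [hσ₀] at h
      simp only [Sum.inr.injEq, Prod.mk.injEq, and_true] at h
      exact hk (h ▸ hj)
  have hcut_of : ∀ h, h ≠ h₀ → Γ.IsCut s h → Γ.IsCut (insert k s) h ∧ h ≠ h₁ ∧ h ≠ h₂ := by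
    intro h hne hc
    refine ⟨⟨hc.1, fun v t e => Finset.mem_insert_of_mem (hc.2.1 v t e), fun j hj e => ?_⟩,
      fun e => hk (hc.2.1 k 1 e), fun e => hk (hc.2.1 k 2 e)⟩
    rcases Finset.mem_insert.1 hj with rfl | hj
    · exact hne (by rw [hh₀, ← e, Pairing.apply_apply])
    · exact hc.2.2 j hj e
  have hcut_to : ∀ h, Γ.IsCut (insert k s) h → h ≠ h₁ → h ≠ h₂ → Γ.IsCut s h := by
    intro h hc hne₁ hne₂
    refine ⟨hc.1, fun v t e => ?_, fun j hj => hc.2.2 j (Finset.mem_insert_of_mem hj)⟩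
    rcases Finset.mem_insert.1 (hc.2.1 v t e) with rfl | hv
    · subst e
      have := hc.1
      fin_cases t
      · simp [hCharge] at this
      · exact absurd rfl hne₁
      · exact absurd rfl hne₂
    · exact hv
  have hsum := hA.sum_le
  have hm3 : ∑ h, m h = (m h₀ + (m h₁ + m h₂)) + ∑ h with h ≠ h₀ ∧ h ≠ h₁ ∧ h ≠ h₂, m h :=
    prod_eq_mul_three (M := Multiplicative ℕ) m h01 h02 h12
  rw [Finset.card_insert_of_notMem hk] at hsum
  have hNpos : (0 : ℝ) < (N : ℝ) + 1 := by positivity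
  obtain ⟨c, hc, hbound⟩ := exists_vertex_bound hz
    (hA.disjoint h₁ h₂ hcut₁ hcut₂ h12) (δ₁ := m h₁ / (N + 1)) (δ₂ := m h₂ / (N + 1))
    (δ' := ((m h₁ + m h₂ + 1 : ℕ) : ℝ) / (N + 1)) (by positivity) (by positivity)
    (by
      rw [← add_div]; exact div_le_div_of_nonneg_right (by push_cast; linarith) hNpos.le) (by positivity) (by
      rw [div_lt_one hNpos]
      have : m h₁ + m h₂ + 1 < N + 1 := by omega
      exact_mod_cast this)
  -- the new branch at `h₀` has the leaves of both branches and one more vertex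
  set m' : HalfEdge n N → ℕ := fun h =>
    if h = h₀ then m h₁ + m h₂ + 1 else if h = h₁ ∨ h = h₂ then 0 else m h with hm'
  set L' : HalfEdge n N → Finset (Fin n) := fun h => if h = h₀ then L h₁ ∪ L h₂ else L h with hL'
  set C' : HalfEdge n N → ℝ≥0∞ := fun h => if h = h₀ then C h₁ * C h₂ * c else C h with hC'
  set A' : HalfEdge n N → ℂ → ℝ≥0∞ := fun h =>
    if h = h₀ then fun w => C' h * ∑ i ∈ L' h, K (1 - m' h / (N + 1)) (w - z i)
    else if h = h₁ ∨ h = h₂ then fun _ => 1 else A h with hA'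
  refine ⟨A', C', L', m', ⟨?_, ?_, ?_, ?_, ?_, ?_⟩, ?_⟩
  · intro h
    simp only [hC']
    split_ifs
    · exact ENNReal.mul_ne_top (ENNReal.mul_ne_top (hA.ne_top _) (hA.ne_top _)) hc
    · exact hA.ne_top h
  · intro h hs
    by_cases h0 : h = h₀
    · simp only [hA', if_pos h0]
    · obtain ⟨hs', h1, h2⟩ := hcut_of h h0 hs
      simp only [hA', hC', hL', hm', if_neg h0, h1, h2, or_self, if_false]
      exact hA.eq_of_isCut h hs'
  · intro h hs
    have h0 : h ≠ h₀ := by rintro rfl; exact hs hcut₀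
    simp only [hA', if_neg h0]
    split_ifs with h1
    · rfl
    · push Not at h1
      exact hA.eq_one h fun hc => hs (hcut_to h hc h1.1 h1.2)
  · intro h hs i hi
    by_cases h0 : h = h₀
    · simp only [hL', if_pos h0, Finset.mem_union] at hi
      exact hi.elim (hA.charge _ hcut₁ i) (hA.charge _ hcut₂ i)
    · simp only [hL', if_neg h0] at hi
      exact hA.charge h (hcut_of h h0 hs).1 i hi
  · have key : ∀ h, Γ.IsCut s h → h ≠ h₀ → Disjoint (L h₁ ∪ L h₂) (L h) := by
      intro h hs h0
      obtain ⟨hs', h1, h2⟩ := hcut_of h h0 hs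
      exact Finset.disjoint_union_left.2 ⟨hA.disjoint _ _ hcut₁ hs' h1.symm,
        hA.disjoint _ _ hcut₂ hs' h2.symm⟩
    intro h h' hs hs' hne
    by_cases h0 : h = h₀
    · have h0' : h' ≠ h₀ := fun e => hne (h0.trans e.symm)
      simp only [hL', if_pos h0, if_neg h0']
      exact key h' hs' h0'
    · by_cases h0' : h' = h₀
      · simp only [hL', if_pos h0', if_neg h0]
        exact (key h hs h0).symm
      · simp only [hL', if_neg h0, if_neg h0']
        exact hA.disjoint _ _ (hcut_of h h0 hs).1 (hcut_of h' h0' hs').1 hne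
  · have e : ∑ h, m' h = (m' h₀ + (m' h₁ + m' h₂)) + ∑ h with h ≠ h₀ ∧ h ≠ h₁ ∧ h ≠ h₂, m' h :=
      prod_eq_mul_three (M := Multiplicative ℕ) m' h01 h02 h12
    have e2 : ∑ h with h ≠ h₀ ∧ h ≠ h₁ ∧ h ≠ h₂, m' h =
        ∑ h with h ≠ h₀ ∧ h ≠ h₁ ∧ h ≠ h₂, m h := by
      refine Finset.sum_congr rfl fun h hh => ?_
      simp only [Finset.mem_filter, Finset.mem_univ, true_and] at hh
      simp [hm', hh.1, hh.2.1, hh.2.2]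
    have e0 : m' h₀ = m h₁ + m h₂ + 1 := by simp [hm']
    have e3 : m' h₁ = 0 := by simp [hm', h01.symm]
    have e4 : m' h₂ = 0 := by simp [hm', h02.symm]
    rw [e, e2, e0, e3, e4]
    omega
  · intro u
    set w := points z u h₀ with hw
    set Q := (∏ j ∈ s, K 1 (points z u (Γ.pairing.1 (.inr (j, 0))) - u j)) *
      ∏ h with h ≠ h₀ ∧ h ≠ h₁ ∧ h ≠ h₂, A h (points z u h) with hQ
    have hleft : ∀ x, Γ.prunedIntegrand z (insert k s) A (Function.update u k x) =
        Q * (C h₁ * C h₂) * (K 1 (w - x) * (∑ i ∈ L h₁, K (1 - m h₁ / (N + 1)) (x - z i)) *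
          ∑ i ∈ L h₂, K (1 - m h₂ / (N + 1)) (x - z i)) := by
      intro x
      have p0 : points z (Function.update u k x) h₀ = w :=
        points_update _ _ _ _ (by rw [hh₀]; exact hnot k (Finset.mem_insert_self _ _))
      have p1 : points z (Function.update u k x) h₁ = x := by simp [points, hh₁]
      have p2 : points z (Function.update u k x) h₂ = x := by simp [points, hh₂]
      rw [prunedIntegrand, Finset.prod_insert hk, prod_eq_mul_three _ h01 h02 h12, p1, p2,
        ← hh₀, p0, Function.update_self, hA.eq_one h₀ hncut₀, hA.eq_of_isCut h₁ hcut₁,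
        hA.eq_of_isCut h₂ hcut₂]
      have f1 : ∏ j ∈ s, K 1 (points z (Function.update u k x) (Γ.pairing.1 (.inr (j, 0))) -
          Function.update u k x j) =
          ∏ j ∈ s, K 1 (points z u (Γ.pairing.1 (.inr (j, 0))) - u j) := by
        refine Finset.prod_congr rfl fun j hj => ?_
        rw [points_update _ _ _ _ (hnot j (Finset.mem_insert_of_mem hj)),
          Function.update_of_ne (by rintro rfl; exact hk hj)]
      have f2 : ∏ h with h ≠ h₀ ∧ h ≠ h₁ ∧ h ≠ h₂, A h (points z (Function.update u k x) h) =
          ∏ h with h ≠ h₀ ∧ h ≠ h₁ ∧ h ≠ h₂, A h (points z u h) := by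
        refine Finset.prod_congr rfl fun h hh => ?_
        simp only [Finset.mem_filter, Finset.mem_univ, true_and] at hh
        by_cases hc : Γ.IsCut (insert k s) h
        · rw [points_update]
          intro t e
          exact hk ((hcut_to h hc hh.2.1 hh.2.2).2.1 k t e)
        · rw [hA.eq_one h hc]
      rw [f1, f2, hQ]
      ring
    have hright : Γ.prunedIntegrand z s A' u =
        Q * (C h₁ * C h₂) *
          (c * ∑ i ∈ L h₁ ∪ L h₂, K (1 - ((m h₁ + m h₂ + 1 : ℕ) : ℝ) / (N + 1)) (w - z i)) := by
      rw [prunedIntegrand, prod_eq_mul_three _ h01 h02 h12, hQ]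
      have f2 : ∏ h with h ≠ h₀ ∧ h ≠ h₁ ∧ h ≠ h₂, A' h (points z u h) =
          ∏ h with h ≠ h₀ ∧ h ≠ h₁ ∧ h ≠ h₂, A h (points z u h) := by
        refine Finset.prod_congr rfl fun h hh => ?_
        simp only [Finset.mem_filter, Finset.mem_univ, true_and] at hh
        simp [hA', hh.1, hh.2.1, hh.2.2]
      have a0 : A' h₀ w = C h₁ * C h₂ * c *
          ∑ i ∈ L h₁ ∪ L h₂, K (1 - ((m h₁ + m h₂ + 1 : ℕ) : ℝ) / (N + 1)) (w - z i) := by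
        simp only [hA', hC', hL', hm', if_true]
      have a1 : A' h₁ (points z u h₁) = 1 := by simp [hA', h01.symm]
      have a2 : A' h₂ (points z u h₂) = 1 := by simp [hA', h02.symm]
      rw [f2, a1, a2, ← hw, a0]
      ring
    have := fun a => measurable_K a
    simp_rw [hleft, hright]
    rw [lintegral_const_mul _ (by fun_prop)]
    gcongr
    exact hbound w

/-- The vertices are integrated out in the order of decreasing depth. In the end, each remaining
bound is evaluated at a root, whose charge `-1` distinguishes it from the leaves. -/
theorem IsForest.lmarginal_prunedIntegrand_lt_top (hΓ : Γ.IsForest) {z : Fin n → ℂ}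
    (hz : Function.Injective z) (s : Finset (Fin N)) :
    ∀ (A : HalfEdge n N → ℂ → ℝ≥0∞) (C : HalfEdge n N → ℝ≥0∞) (L : HalfEdge n N → Finset (Fin n))
      (m : HalfEdge n N → ℕ),
      (∀ j v t, Γ.pairing.1 (.inr (j, 0)) = .inr (v, t) → j ∈ s → v ∈ s) →
      Γ.IsBranchBound z s A C L m → ∀ u,
      lmarginal (fun _ => (volume : Measure ℂ)) s (Γ.prunedIntegrand z s A) u < ⊤ := by
  classical
  induction hN : s.card generalizing s with
  | zero =>
    intro A C L m hup hA u
    obtain rfl := Finset.card_eq_zero.1 hN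
    rw [lmarginal_empty, prunedIntegrand, Finset.prod_empty, one_mul, lt_top_iff_ne_top]
    refine ENNReal.prod_ne_top fun h _ => ?_
    by_cases hc : Γ.IsCut ∅ h
    · rw [hA.eq_of_isCut h hc]
      refine ENNReal.mul_ne_top (hA.ne_top h) (ENNReal.sum_ne_top.2 fun i hi => K_ne_top ?_)
      rcases h with i' | ⟨k, t⟩
      · refine sub_ne_zero.2 fun e => ?_
        obtain rfl : i' = i := hz e
        have h1 := hA.charge _ hc _ hi
        have h2 := hc.1
        simp only [hCharge] at h2
        omega
      · exact absurd (hc.2.1 k t rfl) (Finset.notMem_empty k)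
    · rw [hA.eq_one h hc]
      exact ENNReal.one_ne_top
  | succ M ih =>
    intro A C L m hup hA u
    obtain ⟨k, hks, hmax⟩ := Finset.exists_max_image s (fun j => depth Γ.parent (.inr j))
      (Finset.card_pos.1 (by omega))
    obtain ⟨s', hk, rfl⟩ : ∃ s', k ∉ s' ∧ insert k s' = s :=
      ⟨s.erase k, Finset.notMem_erase k s, Finset.insert_erase hks⟩
    obtain ⟨A', C', L', m', hA', hle⟩ := hΓ.exists_prune hz hk hup hmax hA
    rw [lmarginal_insert' _ hA.measurable_prunedIntegrand hk]
    refine (lmarginal_mono (fun u => hle u) u).trans_lt (ih s' ?_ A' C' L' m' ?_ hA' u)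
    · rw [Finset.card_insert_of_notMem hk] at hN; omega
    · intro j v t e hj
      rcases Finset.mem_insert.1 (hup j v t e (Finset.mem_insert_of_mem hj)) with rfl | hv
      · have := hΓ.depth_out e
        have := hmax j (Finset.mem_insert_of_mem hj)
        omega
      · exact hv

/-- The product of the inverse distances along the edges of a forest is integrable. -/
theorem IsForest.lintegral_prod_K_lt_top (hΓ : Γ.IsForest) {z : Fin n → ℂ}
    (hz : Function.Injective z) :
    ∫⁻ u : Fin N → ℂ, ∏ h ∈ Γ.outgoing, K 1 (points z u (Γ.pairing.1 h) - points z u h) < ⊤ := by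
  classical
  set L : HalfEdge n N → Finset (Fin n) := fun h =>
    Sum.elim (fun i => {i}) (fun _ => ∅) (Γ.pairing.1 h) with hL
  set A : HalfEdge n N → ℂ → ℝ≥0∞ := fun h =>
    if Γ.IsCut Finset.univ h then
      fun w => 1 * ∑ i ∈ L h, K (1 - (0 : ℕ) / (N + 1)) (w - z i)
    else fun _ => 1 with hA
  have hcut : ∀ h, Γ.IsCut Finset.univ h → ∃ i, Γ.pairing.1 h = .inl i ∧ (Φ i).charge = 1 := by
    intro h hc
    rcases e : Γ.pairing.1 h with i | ⟨k, t⟩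
    · refine ⟨i, rfl, ?_⟩
      have := Γ.hCharge_pairing h
      rw [e, hc.1] at this
      simpa [hCharge] using this
    · have h1 := Γ.hCharge_pairing h
      rw [e, hc.1] at h1
      have : t = 0 := by
        by_contra ht
        simp [hCharge, ht] at h1
      exact absurd (by rw [e, this]) (hc.2.2 k (Finset.mem_univ k))
  have hbound : Γ.IsBranchBound z Finset.univ A (fun _ => 1) L (fun _ => 0) := by
    refine ⟨by simp, fun h hc => by simp only [hA, if_pos hc], fun h hc => by simp only [hA, if_neg hc],
      ?_, ?_, by simp⟩
    · intro h hc i hi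
      obtain ⟨j, hj, hcj⟩ := hcut h hc
      simp only [hL, hj, Sum.elim_inl, Finset.mem_singleton] at hi
      exact hi ▸ hcj
    · intro h h' hc hc' hne
      obtain ⟨j, hj, -⟩ := hcut h hc
      obtain ⟨j', hj', -⟩ := hcut h' hc'
      simp only [hL, hj, hj', Sum.elim_inl, Finset.disjoint_singleton]
      rintro rfl
      exact hne (Γ.pairing.1.injective (hj.trans hj'.symm))
  have hfin := hΓ.lmarginal_prunedIntegrand_lt_top hz Finset.univ A _ L _ (by simp) hbound 0
  rw [lmarginal_univ] at hfin
  convert hfin using 1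
  rw [volume_pi]
  refine lintegral_congr fun u => ?_
  rw [prod_outgoing Γ _ Finset.univ, mul_comm, prunedIntegrand]
  congr 1
  have : ∀ h, A h (points z u h) = if Γ.IsCut Finset.univ h then
      K 1 (points z u h - points z u (Γ.pairing.1 h)) else 1 := by
    intro h
    by_cases hc : Γ.IsCut Finset.univ h
    · obtain ⟨i, hi, -⟩ := hcut h hc
      simp [hA, hc, hL, hi, points]
    · simp [hA, hc]
  simp_rw [this]
  rw [← Finset.prod_filter]
  refine Finset.prod_bij' (fun h _ => Γ.pairing.1 h) (fun h _ => Γ.pairing.1 h) ?_ ?_ ?_ ?_ ?_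
  · intro h hh
    simp only [Finset.mem_filter, Γ.mem_outgoing, Finset.mem_univ, true_and] at hh ⊢
    refine ⟨by rw [Γ.hCharge_pairing, hh.1], by simp, fun k _ => ?_⟩
    rw [Pairing.apply_apply]
    exact hh.2 k trivial
  · intro h hh
    simp only [Finset.mem_filter, Γ.mem_outgoing, Finset.mem_univ, true_and] at hh ⊢
    refine ⟨by rw [Γ.hCharge_pairing, hh.1, neg_neg], fun k _ => hh.2.2 k (Finset.mem_univ k)⟩
  · intro h _; rw [Pairing.apply_apply]
  · intro h _; rw [Pairing.apply_apply]
  · intro h _; rw [Pairing.apply_apply]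

end Diagram

/-! ### Smooth dependence of integrals on parameters -/

open MeasureTheory Set
open scoped ContDiff

/-- The derivative in the first variable. -/
def partialDeriv {T Q E : Type} [NormedAddCommGroup T]
    [NormedSpace ℝ T] [NormedAddCommGroup Q] [NormedSpace ℝ Q] [NormedAddCommGroup E]
    [NormedSpace ℝ E] (H : T × Q → E) (p : T × Q) :
    T →L[ℝ] E :=
  (fderiv ℝ H p).comp (ContinuousLinearMap.inl ℝ T Q)

theorem contDiffOn_partialDeriv {T Q E : Type} [NormedAddCommGroup T]
    [NormedSpace ℝ T] [NormedAddCommGroup Q] [NormedSpace ℝ Q] [NormedAddCommGroup E]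
    [NormedSpace ℝ E] {H : T × Q → E}
    {U : Set (T × Q)} (hU : IsOpen U) (hH : ContDiffOn ℝ ∞ H U) :
    ContDiffOn ℝ ∞ (partialDeriv H) U :=
  (hH.fderiv_of_isOpen hU (by simp)).clm_comp contDiffOn_const

section ParametricIntegral

variable {α T Q : Type} [MeasurableSpace α] {μ : Measure α} [NormedAddCommGroup T]
  [NormedSpace ℝ T] [FiniteDimensional ℝ T] [NormedAddCommGroup Q] [NormedSpace ℝ Q]
  [FiniteDimensional ℝ Q] [MeasurableSpace Q] [BorelSpace Q]

theorem aestronglyMeasurable_smul_comp {E : Type} [NormedAddCommGroup E] [NormedSpace ℝ E]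
    {G : α → ℝ} (hG : Integrable G μ) {q : α → Q} (hq : Measurable q) {K : Set Q}
    (hqK : ∀ u, q u ∈ K) {f : Q → E} (hf : ContinuousOn f K) :
    AEStronglyMeasurable (fun u => G u • f (q u)) μ := by
  have : SecondCountableTopology Q := secondCountable_of_proper (α := Q)
  have h1 : StronglyMeasurable (fun u => (⟨q u, hqK u⟩ : K)) :=
    (hq.subtype_mk (h := hqK)).stronglyMeasurable
  exact hG.aestronglyMeasurable.smul
    ((continuousOn_iff_continuous_domRestrict.1 hf).comp_stronglyMeasurable h1).aestronglyMeasurable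

/-- Differentiation under the integral sign for an integrand `G(u) H(t, q(u))`, where `q` takes
values in a compact set: on it `H` and its derivatives are bounded. -/
theorem hasFDerivAt_integral_smul {E : Type} [NormedAddCommGroup E] [NormedSpace ℝ E]
    {G : α → ℝ} (hG : Integrable G μ) {q : α → Q} (hq : Measurable q) {K : Set Q}
    (hK : IsCompact K) (hqK : ∀ u, q u ∈ K) {U : Set (T × Q)} (hU : IsOpen U) {H : T × Q → E}
    (hH : ContDiffOn ℝ ∞ H U) {r : ℝ} (hr : Metric.closedBall 0 r ×ˢ K ⊆ U) {t : T}
    (ht : t ∈ Metric.ball 0 r) :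
    HasFDerivAt (fun t => ∫ u, G u • H (t, q u) ∂μ) (∫ u, G u • partialDeriv H (t, q u) ∂μ) t := by
  have hsub : ∀ t ∈ Metric.ball (0 : T) r, ∀ x ∈ K, (t, x) ∈ U := fun t ht x hx =>
    hr ⟨Metric.ball_subset_closedBall ht, hx⟩
  have hcompact : IsCompact (Metric.closedBall (0 : T) r ×ˢ K) :=
    (isCompact_closedBall 0 r).prod hK
  have hslice : ∀ t ∈ Metric.ball (0 : T) r, ∀ {E : Type} [NormedAddCommGroup E] [NormedSpace ℝ E]
      {H : T × Q → E}, ContDiffOn ℝ ∞ H U →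
      ContinuousOn (fun x : Q => H (t, x)) K :=
    fun t ht E _ _ H hH => ContinuousOn.comp (g := H) (f := fun x => (t, x)) hH.continuousOn
      (by fun_prop) fun x hx => hsub t ht x hx
  have hD : ContDiffOn ℝ ∞ (partialDeriv H) U := contDiffOn_partialDeriv hU hH
  obtain ⟨M, hM⟩ := hcompact.exists_bound_of_continuousOn (hD.continuousOn.mono hr)
  obtain ⟨M₀, hM₀⟩ := hcompact.exists_bound_of_continuousOn (hH.continuousOn.mono hr)
  refine hasFDerivAt_integral_of_dominated_of_fderiv_le (𝕜 := ℝ)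
    (F := fun t u => G u • H (t, q u)) (F' := fun t u => G u • partialDeriv H (t, q u))
    (s := Metric.ball 0 r)
    (bound := fun u => ‖G u‖ * M) (Metric.isOpen_ball.mem_nhds ht) ?_ ?_ ?_ ?_ ?_ ?_
  · filter_upwards [Metric.isOpen_ball.mem_nhds ht] with t' ht'
    exact aestronglyMeasurable_smul_comp hG hq hqK (hslice t' ht' hH)
  · refine (hG.norm.mul_const M₀).mono'
      (aestronglyMeasurable_smul_comp hG hq hqK (hslice t ht hH)) (ae_of_all _ fun u => ?_)
    rw [norm_smul]
    exact mul_le_mul_of_nonneg_left (hM₀ _ ⟨Metric.ball_subset_closedBall ht, hqK u⟩)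
      (norm_nonneg _)
  · exact aestronglyMeasurable_smul_comp hG hq hqK (hslice t ht hD)
  · refine ae_of_all _ fun u t' ht' => ?_
    rw [norm_smul]
    exact mul_le_mul_of_nonneg_left (hM _ ⟨Metric.ball_subset_closedBall ht', hqK u⟩)
      (norm_nonneg _)
  · exact hG.norm.mul_const M
  · refine ae_of_all _ fun u t' ht' => HasFDerivAt.const_smul ?_ (G u)
    have h1 : HasFDerivAt H (fderiv ℝ H (t', q u)) (t', q u) :=
      ((hH.contDiffAt (hU.mem_nhds (hsub t' ht' _ (hqK u)))).differentiableAt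
        (by simp)).hasFDerivAt
    exact h1.comp t' (hasFDerivAt_prodMk_left (𝕜 := ℝ) t' (q u))

/-- The derivative is again an integral of the same form, so that induction on the order applies. -/
theorem contDiffOn_integral_smul {G : α → ℝ} (hG : Integrable G μ) {q : α → Q} (hq : Measurable q)
    {K : Set Q} (hK : IsCompact K) (hqK : ∀ u, q u ∈ K) {U : Set (T × Q)} (hU : IsOpen U) {r : ℝ}
    (hr : Metric.closedBall 0 r ×ˢ K ⊆ U) (m : ℕ) :
    ∀ {E : Type} [NormedAddCommGroup E] [NormedSpace ℝ E] {H : T × Q → E}, ContDiffOn ℝ ∞ H U →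
      ContDiffOn ℝ m (fun t => ∫ u, G u • H (t, q u) ∂μ) (Metric.ball 0 r) := by
  induction m with
  | zero =>
    intro E _ _ H hH
    rw [Nat.cast_zero, contDiffOn_zero]
    exact fun t ht => (hasFDerivAt_integral_smul hG hq hK hqK hU hH hr
      ht).continuousAt.continuousWithinAt
  | succ m ih =>
    intro E _ _ H hH
    rw [Nat.cast_succ, contDiffOn_succ_iff_fderiv_of_isOpen Metric.isOpen_ball]
    refine ⟨fun t ht => (hasFDerivAt_integral_smul hG hq hK hqK hU hH hr
      ht).differentiableAt.differentiableWithinAt, by simp, ?_⟩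
    exact (ih (contDiffOn_partialDeriv hU hH)).congr fun t ht =>
      (hasFDerivAt_integral_smul hG hq hK hqK hU hH hr ht).fderiv

/-- An integral `∫ G(u) H(t, q(u)) du` with `G` integrable and `q` bounded is a smooth function of
the parameter `t` if `H` is smooth. -/
theorem contDiffAt_integral_smul {E : Type} [NormedAddCommGroup E] [NormedSpace ℝ E] {G : α → ℝ}
    (hG : Integrable G μ) {q : α → Q} (hq : Measurable q) {b : ℝ} (hb : 0 ≤ b)
    (hqb : ∀ᵐ u ∂μ, ‖q u‖ ≤ b) {U : Set (T × Q)} (hU : IsOpen U)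
    (hbU : ∀ x, ‖x‖ ≤ b → ((0 : T), x) ∈ U) {H : T × Q → E} (hH : ContDiffOn ℝ ∞ H U) :
    ContDiffAt ℝ ∞ (fun t => ∫ u, G u • H (t, q u) ∂μ) 0 := by
  classical
  set K : Set Q := Metric.closedBall 0 b with hKdef
  have hK : IsCompact K := isCompact_closedBall 0 b
  -- `q` is changed on a null set to have values in a compact set everywhere
  set q' : α → Q := fun u => if ‖q u‖ ≤ b then q u else 0 with hq'
  have hq'm : Measurable q' :=
    Measurable.ite (measurableSet_le hq.norm measurable_const) hq measurable_const
  have hq'K : ∀ u, q' u ∈ K := by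
    intro u
    rw [hKdef, mem_closedBall_zero_iff, hq']
    dsimp only
    split_ifs with h
    · exact h
    · simpa using hb
  have hcongr : (fun t => ∫ u, G u • H (t, q u) ∂μ) = fun t => ∫ u, G u • H (t, q' u) ∂μ := by
    funext t
    refine integral_congr_ae ?_
    filter_upwards [hqb] with u hu
    simp only [hq', if_pos hu]
  obtain ⟨V, W, hV, hW, h0V, hKW, hVW⟩ := generalized_tube_lemma
    (isCompact_singleton (x := (0 : T))) hK hU (by
      rintro ⟨t, x⟩ ⟨ht, hx⟩
      rw [mem_singleton_iff] at ht
      subst ht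
      exact hbU x (by simpa [hKdef] using hx))
  obtain ⟨r, hr0, hr⟩ := Metric.nhds_basis_closedBall.mem_iff.1
    (hV.mem_nhds (h0V (mem_singleton 0)))
  have hrU : Metric.closedBall (0 : T) r ×ˢ K ⊆ U := fun p hp => hVW ⟨hr hp.1, hKW hp.2⟩
  rw [hcongr]
  exact (contDiffOn_infty.2 fun m => contDiffOn_integral_smul hG hq'm hK hq'K hU hrU m hH).contDiffAt
    (Metric.isOpen_ball.mem_nhds (Metric.mem_ball_self hr0))

end ParametricIntegral

/-! ### Diffeomorphisms of the disk that move finitely many points -/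

open MeasureTheory Set
open scoped ContDiff ComplexConjugate

variable {n : ℕ}

/-- The map `x ↦ x + ∑ i, tᵢ χᵢ(x)`. -/
def shift (χ : Fin n → ℂ → ℝ) (t : Fin n → ℂ) (x : ℂ) : ℂ := x + ∑ i, t i * (χ i x : ℂ)

/-- Cut-off functions `χᵢ` near the points `zᵢ` of a configuration, with a common Lipschitz constant
`M`; the maps `shift χ t` then move `zᵢ` to `zᵢ + tᵢ` and fix the complement of the disk. -/
structure IsCutoff (S : Scheme) (z : Fin n → ℂ) (χ : Fin n → ℂ → ℝ) (M : ℝ) : Prop where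
  contDiff : ∀ i, ContDiff ℝ ∞ (χ i)
  apply_self : ∀ i, χ i (z i) = 1
  apply_of_ne : ∀ i j, i ≠ j → χ i (z j) = 0
  eq_zero : ∀ i, ∀ x ∉ Metric.eball (0 : ℂ) S.R, χ i x = 0
  nonneg : 0 ≤ M
  lipschitz : ∀ i x y, |χ i x - χ i y| ≤ M * ‖x - y‖

theorem exists_isCutoff {S : Scheme} {z : Fin n → ℂ} (hz : z ∈ conf S n) :
    ∃ χ M, IsCutoff S z χ M := by
  have h1 : ∀ i, ∃ f : ℂ → ℝ, tsupport f ⊆ Metric.eball (0 : ℂ) S.R \ (z '' {j | j ≠ i}) ∧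
      HasCompactSupport f ∧ ContDiff ℝ ∞ f ∧ range f ⊆ Icc 0 1 ∧ f (z i) = 1 := by
    intro i
    refine exists_contDiff_tsupport_subset (IsOpen.mem_nhds ?_ ⟨hz.2 i, ?_⟩)
    · exact Metric.isOpen_eball.sdiff (Set.toFinite _).isClosed
    · rintro ⟨j, hj, h⟩
      exact hj (hz.1 h)
  choose f hsupp hcomp hsmooth hrange hone using h1
  have h2 : ∀ i, ∃ C : NNReal, LipschitzWith C (f i) := fun i =>
    (hsmooth i).lipschitzWith_of_hasCompactSupport (hcomp i) (by simp)
  choose C hC using h2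
  refine ⟨f, ∑ i, (C i : ℝ), hsmooth, hone, fun i j hij => ?_, fun i x hx => ?_, by positivity,
    fun i x y => ?_⟩
  · exact image_eq_zero_of_notMem_tsupport fun h => (hsupp i h).2 ⟨j, hij.symm, rfl⟩
  · exact image_eq_zero_of_notMem_tsupport fun h => hx (hsupp i h).1
  · have := (hC i).dist_le_mul x y
    rw [Real.dist_eq, dist_eq_norm] at this
    refine this.trans (mul_le_mul_of_nonneg_right ?_ (norm_nonneg _))
    exact Finset.single_le_sum (f := fun i => (C i : ℝ)) (fun i _ => (C i).2) (Finset.mem_univ i)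

/-- The difference quotients of the cut-off functions. -/
def slope (χ : Fin n → ℂ → ℝ) (a b : ℂ) : Fin n → ℂ := fun i => ((χ i b - χ i a : ℝ) : ℂ) / (b - a)

/-- The factor `1 + ∑ i, tᵢ qᵢ` by which `shift χ t` changes a difference `b - a`, where `q` is the
slope between `a` and `b`. -/
def stretch (t q : Fin n → ℂ) : ℂ := 1 + ∑ i, t i * q i

/-- The map `shift χ t` multiplies differences by `stretch`. At `a = b` the slope has the value `0`,
but both sides vanish. -/
theorem shift_sub_shift (χ : Fin n → ℂ → ℝ) (t : Fin n → ℂ) (a b : ℂ) :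
    shift χ t b - shift χ t a = (b - a) * stretch t (slope χ a b) := by
  rcases eq_or_ne a b with rfl | hab
  · simp
  have h : b - a ≠ 0 := sub_ne_zero.2 hab.symm
  have e : ∀ i, (b - a) * (t i * slope χ a b i) = t i * (χ i b : ℂ) - t i * (χ i a : ℂ) := by
    intro i
    rw [slope]
    field_simp
    push_cast
    ring
  rw [stretch, mul_add, Finset.mul_sum]
  simp_rw [e]
  rw [Finset.sum_sub_distrib, shift, shift]
  ring

namespace IsCutoff

variable {S : Scheme} {z : Fin n → ℂ} {χ : Fin n → ℂ → ℝ} {M : ℝ}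

theorem shift_apply (h : IsCutoff S z χ M) (t : Fin n → ℂ) (j : Fin n) :
    shift χ t (z j) = z j + t j := by
  rw [shift, Finset.sum_eq_single j, h.apply_self]
  · simp
  · intro i _ hij
    rw [h.apply_of_ne i j hij]
    simp
  · simp

theorem norm_slope_le (h : IsCutoff S z χ M) (a b : ℂ) : ‖slope χ a b‖ ≤ M := by
  refine (pi_norm_le_iff_of_nonneg h.nonneg).2 fun i => ?_
  rw [slope, norm_div, Complex.norm_real, Real.norm_eq_abs]
  exact div_le_of_le_mul₀ (norm_nonneg _) h.nonneg (h.lipschitz i b a)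

theorem norm_stretch_sub_one_le (h : IsCutoff S z χ M) (t : Fin n → ℂ) (a b : ℂ) :
    ‖stretch t (slope χ a b) - 1‖ ≤ n * ‖t‖ * M := by
  rw [stretch, add_sub_cancel_left]
  refine (norm_sum_le _ _).trans ((Finset.sum_le_card_nsmul _ _ (‖t‖ * M) fun i _ => ?_).trans ?_)
  · rw [norm_mul]
    exact mul_le_mul (norm_le_pi_norm t i) ((norm_le_pi_norm _ i).trans (h.norm_slope_le a b))
      (norm_nonneg _) (norm_nonneg _)
  · rw [Finset.card_univ, Fintype.card_fin, nsmul_eq_mul, mul_assoc]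

theorem stretch_ne_zero (h : IsCutoff S z χ M) {t : Fin n → ℂ} (ht : n * ‖t‖ * M < 1) (a b : ℂ) :
    stretch t (slope χ a b) ≠ 0 := by
  intro h0
  have := h.norm_stretch_sub_one_le t a b
  rw [h0, zero_sub, norm_neg, norm_one] at this
  linarith

theorem shift_injective (h : IsCutoff S z χ M) {t : Fin n → ℂ} (ht : n * ‖t‖ * M < 1) :
    Function.Injective (shift χ t) := by
  intro a b hab
  have := shift_sub_shift χ t a b
  rw [hab, sub_self] at this
  have := (mul_eq_zero.1 this.symm).resolve_right (h.stretch_ne_zero ht a b)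
  exact (sub_eq_zero.1 this).symm

theorem shift_surjective (h : IsCutoff S z χ M) {t : Fin n → ℂ} (ht : n * ‖t‖ * M < 1) :
    Function.Surjective (shift χ t) := by
  have hM := h.nonneg
  -- `shift χ t` differs from the identity by a contraction
  have hlin : ApproximatesLinearOn (shift χ t)
      ((ContinuousLinearEquiv.refl ℝ ℂ : ℂ ≃L[ℝ] ℂ) : ℂ →L[ℝ] ℂ) univ
      (Real.toNNReal (n * ‖t‖ * M)) := by
    intro a _ b _
    rw [shift_sub_shift]
    have e : (a - b) * stretch t (slope χ b a) - (ContinuousLinearEquiv.refl ℝ ℂ : ℂ →L[ℝ] ℂ) (a - b) =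
        (a - b) * (stretch t (slope χ b a) - 1) := by
      simp [mul_sub]
    rw [e, norm_mul, mul_comm, Real.coe_toNNReal _ (by positivity)]
    exact mul_le_mul_of_nonneg_right (h.norm_stretch_sub_one_le t b a) (norm_nonneg _)
  refine hlin.surjective (Or.inr ?_)
  have e : ‖(((ContinuousLinearEquiv.refl ℝ ℂ).symm : ℂ ≃L[ℝ] ℂ) : ℂ →L[ℝ] ℂ)‖₊ = 1 := by
    ext
    exact ContinuousLinearMap.norm_id
  rw [e, inv_one, Real.toNNReal_lt_one]
  exact ht

theorem shift_of_notMem (h : IsCutoff S z χ M) (t : Fin n → ℂ) {x : ℂ}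
    (hx : x ∉ Metric.eball (0 : ℂ) S.R) : shift χ t x = x := by
  rw [shift, Finset.sum_eq_zero, add_zero]
  intro i _
  rw [h.eq_zero i x hx]
  simp

theorem shift_mem_iff (h : IsCutoff S z χ M) {t : Fin n → ℂ} (ht : n * ‖t‖ * M < 1) {x : ℂ} :
    shift χ t x ∈ Metric.eball (0 : ℂ) S.R ↔ x ∈ Metric.eball (0 : ℂ) S.R := by
  constructor
  · intro hx
    by_contra hx'
    rw [h.shift_of_notMem t hx'] at hx
    exact hx' hx
  · intro hx
    by_contra hx'
    exact hx' ((h.shift_injective ht (h.shift_of_notMem t hx')).symm ▸ hx)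

theorem image_domain (h : IsCutoff S z χ M) {t : Fin n → ℂ} (ht : n * ‖t‖ * M < 1) (N : ℕ) :
    (fun (u : Fin N → ℂ) k => shift χ t (u k)) '' domain S N = domain S N := by
  ext v
  simp only [domain, mem_image, mem_univ_pi]
  constructor
  · rintro ⟨u, hu, rfl⟩ k
    exact (h.shift_mem_iff ht).2 (hu k)
  · intro hv
    choose u hu using fun k => h.shift_surjective ht (v k)
    exact ⟨u, fun k => (h.shift_mem_iff ht).1 (by rw [hu]; exact hv k), funext hu⟩

end IsCutoff

/-- The partial derivatives of the cut-off functions at a point. -/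
def gradient (χ : Fin n → ℂ → ℝ) (x : ℂ) : Fin n → ℝ × ℝ := fun i =>
  (fderiv ℝ (χ i) x 1, fderiv ℝ (χ i) x Complex.I)

/-- The Jacobian determinant of `shift χ t`, in terms of the gradients `p` of the `χᵢ`. -/
def jacobian (t : Fin n → ℂ) (p : Fin n → ℝ × ℝ) : ℝ :=
  (1 + ∑ i, t i * ((p i).1 : ℂ)).re * (Complex.I + ∑ i, t i * ((p i).2 : ℂ)).im -
    (1 + ∑ i, t i * ((p i).1 : ℂ)).im * (Complex.I + ∑ i, t i * ((p i).2 : ℂ)).re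

theorem det_eq (A : ℂ →L[ℝ] ℂ) :
    A.det = (A 1).re * (A Complex.I).im - (A 1).im * (A Complex.I).re := by
  rw [ContinuousLinearMap.det, ← LinearMap.det_toMatrix Complex.basisOneI, Matrix.det_fin_two]
  simp [LinearMap.toMatrix_apply]
  ring

/-- The derivative of `shift χ t` at `x`. -/
def shiftDeriv (χ : Fin n → ℂ → ℝ) (t : Fin n → ℂ) (x : ℂ) : ℂ →L[ℝ] ℂ :=
  ContinuousLinearMap.id ℝ ℂ + ∑ i, (fderiv ℝ (χ i) x).smulRight (t i)

theorem det_shiftDeriv (χ : Fin n → ℂ → ℝ) (t : Fin n → ℂ) (x : ℂ) :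
    (shiftDeriv χ t x).det = jacobian t (gradient χ x) := by
  have e : ∀ y, shiftDeriv χ t x y = y + ∑ i, t i * ((fderiv ℝ (χ i) x y : ℝ) : ℂ) := by
    intro y
    simp [shiftDeriv, mul_comm]
  rw [det_eq, e, e, jacobian]
  rfl

theorem IsCutoff.hasFDerivAt {S : Scheme} {z : Fin n → ℂ} {χ : Fin n → ℂ → ℝ} {M : ℝ}
    (h : IsCutoff S z χ M) (t : Fin n → ℂ) (x : ℂ) :
    HasFDerivAt (shift χ t) (shiftDeriv χ t x) x := by
  have h1 : ∀ i, HasFDerivAt (fun x => χ i x • t i) ((fderiv ℝ (χ i) x).smulRight (t i)) x :=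
    fun i => (((h.contDiff i).differentiable (by simp)) x).hasFDerivAt.smul_const (t i)
  have h2 := (hasFDerivAt_id x).add (HasFDerivAt.fun_sum fun i (_ : i ∈ Finset.univ) => h1 i)
  refine h2.congr_of_eventuallyEq (Filter.Eventually.of_forall fun y => ?_)
  simp [shift, mul_comm]

theorem IsCutoff.norm_gradient_le {S : Scheme} {z : Fin n → ℂ} {χ : Fin n → ℂ → ℝ} {M : ℝ}
    (h : IsCutoff S z χ M) (x : ℂ) : ‖gradient χ x‖ ≤ M := by
  refine (pi_norm_le_iff_of_nonneg h.nonneg).2 fun i => ?_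
  have h1 : ‖fderiv ℝ (χ i) x‖ ≤ M := by
    refine norm_fderiv_le_of_lipschitz ℝ (C := ⟨M, h.nonneg⟩)
      (LipschitzWith.of_dist_le_mul fun x y => ?_)
    rw [Real.dist_eq, dist_eq_norm]
    exact h.lipschitz i x y
  have h2 : ∀ y : ℂ, ‖y‖ = 1 → ‖fderiv ℝ (χ i) x y‖ ≤ M := fun y hy =>
    ((fderiv ℝ (χ i) x).le_opNorm y).trans (by rw [hy, mul_one]; exact h1)
  exact max_le (h2 1 norm_one) (h2 Complex.I Complex.norm_I)

theorem measurableSet_domain (S : Scheme) (N : ℕ) : MeasurableSet (domain S N) :=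
  MeasurableSet.univ_pi fun _ => Metric.isOpen_eball.measurableSet

/-- The change of variables `u ↦ shift χ t ∘ u` in an integral over the positions of the interaction
vertices. -/
theorem IsCutoff.integral_domain {S : Scheme} {z : Fin n → ℂ} {χ : Fin n → ℂ → ℝ} {M : ℝ}
    (h : IsCutoff S z χ M) {t : Fin n → ℂ} (ht : n * ‖t‖ * M < 1) (N : ℕ)
    (g : (Fin N → ℂ) → ℂ) :
    ∫ u in domain S N, g u = ∫ u in domain S N,
      (∏ k, |jacobian t (gradient χ (u k))|) • g (fun k => shift χ t (u k)) := by
  have key := integral_image_eq_integral_abs_det_fderiv_smul (volume : Measure (Fin N → ℂ))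
    (measurableSet_domain S N) (f := fun (u : Fin N → ℂ) k => shift χ t (u k))
    (f' := fun u => ContinuousLinearMap.pi fun k =>
      (shiftDeriv χ t (u k)).comp (ContinuousLinearMap.proj k))
    (fun u _ => (hasFDerivAt_pi.2 fun k =>
      HasFDerivAt.comp (g := shift χ t) (f := fun u : Fin N → ℂ => u k) u
        (h.hasFDerivAt t (u k)) (hasFDerivAt_apply k u)).hasFDerivWithinAt)
    (fun u _ v _ huv => funext fun k => h.shift_injective ht (congrFun huv k)) g
  rw [h.image_domain ht] at key
  rw [key]
  refine integral_congr_ae (Filter.Eventually.of_forall fun u => ?_)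
  dsimp only
  congr 1
  have : (ContinuousLinearMap.pi fun k =>
      (shiftDeriv χ t (u k)).comp (ContinuousLinearMap.proj k)).det =
      ∏ k, (shiftDeriv χ t (u k)).det :=
    LinearMap.det_pi fun k => (shiftDeriv χ t (u k) : ℂ →ₗ[ℝ] ℂ)
  rw [this, Finset.abs_prod]
  simp_rw [det_shiftDeriv]

/-! ### Smoothness of the integral of a forest -/

open MeasureTheory Set
open scoped ContDiff ComplexConjugate ENNReal

variable {n : ℕ}

/-- Parameters on which an edge depends after the change of variables: the slope between its ends,
its propagator times its length, and its length if the propagator is a logarithm. -/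
abbrev EdgeParam (n : ℕ) := (Fin n → ℂ) × ℂ × ℝ

/-- The values of the parameters for an edge from `a` to `b`, where the letter `x` of charge `+1`
sits at `a`. -/
def edgeParam (χ : Fin n → ℂ → ℝ) (C : ℂ) (x : Letter) (a b : ℂ) : EdgeParam n :=
  (slope χ a b, (‖b - a‖ : ℂ) * outGreen C x a b,
    match x with
    | .b => ‖b - a‖
    | _ => 0)

/-- The propagator of an edge after the change of variables `shift χ t`, times the length of the
edge before it. -/
def edgeFactor (x : Letter) (t : Fin n → ℂ) (q : EdgeParam n) : ℂ :=
  match x with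
  | .gamma => q.2.1 * (stretch t q.1)⁻¹
  | .db => q.2.1 * (stretch t q.1)⁻¹
  | .gammaBar => q.2.1 * (conj (stretch t q.1))⁻¹
  | .dbBar => q.2.1 * (conj (stretch t q.1))⁻¹
  | .b => q.2.1 + q.2.2 * (2 * (Real.log ‖stretch t q.1‖ : ℂ))
  | _ => 0

/-- The factor `stretch` divides an inverse distance and adds to a logarithm, so after the change of
variables a propagator is still the inverse of the original length times a bounded factor. -/
theorem outGreen_shift (χ : Fin n → ℂ → ℝ) (C : ℂ) (x : Letter) (t : Fin n → ℂ) {a b : ℂ}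
    (hab : a ≠ b) (hs : stretch t (slope χ a b) ≠ 0) :
    outGreen C x (shift χ t a) (shift χ t b) =
      ((‖b - a‖⁻¹ : ℝ) : ℂ) * edgeFactor x t (edgeParam χ C x a b) := by
  have h0 : b - a ≠ 0 := sub_ne_zero.2 hab.symm
  have h1 : (‖b - a‖ : ℂ) ≠ 0 := by exact_mod_cast norm_ne_zero_iff.2 h0
  have e1 := shift_sub_shift χ t a b
  have e2 : shift χ t a - shift χ t b = (a - b) * stretch t (slope χ a b) := by
    rw [← neg_sub, e1]; ring
  have h0' : a - b ≠ 0 := sub_ne_zero.2 hab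
  cases x
  case b =>
    simp only [outGreen, edgeFactor, edgeParam]
    rw [e1, norm_mul, Real.log_mul (norm_ne_zero_iff.2 h0) (norm_ne_zero_iff.2 hs)]
    push_cast
    field_simp
    ring
  all_goals
    simp only [outGreen, edgeFactor, edgeParam, mul_zero, ← map_sub, e1, e2, map_mul]
  all_goals
    push_cast
    field_simp

theorem contDiffAt_edgeFactor (x : Letter) {p : (Fin n → ℂ) × EdgeParam n}
    (hp : stretch p.1 p.2.1 ≠ 0) :
    ContDiffAt ℝ ∞ (fun p : (Fin n → ℂ) × EdgeParam n => edgeFactor x p.1 p.2) p := by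
  have hs : ContDiffAt ℝ ∞ (fun p : (Fin n → ℂ) × EdgeParam n => stretch p.1 p.2.1) p := by
    unfold stretch; fun_prop
  have hc : ContDiffAt ℝ ∞ (fun p : (Fin n → ℂ) × EdgeParam n => conj (stretch p.1 p.2.1)) p :=
    Complex.conjCLE.contDiff.contDiffAt.comp p hs
  have hc0 : conj (stretch p.1 p.2.1) ≠ 0 := by simpa using hp
  have hl : ContDiffAt ℝ ∞
      (fun p : (Fin n → ℂ) × EdgeParam n => (Real.log ‖stretch p.1 p.2.1‖ : ℂ)) p :=
    Complex.ofRealCLM.contDiff.contDiffAt.comp p ((hs.norm ℝ hp).log (norm_ne_zero_iff.2 hp))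
  have hr : ContDiffAt ℝ ∞ (fun p : (Fin n → ℂ) × EdgeParam n => (p.2.2.2 : ℂ)) p :=
    Complex.ofRealCLM.contDiff.contDiffAt.comp p (by fun_prop)
  have hq : ContDiffAt ℝ ∞ (fun p : (Fin n → ℂ) × EdgeParam n => p.2.2.1) p := by fun_prop
  cases x
  case gamma => exact hq.mul (hs.inv hp)
  case db => exact hq.mul (hs.inv hp)
  case gammaBar => exact hq.mul (hc.inv hc0)
  case dbBar => exact hq.mul (hc.inv hc0)
  case b => exact hq.add (hr.mul (contDiffAt_const.mul hl))
  all_goals exact contDiffAt_const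

theorem measurable_outGreen (C : ℂ) (x : Letter) :
    Measurable fun p : ℂ × ℂ => outGreen C x p.1 p.2 := by
  have hc : Measurable fun z : ℂ => conj z := Complex.continuous_conj.measurable
  cases x <;> unfold outGreen
  case gammaBar =>
    exact measurable_const.div ((hc.comp measurable_snd).sub (hc.comp measurable_fst))
  case dbBar =>
    exact measurable_const.div ((hc.comp measurable_fst).sub (hc.comp measurable_snd))
  all_goals fun_prop

theorem IsCutoff.measurable_edgeParam {S : Scheme} {z : Fin n → ℂ} {χ : Fin n → ℂ → ℝ} {M : ℝ}
    (h : IsCutoff S z χ M) (C : ℂ) (x : Letter) :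
    Measurable fun p : ℂ × ℂ => edgeParam χ C x p.1 p.2 := by
  have h1 : Measurable fun p : ℂ × ℂ => slope χ p.1 p.2 := by
    have hm : ∀ i, Measurable (χ i) := fun i => (h.contDiff i).continuous.measurable
    unfold slope
    fun_prop
  have h2 := measurable_outGreen C x
  refine h1.prodMk ((by fun_prop : Measurable fun p : ℂ × ℂ =>
    (‖p.2 - p.1‖ : ℂ) * outGreen C x p.1 p.2).prodMk ?_)
  cases x
  case b => fun_prop
  all_goals exact measurable_const

/-- A propagator is bounded by a multiple of the inverse distance; for the logarithmic one this
holds in a bounded region only. -/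
theorem exists_outGreen_bound (S : Scheme) (x : Letter) (hx : x = .b → S.R < ⊤) :
    ∃ B : ℝ, 0 ≤ B ∧ ∀ a ∈ Metric.eball (0 : ℂ) S.R, ∀ b ∈ Metric.eball (0 : ℂ) S.R,
      ‖b - a‖ * ‖outGreen S.C x a b‖ ≤ B ∧ (x = .b → ‖b - a‖ ≤ B) := by
  have hle : ∀ a b : ℂ, ‖b - a‖ * ‖b - a‖⁻¹ ≤ 1 := fun a b => mul_inv_le_one
  have hle' : ∀ a b : ℂ, ‖b - a‖ * ‖a - b‖⁻¹ ≤ 1 := fun a b => by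
    rw [norm_sub_rev a b]; exact hle a b
  cases x
  case b =>
    obtain ⟨R, hR⟩ : ∃ R : NNReal, S.R = R := ⟨S.R.toNNReal, (ENNReal.coe_toNNReal (hx rfl).ne).symm⟩
    obtain ⟨B, hB⟩ := (isCompact_Icc (a := (0 : ℝ)) (b := 2 * R)).exists_bound_of_continuousOn
      (f := fun t : ℝ => t * Real.log t) Real.continuous_mul_log.continuousOn
    have hB0 : 0 ≤ B := (norm_nonneg _).trans (hB 0 ⟨le_rfl, by positivity⟩)
    refine ⟨2 * B + 2 * R * ‖S.C‖ + 2 * R, by positivity, fun a ha b hb => ?_⟩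
    rw [hR, Metric.eball_coe, mem_ball_zero_iff] at ha hb
    have hab : ‖b - a‖ ≤ 2 * R := (norm_sub_le _ _).trans (by linarith)
    have hC : 0 ≤ 2 * (R : ℝ) * ‖S.C‖ := by positivity
    refine ⟨?_, fun _ => by linarith [R.2, show (0 : ℝ) ≤ R from R.2]⟩
    have h1 := hB ‖b - a‖ ⟨norm_nonneg _, hab⟩
    rw [norm_mul, norm_norm] at h1
    simp only [outGreen]
    calc ‖b - a‖ * ‖2 * (Real.log ‖b - a‖ : ℂ) + S.C‖
        ≤ ‖b - a‖ * (2 * ‖Real.log ‖b - a‖‖ + ‖S.C‖) := by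
          gcongr
          refine (norm_add_le _ _).trans ?_
          rw [norm_mul, Complex.norm_real]
          simp
      _ = 2 * (‖b - a‖ * ‖Real.log ‖b - a‖‖) + ‖b - a‖ * ‖S.C‖ := by ring
      _ ≤ 2 * B + 2 * R * ‖S.C‖ := by gcongr
      _ ≤ _ := by linarith [show (0 : ℝ) ≤ R from R.2]
  all_goals
    refine ⟨1, zero_le_one, fun a _ b _ => ⟨?_, fun h => by simp at h⟩⟩
    simp only [outGreen, ← map_sub, one_div, norm_inv, RCLike.norm_conj, norm_zero, mul_zero,
      zero_le_one]
  all_goals first | exact hle a b | exact hle' a b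

theorem IsCutoff.norm_edgeParam_le {S : Scheme} {z : Fin n → ℂ} {χ : Fin n → ℂ → ℝ} {M : ℝ}
    (h : IsCutoff S z χ M) {x : Letter} {a b : ℂ} {B : ℝ} (hB : 0 ≤ B)
    (h1 : ‖b - a‖ * ‖outGreen S.C x a b‖ ≤ B) (h2 : x = .b → ‖b - a‖ ≤ B) :
    ‖edgeParam χ S.C x a b‖ ≤ max M B := by
  refine max_le ((h.norm_slope_le a b).trans (le_max_left _ _)) (le_trans ?_ (le_max_right _ _))
  refine max_le ?_ ?_
  · dsimp only [edgeParam]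
    rw [norm_mul, Complex.norm_real, norm_norm]
    exact h1
  · cases x
    case b => simpa [edgeParam] using h2 rfl
    all_goals simpa [edgeParam] using hB

namespace Diagram

variable {N : ℕ} {Φ : Fin n → Insertion} {Γ : Diagram Φ N}

theorem IsForest.noSelfContraction (hΓ : Γ.IsForest) : Γ.NoSelfContraction := by
  intro v s h
  have := hΓ.depth_out h
  omega

/-- The product of the inverse lengths of the edges. -/
def edgeWeight (Γ : Diagram Φ N) (z : Fin n → ℂ) (u : Fin N → ℂ) : ℝ :=
  ∏ h ∈ Γ.outgoing, ‖points z u (Γ.pairing.1 h) - points z u h‖⁻¹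

theorem IsForest.integrable_edgeWeight (hΓ : Γ.IsForest) {z : Fin n → ℂ}
    (hz : Function.Injective z) : Integrable (Γ.edgeWeight z) := by
  have hm := measurable_points (N := N) z
  refine ⟨Measurable.aestronglyMeasurable (by unfold edgeWeight; fun_prop), ?_⟩
  refine lt_of_le_of_lt (lintegral_mono fun u => ?_) (hΓ.lintegral_prod_K_lt_top hz)
  rw [edgeWeight, enorm_eq_nnnorm, nnnorm_prod, ENNReal.ofNNReal_finsetProd]
  refine Finset.prod_le_prod' fun h _ => ?_
  rw [K, ENNReal.rpow_neg_one]
  rcases eq_or_ne (points z u (Γ.pairing.1 h) - points z u h) 0 with h0 | h0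
  · simp [h0]
  · rw [← enorm_eq_nnnorm, enorm_inv (norm_ne_zero_iff.2 h0), enorm_norm]

theorem points_shift {χ : Fin n → ℂ → ℝ} {S : Scheme} {z : Fin n → ℂ} {M : ℝ}
    (h : IsCutoff S z χ M) (t : Fin n → ℂ) (u : Fin N → ℂ) (k : HalfEdge n N) :
    points (z + t) (fun k => shift χ t (u k)) k = shift χ t (points z u k) := by
  rcases k with i | ⟨v, s⟩
  · exact (h.shift_apply t i).symm
  · rfl

theorem points_mem {S : Scheme} {z : Fin n → ℂ} (hz : z ∈ conf S n) {u : Fin N → ℂ}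
    (hu : u ∈ domain S N) (h : HalfEdge n N) : points z u h ∈ Metric.eball (0 : ℂ) S.R := by
  rcases h with i | ⟨v, s⟩
  · exact hz.2 i
  · exact hu v (mem_univ v)

/-- The interaction contains `b` only with derivatives. -/
theorem letters_eq_b {kind : Fin N → VertexKind} {h : HalfEdge n N}
    (hh : letters Φ kind h = .b) : ∃ i, (Φ i).IsBareB := by
  rcases h with i | ⟨v, s⟩
  · refine ⟨i, ?_⟩
    simp only [letters, Sum.elim_inl] at hh
    unfold Insertion.IsBareB
    rcases e : Φ i with ⟨_ | _ | _ | _ | _ | _, _ | p, _ | q⟩ <;>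
      simp_all [Insertion.letter]
  · simp only [letters, Sum.elim_inr] at hh
    exfalso
    revert hh
    cases kind v <;> fin_cases s <;> simp [VertexKind.letter]

section Smooth

variable {𝕜 L ι : Type*} [Field 𝕜] [Algebra 𝕜 ℂ] [LieRing L] [LieAlgebra 𝕜 L] [Fintype ι]

/-- The product of the signs and the color factor in the integrand of a diagram. -/
def coefficient (B : Module.Basis ι 𝕜 L) (e : Fin n → ι) (Γ : Diagram Φ N) : ℂ :=
  (∏ k, (Γ.kind k).sign) * Γ.colorFactor B e * Γ.wickSign

/-- The factor of the integrand, after the change of variables, that depends smoothly on the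
parameters `t` and on bounded functions of the positions. -/
def smoothFactor (Γ : Diagram Φ N)
    (p : (Fin n → ℂ) × (HalfEdge n N → EdgeParam n) × (Fin N → Fin n → ℝ × ℝ)) : ℂ :=
  ((∏ k, |jacobian p.1 (p.2.2 k)| : ℝ) : ℂ) *
    ∏ h ∈ Γ.outgoing, edgeFactor (letters Φ Γ.kind h) p.1 (p.2.1 h)

/-- The region in which `smoothFactor` is smooth. -/
def smoothRegion (n N : ℕ) :
    Set ((Fin n → ℂ) × (HalfEdge n N → EdgeParam n) × (Fin N → Fin n → ℝ × ℝ)) :=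
  {p | (∀ h, stretch p.1 (p.2.1 h).1 ≠ 0) ∧ ∀ k, jacobian p.1 (p.2.2 k) ≠ 0}

theorem isOpen_smoothRegion (n N : ℕ) : IsOpen (smoothRegion n N) := by
  have e : smoothRegion n N =
      (⋂ h, {p | stretch p.1 (p.2.1 h).1 ≠ 0}) ∩ ⋂ k, {p | jacobian p.1 (p.2.2 k) ≠ 0} := by
    ext p; simp [smoothRegion]
  rw [e]
  refine (isOpen_iInter_of_finite fun h => ?_).inter (isOpen_iInter_of_finite fun k => ?_)
  · exact isOpen_ne_fun (by unfold stretch; fun_prop) continuous_const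
  · exact isOpen_ne_fun (by unfold jacobian; fun_prop) continuous_const

theorem contDiffOn_smoothFactor (Γ : Diagram Φ N) :
    ContDiffOn ℝ ∞ Γ.smoothFactor (smoothRegion n N) := by
  intro p hp
  have h1 : ∀ k, ContDiffAt ℝ ∞ (fun p : (Fin n → ℂ) × (HalfEdge n N → EdgeParam n) ×
      (Fin N → Fin n → ℝ × ℝ) => |jacobian p.1 (p.2.2 k)|) p := by
    intro k
    refine ContDiffAt.comp (g := fun x : ℝ => |x|) p (contDiffAt_abs (hp.2 k)) ?_
    have hre : ContDiff ℝ ∞ Complex.re := Complex.reCLM.contDiff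
    have him : ContDiff ℝ ∞ Complex.im := Complex.imCLM.contDiff
    have hof : ContDiff ℝ ∞ Complex.ofReal := Complex.ofRealCLM.contDiff
    unfold jacobian
    fun_prop
  have h2 : ∀ h, ContDiffAt ℝ ∞ (fun p : (Fin n → ℂ) × (HalfEdge n N → EdgeParam n) ×
      (Fin N → Fin n → ℝ × ℝ) => edgeFactor (letters Φ Γ.kind h) p.1 (p.2.1 h)) p := fun h =>
    (contDiffAt_edgeFactor (letters Φ Γ.kind h) (p := (p.1, p.2.1 h)) (hp.1 h)).comp p
      (f := fun p : (Fin n → ℂ) × (HalfEdge n N → EdgeParam n) × (Fin N → Fin n → ℝ × ℝ) =>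
        (p.1, p.2.1 h)) (by fun_prop)
  have h3 := Complex.ofRealCLM.contDiff.contDiffAt.comp p
    (contDiffAt_prod (t := Finset.univ) fun k _ => h1 k)
  have h4 := contDiffAt_prod (t := Γ.outgoing) fun h _ => h2 h
  exact (h3.mul h4).contDiffWithinAt

/-- The bounded functions of the positions on which the integrand depends after the change of
variables. -/
def edgeParams (Γ : Diagram Φ N) (χ : Fin n → ℂ → ℝ) (C : ℂ) (z : Fin n → ℂ) (u : Fin N → ℂ) :
    (HalfEdge n N → EdgeParam n) × (Fin N → Fin n → ℝ × ℝ) :=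
  (fun h => edgeParam χ C (letters Φ Γ.kind h) (points z u h) (points z u (Γ.pairing.1 h)),
    fun k => gradient χ (u k))

/-- After the change of variables, the parameters `t` no longer enter the singular factor of the
integrand. -/
theorem IsForest.integrand_shift (hΓ : Γ.IsForest) (S : Scheme) (B : Module.Basis ι 𝕜 L)
    (e : Fin n → ι) {z : Fin n → ℂ} {χ : Fin n → ℂ → ℝ} {M : ℝ} (h : IsCutoff S z χ M)
    {t : Fin n → ℂ} (ht : n * ‖t‖ * M < 1) {u : Fin N → ℂ}
    (hu : Function.Injective (Sum.elim z u)) :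
    (∏ k, |jacobian t (gradient χ (u k))|) •
        Γ.integrand S B e (z + t) (fun k => shift χ t (u k)) =
      Γ.edgeWeight z u • (Γ.coefficient B e * Γ.smoothFactor (t, Γ.edgeParams χ S.C z u)) := by
  have hinj : Function.Injective (Sum.elim (z + t) fun k => shift χ t (u k)) := by
    have : Sum.elim (z + t) (fun k => shift χ t (u k)) = shift χ t ∘ Sum.elim z u := by
      funext x
      rcases x with i | k
      · exact (h.shift_apply t i).symm
      · rfl
    rw [this]
    exact (h.shift_injective ht).comp hu
  rw [integrand_eq_of_ne S B e Γ fun k => points_ne hΓ.noSelfContraction hinj k]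
  have hne := points_ne hΓ.noSelfContraction hu
  have : ∏ k ∈ Γ.outgoing, outGreen S.C (letters Φ Γ.kind k)
        (points (z + t) (fun k => shift χ t (u k)) k)
        (points (z + t) (fun k => shift χ t (u k)) (Γ.pairing.1 k)) =
      (Γ.edgeWeight z u : ℂ) * ∏ k ∈ Γ.outgoing, edgeFactor (letters Φ Γ.kind k) t
        ((Γ.edgeParams χ S.C z u).1 k) := by
    rw [edgeWeight, Complex.ofReal_prod, ← Finset.prod_mul_distrib]
    refine Finset.prod_congr rfl fun k _ => ?_
    rw [points_shift h, points_shift h, outGreen_shift χ S.C _ t (hne k) (h.stretch_ne_zero ht _ _)]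
    rfl
  rw [this, coefficient, smoothFactor, Complex.real_smul, Complex.real_smul]
  simp only [edgeParams]
  ring

/-- The propagators of a diagram times the lengths of the edges are bounded. -/
theorem exists_edge_bound (Γ : Diagram Φ N) {S : Scheme}
    (hb : (∀ i, ¬ (Φ i).IsBareB) ∨ S.R < ⊤) :
    ∃ b : ℝ, 0 ≤ b ∧ ∀ z ∈ conf S n, ∀ u ∈ domain S N, ∀ h,
      ‖points z u (Γ.pairing.1 h) - points z u h‖ *
        ‖outGreen S.C (letters Φ Γ.kind h) (points z u h) (points z u (Γ.pairing.1 h))‖ ≤ b ∧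
      (letters Φ Γ.kind h = .b → ‖points z u (Γ.pairing.1 h) - points z u h‖ ≤ b) := by
  have h1 : ∀ h, letters Φ Γ.kind h = .b → S.R < ⊤ := by
    intro h hh
    obtain ⟨i, hi⟩ := letters_eq_b hh
    exact hb.resolve_left fun h => h i hi
  choose b hb0 hb using fun h => exists_outGreen_bound S (letters Φ Γ.kind h) (h1 h)
  have hle : ∀ h, b h ≤ ∑ h, b h := fun h =>
    Finset.single_le_sum (fun h _ => hb0 h) (Finset.mem_univ h)
  refine ⟨∑ h, b h, Finset.sum_nonneg fun h _ => hb0 h, fun z hz u hu h => ?_⟩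
  have := hb h _ (points_mem hz hu h) _ (points_mem hz hu (Γ.pairing.1 h))
  exact ⟨this.1.trans (hle h), fun hh => (this.2 hh).trans (hle h)⟩

theorem IsForest.integrableOn_integrand (hΓ : Γ.IsForest) {S : Scheme} (B : Module.Basis ι 𝕜 L)
    (e : Fin n → ι) (hb : (∀ i, ¬ (Φ i).IsBareB) ∨ S.R < ⊤) {z : Fin n → ℂ}
    (hz : z ∈ conf S n) : IntegrableOn (Γ.integrand S B e z) (domain S N) := by
  obtain ⟨b, hb0, hbd⟩ := Γ.exists_edge_bound hb
  have hm := measurable_points (N := N) z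
  have hg := fun x => measurable_outGreen S.C x
  have hae : ∀ᵐ u ∂volume.restrict (domain S N),
      Γ.coefficient B e * ∏ h ∈ Γ.outgoing, outGreen S.C (letters Φ Γ.kind h) (points z u h)
        (points z u (Γ.pairing.1 h)) = Γ.integrand S B e z u := by
    filter_upwards [ae_restrict_of_ae (ae_injective hz.1 N)] with u hu
    rw [integrand_eq_of_ne S B e Γ fun k => points_ne hΓ.noSelfContraction hu k, coefficient]
    ring
  refine Integrable.congr ?_ hae
  refine Integrable.mono' ((hΓ.integrable_edgeWeight hz.1).restrict.const_mul
    (‖Γ.coefficient B e‖ * b ^ Γ.outgoing.card)) ?_ ?_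
  · refine (Measurable.const_mul (Finset.measurable_prod _ fun h _ => ?_) _).aestronglyMeasurable
    exact (hg _).comp ((hm h).prodMk (hm _))
  · filter_upwards [ae_restrict_of_ae (ae_injective hz.1 N),
      ae_restrict_mem (measurableSet_domain S N)] with u hu hud
    rw [norm_mul, norm_prod, mul_assoc, edgeWeight, ← Finset.prod_const, ← Finset.prod_mul_distrib]
    refine mul_le_mul_of_nonneg_left (Finset.prod_le_prod (fun _ _ => norm_nonneg _) fun h _ => ?_)
      (norm_nonneg _)
    have hne := points_ne hΓ.noSelfContraction hu h
    rw [← div_eq_mul_inv, le_div_iff₀ (norm_pos_iff.2 (sub_ne_zero.2 hne.symm)), mul_comm]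
    exact (hbd z hz u hud h).1

set_option synthInstance.maxHeartbeats 200000 in
set_option synthInstance.maxSize 2000 in
/-- The integral of a forest, written with the change of variables `shift χ t` near a configuration
`z`, is the integral of a fixed integrable weight against a smooth function of `t`. -/
theorem IsForest.contDiffAt_integral (hΓ : Γ.IsForest) {S : Scheme} (B : Module.Basis ι 𝕜 L)
    (e : Fin n → ι) (hb : (∀ i, ¬ (Φ i).IsBareB) ∨ S.R < ⊤) {z : Fin n → ℂ}
    (hz : z ∈ conf S n) : ContDiffAt ℝ ∞ (Γ.integral S B e) z := by
  obtain ⟨χ, M, h⟩ := exists_isCutoff hz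
  obtain ⟨b, hb0, hbd⟩ := Γ.exists_edge_bound hb
  have hm := measurable_points (N := N) z
  have hgrad : Measurable (gradient χ) := by
    refine measurable_pi_lambda _ fun i => ?_
    have h1 : Continuous (fderiv ℝ (χ i)) := (h.contDiff i).continuous_fderiv (by simp)
    exact ((h1.clm_apply continuous_const).prodMk (h1.clm_apply continuous_const)).measurable
  have hq : Measurable (Γ.edgeParams χ S.C z) := by
    refine Measurable.prodMk (measurable_pi_lambda _ fun k => ?_) (measurable_pi_lambda _ fun k => ?_)
    · exact (h.measurable_edgeParam S.C _).comp ((hm k).prodMk (hm _))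
    · exact hgrad.comp (measurable_pi_apply k)
  have hqb : ∀ᵐ u ∂volume.restrict (domain S N), ‖Γ.edgeParams χ S.C z u‖ ≤ max M b := by
    filter_upwards [ae_restrict_mem (measurableSet_domain S N)] with u hu
    have h0 : 0 ≤ max M b := hb0.trans (le_max_right _ _)
    refine max_le ((pi_norm_le_iff_of_nonneg h0).2 fun k => ?_)
      ((pi_norm_le_iff_of_nonneg h0).2 fun k => (h.norm_gradient_le _).trans (le_max_left _ _))
    exact h.norm_edgeParam_le hb0 (hbd z hz u hu k).1 (hbd z hz u hu k).2
  have key := contDiffAt_integral_smul (T := Fin n → ℂ)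
    (hΓ.integrable_edgeWeight hz.1).restrict hq (hb0.trans (le_max_right _ _)) hqb
    (isOpen_smoothRegion n N) (fun x _ => by simp [smoothRegion, stretch, jacobian])
    (contDiffOn_const.mul Γ.contDiffOn_smoothFactor :
      ContDiffOn ℝ ∞ (fun p => Γ.coefficient B e * Γ.smoothFactor p) _)
  have hsmall : ∀ᶠ t : Fin n → ℂ in nhds 0, n * ‖t‖ * M < 1 := by
    have : ContinuousAt (fun t : Fin n → ℂ => n * ‖t‖ * M) 0 := by fun_prop
    exact this.eventually_lt continuousAt_const (by simp)
  have hloc : ContDiffAt ℝ ∞ (fun t => Γ.integral S B e (z + t)) 0 := by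
    refine (contDiffAt_const (c := expWeight N)).mul (key.congr_of_eventuallyEq ?_)
    filter_upwards [hsmall] with t ht
    rw [h.integral_domain ht]
    refine integral_congr_ae ?_
    filter_upwards [ae_restrict_of_ae (ae_injective hz.1 N)] with u hu
    exact hΓ.integrand_shift S B e h ht hu
  have hcomp : Γ.integral S B e = (fun t => Γ.integral S B e (z + t)) ∘ fun w => w - z := by
    funext w
    simp
  rw [hcomp]
  exact ContDiffAt.comp z (by rw [sub_self]; exact hloc) (by fun_prop)

end Smooth

end Diagram

/-! ### The correlator as a sum over forests -/

open MeasureTheory Set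
open scoped ContDiff

variable {n : ℕ}

theorem isOpen_conf (S : Scheme) (n : ℕ) : IsOpen (conf S n) := by
  have e : conf S n = (⋂ i, ⋂ j, {z | i ≠ j → z i ≠ z j}) ∩
      ⋂ i, {z | z i ∈ Metric.eball (0 : ℂ) S.R} := by
    ext z
    simp only [conf, mem_ofPred_eq, mem_inter_iff, mem_iInter]
    refine and_congr_left fun _ => ⟨fun h i j hij => fun e => hij (h e), fun h i j e => ?_⟩
    by_contra hij
    exact h i j hij e
  rw [e]
  refine (isOpen_iInter_of_finite fun i => isOpen_iInter_of_finite fun j => ?_).inter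
    (isOpen_iInter_of_finite fun i => Metric.isOpen_eball.preimage (continuous_apply i))
  by_cases hij : i = j
  · simp [hij]
  · simpa [hij] using isOpen_ne_fun (continuous_apply i) (continuous_apply j)

/-- The properties of linear differential operators with constant coefficients that are needed to
apply them term by term: they are local, preserve smooth functions and are additive on these. -/
structure IsDiffOp (U : Set (Fin n → ℂ)) (D : ((Fin n → ℂ) → ℂ) → (Fin n → ℂ) → ℂ) : Prop where
  congr : ∀ F G, EqOn F G U → EqOn (D F) (D G) U
  contDiffOn : ∀ F, ContDiffOn ℝ ∞ F U → ContDiffOn ℝ ∞ (D F) U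
  add : ∀ F G, ContDiffOn ℝ ∞ F U → ContDiffOn ℝ ∞ G U →
    EqOn (D fun z => F z + G z) (fun z => D F z + D G z) U
  zero : EqOn (D fun _ => 0) (fun _ => 0) U

namespace IsDiffOp

variable {U : Set (Fin n → ℂ)} {D D' : ((Fin n → ℂ) → ℂ) → (Fin n → ℂ) → ℂ}

theorem comp (h : IsDiffOp U D) (h' : IsDiffOp U D') : IsDiffOp U fun F => D (D' F) where
  congr F G e := h.congr _ _ (h'.congr F G e)
  contDiffOn F hF := h.contDiffOn _ (h'.contDiffOn F hF)
  add F G hF hG := (h.congr _ _ (h'.add F G hF hG)).trans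
    (h.add _ _ (h'.contDiffOn F hF) (h'.contDiffOn G hG))
  zero := (h.congr _ _ h'.zero).trans h.zero

theorem refl : IsDiffOp U fun F => F where
  congr _ _ e := e
  contDiffOn _ hF := hF
  add _ _ _ _ := eqOn_refl _ _
  zero := eqOn_refl _ _

theorem iterate (h : IsDiffOp U D) (k : ℕ) : IsDiffOp U D^[k] := by
  induction k with
  | zero => exact refl
  | succ k ih => exact ih.comp h

theorem sum (h : IsDiffOp U D) {α : Type*} (s : Finset α) (F : α → (Fin n → ℂ) → ℂ)
    (hF : ∀ a ∈ s, ContDiffOn ℝ ∞ (F a) U) :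
    EqOn (D fun z => ∑ a ∈ s, F a z) (fun z => ∑ a ∈ s, D (F a) z) U := by
  classical
  induction s using Finset.induction_on with
  | empty => simpa using h.zero
  | insert a s ha ih =>
    simp_rw [Finset.sum_insert ha]
    have h1 := ih fun a ha => hF a (Finset.mem_insert_of_mem ha)
    have h2 : ContDiffOn ℝ ∞ (fun z => ∑ a ∈ s, F a z) U :=
      ContDiffOn.sum fun a ha => hF a (Finset.mem_insert_of_mem ha)
    intro z hz
    rw [h.add _ _ (hF a (Finset.mem_insert_self a s)) h2 hz]
    exact congrArg _ (h1 hz)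

/-- Linear combinations of directional derivatives are differential operators. -/
theorem of_fderiv (hU : IsOpen U) (c d : ℂ) (v w : Fin n → ℂ)
    (hD : ∀ F z, D F z = c * fderiv ℝ F z v + d * fderiv ℝ F z w) : IsDiffOp U D where
  congr F G e z hz := by
    have : fderiv ℝ F z = fderiv ℝ G z :=
      Filter.EventuallyEq.fderiv_eq (Filter.eventuallyEq_of_mem (hU.mem_nhds hz) e)
    rw [hD, hD, this]
  contDiffOn F hF := by
    have h1 : ContDiffOn ℝ ∞ (fderiv ℝ F) U := hF.fderiv_of_isOpen hU (by simp)
    have h2 : ∀ v, ContDiffOn ℝ ∞ (fun z => fderiv ℝ F z v) U := fun v =>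
      h1.clm_apply contDiffOn_const
    exact ((contDiffOn_const.mul (h2 v)).add (contDiffOn_const.mul (h2 w))).congr
      fun z _ => hD F z
  add F G hF hG z hz := by
    have hd : ∀ F : (Fin n → ℂ) → ℂ, ContDiffOn ℝ ∞ F U → DifferentiableAt ℝ F z := fun F hF =>
      (hF.contDiffAt (hU.mem_nhds hz)).differentiableAt (by simp)
    dsimp only
    rw [hD, hD, hD, fderiv_fun_add (hd F hF) (hd G hG), add_apply,
      add_apply]
    ring
  zero z _ := by
    dsimp only
    rw [hD]
    simp

theorem dz {U : Set (Fin n → ℂ)} (hU : IsOpen U) (i : Fin n) : IsDiffOp U (BF.dz i) :=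
  of_fderiv hU (1 / 2) (-Complex.I / 2) (Pi.single i 1) (Pi.single i Complex.I) fun F z => by
    rw [BF.dz]; ring

theorem dzBar {U : Set (Fin n → ℂ)} (hU : IsOpen U) (i : Fin n) : IsDiffOp U (BF.dzBar i) :=
  of_fderiv hU (1 / 2) (Complex.I / 2) (Pi.single i 1) (Pi.single i Complex.I) fun F z => by
    rw [BF.dzBar]; ring

theorem derivatives {U : Set (Fin n → ℂ)} (hU : IsOpen U) (Φ : Fin n → Insertion) :
    IsDiffOp U (BF.derivatives Φ) := by
  unfold BF.derivatives
  induction List.finRange n with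
  | nil => exact refl
  | cons i l ih => exact (((dz hU i).iterate _).comp ((dzBar hU i).iterate _)).comp ih

end IsDiffOp

section Correlator

variable {𝕜 L ι : Type*} [Field 𝕜] [Algebra 𝕜 ℂ] [LieRing L] [LieAlgebra 𝕜 L] [Fintype ι]
  {Φ : Fin n → Insertion}

open Classical in
/-- Almost everywhere, the full integrand is the sum of the integrands of the forests. -/
theorem ae_integrand_eq_sum_forests (hL : StronglyUnimodular 𝕜 L) (S : Scheme)
    (B : Module.Basis ι 𝕜 L) (e : Fin n → ι) {z : Fin n → ℂ} (hz : Function.Injective z) (N : ℕ) :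
    ∀ᵐ u : Fin N → ℂ, integrand S B Φ e N z u =
      ∑ Γ : Diagram Φ N with Γ.IsForest, Γ.integrand S B e z u := by
  filter_upwards [ae_injective hz N] with u hu
  rw [integrand_eq_sum_diagram, Diagram.sum_integrand_eq hL S B e hu]

open Classical in
/-- Each coefficient of the correlator is a sum over forests. -/
theorem coeff_correlator (hL : StronglyUnimodular 𝕜 L) {S : Scheme} (B : Module.Basis ι 𝕜 L)
    (e : Fin n → ι) (hb : (∀ i, ¬ (Φ i).IsBareB) ∨ S.R < ⊤) {z : Fin n → ℂ} (hz : z ∈ conf S n)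
    (N : ℕ) : (correlator S B Φ e z).coeff N =
      ∑ Γ : Diagram Φ N with Γ.IsForest, derivatives Φ (Γ.integral S B e) z := by
  have hD := IsDiffOp.derivatives (isOpen_conf S n) Φ
  rw [correlator, PowerSeries.coeff_mk]
  have hsum := hD.sum {Γ : Diagram Φ N | Γ.IsForest} (fun Γ : Diagram Φ N => Γ.integral S B e)
    (fun Γ hΓ w hw =>
      ((Finset.mem_filter.1 hΓ).2.contDiffAt_integral B e hb hw).contDiffWithinAt) hz
  refine (hD.congr _ _ (fun w hw => ?_) hz).trans hsum
  dsimp only [Diagram.integral]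
  rw [← Finset.mul_sum, ← integral_finsetSum _ fun Γ hΓ =>
    (Finset.mem_filter.1 hΓ).2.integrableOn_integrand B e hb hw]
  congr 1
  exact integral_congr_ae (ae_restrict_of_ae (ae_integrand_eq_sum_forests hL S B e hw.1 N))

/-- There are no diagrams in an order other than the total charge. -/
theorem coeff_correlator_eq_zero (S : Scheme) (B : Module.Basis ι 𝕜 L) (e : Fin n → ι)
    {z : Fin n → ℂ} (hz : z ∈ conf S n) {N : ℕ} (hN : (N : ℤ) ≠ ∑ i, (Φ i).charge) :
    (correlator S B Φ e z).coeff N = 0 := by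
  have : IsEmpty (Diagram Φ N) := ⟨fun Γ => hN Γ.card_vertices⟩
  have h0 : ∀ w u, integrand S B Φ e N w u = 0 := fun w u => by
    rw [integrand_eq_sum_diagram, Finset.univ_eq_empty, Finset.sum_empty]
  rw [correlator, PowerSeries.coeff_mk]
  simp_rw [h0, integral_zero, mul_zero]
  exact (IsDiffOp.derivatives (isOpen_conf S n) Φ).zero hz

open Classical in
/-- The finite set of all forests: their number of interaction vertices is the total charge. -/
def forests (Φ : Fin n → Insertion) : Finset (Σ N : ℕ, Diagram Φ N) :=
  (Finset.univ.filter fun Γ : Diagram Φ (∑ i, (Φ i).charge).toNat => Γ.IsForest).map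
    ⟨Sigma.mk _, sigma_mk_injective⟩

theorem mem_forests (Γ : Σ N : ℕ, Diagram Φ N) : Γ ∈ forests Φ ↔ Γ.2.IsForest := by
  simp only [forests, Finset.mem_map, Finset.mem_filter, Finset.mem_univ, true_and,
    Function.Embedding.coeFn_mk]
  constructor
  · rintro ⟨Γ, h, rfl⟩
    exact h
  · intro h
    obtain ⟨N, Γ⟩ := Γ
    obtain rfl : N = (∑ i, (Φ i).charge).toNat := by
      have := Γ.card_vertices
      omega
    exact ⟨Γ, h, rfl⟩

theorem correlator_eq_sum_forests (hL : StronglyUnimodular 𝕜 L) {S : Scheme}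
    (B : Module.Basis ι 𝕜 L) (e : Fin n → ι) (hb : (∀ i, ¬ (Φ i).IsBareB) ∨ S.R < ⊤)
    {z : Fin n → ℂ} (hz : z ∈ conf S n) :
    correlator S B Φ e z = ∑ Γ ∈ forests Φ, Γ.2.contribution S B e z := by
  ext N
  rw [map_sum, forests, Finset.sum_map]
  by_cases hN : N = (∑ i, (Φ i).charge).toNat
  · subst hN
    rw [coeff_correlator hL B e hb hz]
    exact Finset.sum_congr rfl fun Γ _ => by
      simp [Diagram.contribution]
  · rw [coeff_correlator_eq_zero S B e hz (by omega), Finset.sum_eq_zero]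
    intro Γ _
    simp [Diagram.contribution, PowerSeries.coeff_monomial, hN]

end Correlator

end BF

end

open scoped ContDiff in
theorem mainTheorem2 {𝕜 L ι : Type*} [Field 𝕜] [Algebra 𝕜 ℂ] [LieRing L] [LieAlgebra 𝕜 L]
    [Fintype ι] (B : Module.Basis ι 𝕜 L) (hL : BF.StronglyUnimodular 𝕜 L) (S : BF.Scheme)
    {n : ℕ} (Φ : Fin n → BF.Insertion) (e : Fin n → ι) :
    -- structure of the diagrams that are forests
    (∀ (N : ℕ) (Γ : BF.Diagram Φ N), Γ.IsForest →
      (∀ T : Γ.graph.ConnectedComponent, Γ.IsBinaryRootedTree T) ∧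
      (N : ℤ) = ∑ i, (Φ i).charge ∧
      Nat.card Γ.graph.ConnectedComponent = Nat.card {i : Fin n // (Φ i).charge = -1}) ∧
    -- only the order given by the total charge occurs
    (∀ z ∈ BF.conf S n, ∀ N : ℕ, (N : ℤ) ≠ ∑ i, (Φ i).charge →
      (BF.correlator S B Φ e z).coeff N = 0) ∧
    -- the finitely many forests give the correlator
    ∃ F : Finset (Σ N : ℕ, BF.Diagram Φ N), (∀ Γ, Γ ∈ F ↔ Γ.2.IsForest) ∧
      -- at the level of integrands, without any condition
      (∀ z ∈ BF.conf S n, ∀ (N : ℕ), ∀ᵐ u : Fin N → ℂ, BF.integrand S B Φ e N z u =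
        ∑ Γ : BF.Diagram Φ N, Set.indicator {Γ | Γ.IsForest} (fun Γ => Γ.integrand S B e z u) Γ) ∧
      -- as integrals, if `b` always occurs with a derivative or there is an infrared cut-off
      ((∀ i, ¬ (Φ i).IsBareB) ∨ S.R < ⊤ →
        (∀ Γ ∈ F,
          (∀ z ∈ BF.conf S n, MeasureTheory.IntegrableOn (Γ.2.integrand S B e z)
            (BF.domain S Γ.1)) ∧
          ContDiffOn ℝ ∞ (Γ.2.integral S B e) (BF.conf S n)) ∧
        ∀ z ∈ BF.conf S n, BF.correlator S B Φ e z = ∑ Γ ∈ F, Γ.2.contribution S B e z) := by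
  classical
  refine ⟨fun N Γ hΓ => ⟨hΓ.isBinaryRootedTree, Γ.card_vertices, hΓ.card_connectedComponent⟩,
    fun z hz N hN => BF.coeff_correlator_eq_zero S B e hz hN, BF.forests Φ, BF.mem_forests,
    fun z hz N => ?_, fun hb => ⟨fun Γ hΓ => ?_, fun z hz =>
      BF.correlator_eq_sum_forests hL B e hb hz⟩⟩
  · filter_upwards [BF.ae_integrand_eq_sum_forests (Φ := Φ) hL S B e hz.1 N] with u hu
    rw [hu, Finset.sum_filter]
    rfl
  · have hF := (BF.mem_forests Γ).1 hΓ
    exact ⟨fun z hz => hF.integrableOn_integrand B e hb hz,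
      fun z hz => (hF.contDiffAt_integral B e hb hz).contDiffWithinAt⟩
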